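/- Let $\tilde{\mathbb C}^2=\{(z,[t])\in\mathbb C^2\times\mathbb CP^1: t_1z_2-t_2z_1=0\}$ be the blow-up of $\mathbb C^2$ at the origin, and let $g_S$ be the Simanca metric on it, i.e. the Kähler metric whose Kähler form $\omega_S$ is the extension to $\tilde{\mathbb C}^2$ of the form $\frac{i}{2\pi}\partial\bar\partial\left(|z|^2+\log|z|^2\right)$ on $\mathbb C^2\setminus\{0\}$. There exist a holomorphic line bundle $L$ over $\tilde{\mathbb C}^2$ and Hermitian metrics $h_m$ on $L^m=L^{\otimes m}$, $m\ge 1$, such that $$-\frac{i}{2\pi}\partial\bar\partial\log h_m(\sigma,\sigma)=m\,\omega_S$$ for every local nowhere vanishing holomorphic section $\sigma$ of $L^m$. For every such choice of $L$ and $(h_m)_{m\ge1}$ and every $m\geq 1$, let $\mathcal H_m$ be the Hilbert space of global holomorphic sections $s$ of $L^m$ with $\langle s,s\rangle_{h_m}=\int_{\tilde{\mathbb C}^2} h_m(s,s)\frac{\omega_S^2}{2!}<\infty$, and let $$\epsilon_{mg_S}(x)=\sum_j h_m(s_j(x),s_j(x)),$$ where $(s_j)_j$ is an orthonormal basis of $\mathcal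 H_m$. Then $\epsilon_{mg_S}(x)=m^2$ for all $m\ge1$ and all $x\in\tilde{\mathbb C}^2$, independently of the choices. Moreover, $\epsilon_{mg_S}$ has a Tian–Yau–Zelditch expansion $$\epsilon_{mg_S}(x)\sim\sum_{j=0}^\infty a_j(x)\,m^{2-j}\qquad(m\to\infty)$$ with smooth functions $a_j$ on $\tilde{\mathbb C}^2$ (that is, for every $N\ge 0$, every derivative of $\epsilon_{mg_S}-\sum_{j=0}^N a_jm^{2-j}$ in local holomorphic coordinates is $O(m^{2-(N+1)})$ uniformly on compact sets), and in every such expansion $a_0=1$ and all the coefficients $a_j$ with $j\ge1$ vanish identically. -/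

import Mathlib

open scoped LinearAlgebra.Projectivization ContDiff

noncomputable section

namespace Simanca

/-! ### The blow-up of `ℂ²` at the origin and its two standard charts -/

/-- The quotient topology on the complex projective line. -/
instance instTopologicalSpaceProjectiveLine : TopologicalSpace (ℙ ℂ (ℂ × ℂ)) :=
  inferInstanceAs (TopologicalSpace (Quotient (projectivizationSetoid ℂ (ℂ × ℂ))))

/-- The blow-up of `ℂ²` at the origin: the pairs `(z, [t]) ∈ ℂ² × ℂP¹` such that
`t₁ z₂ - t₂ z₁ = 0`. -/
def BlowUp : Type :=
  {p : (ℂ × ℂ) × ℙ ℂ (ℂ × ℂ) // p.2.rep.1 * p.1.2 - p.2.rep.2 * p.1.1 = 0}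

instance instTopologicalSpaceBlowUp : TopologicalSpace BlowUp :=
  inferInstanceAs (TopologicalSpace
    {p : (ℂ × ℂ) × ℙ ℂ (ℂ × ℂ) // p.2.rep.1 * p.1.2 - p.2.rep.2 * p.1.1 = 0})

instance instMeasurableSpaceBlowUp : MeasurableSpace BlowUp := borel BlowUp

instance instBorelSpaceBlowUp : BorelSpace BlowUp := ⟨rfl⟩

/-- The incidence relation can be checked on any representative of the line `[t]`. -/
theorem incidence_mk (z t : ℂ × ℂ) (ht : t ≠ 0) (h : t.1 * z.2 - t.2 * z.1 = 0) :
    (Projectivization.mk ℂ t ht).rep.1 * z.2 - (Projectivization.mk ℂ t ht).rep.2 * z.1 = 0 := by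
  obtain ⟨a, ha⟩ := Projectivization.exists_smul_eq_mk_rep ℂ t ht
  rw [← ha]
  simp only [Units.smul_def, Prod.smul_fst, Prod.smul_snd, smul_eq_mul]
  linear_combination (a : ℂ) * h

/-- The point `(z, [t])` of the blow-up. -/
def BlowUp.mk (z t : ℂ × ℂ) (ht : t ≠ 0) (h : t.1 * z.2 - t.2 * z.1 = 0) : BlowUp :=
  ⟨(z, Projectivization.mk ℂ t ht), incidence_mk z t ht h⟩

/-- The projection of the blow-up to `ℂ²`. -/
def BlowUp.proj (x : BlowUp) : ℂ × ℂ := x.1.1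

/-- The inverses of the two coordinate maps of the blow-up:
`(w₁, w₂) ↦ (w₁, w₁ w₂, [1, w₂])` and `(w₁, w₂) ↦ (w₁ w₂, w₂, [w₁, 1])`. -/
def param : Fin 2 → ℂ × ℂ → BlowUp
  | 0, w => BlowUp.mk (w.1, w.1 * w.2) (1, w.2) (by simp [Prod.ext_iff]) (by ring)
  | 1, w => BlowUp.mk (w.1 * w.2, w.2) (w.1, 1) (by simp [Prod.ext_iff]) (by ring)

/-- The coordinate domain `{t_c ≠ 0}`. -/
def chartDomain : Fin 2 → Set BlowUp
  | 0 => {x | x.1.2.rep.1 ≠ 0}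
  | 1 => {x | x.1.2.rep.2 ≠ 0}

/-- The coordinate maps `(z, [t]) ↦ (z₁, t₂ / t₁)` and `(z, [t]) ↦ (t₁ / t₂, z₂)`. -/
def coord : Fin 2 → BlowUp → ℂ × ℂ
  | 0, x => (x.1.1.1, x.1.2.rep.2 / x.1.2.rep.1)
  | 1, x => (x.1.2.rep.1 / x.1.2.rep.2, x.1.1.2)

theorem continuous_projMk :
    Continuous (fun v : {v : ℂ × ℂ // v ≠ 0} => Projectivization.mk' ℂ v) :=
  continuous_quotient_mk'

theorem continuous_param (c : Fin 2) : Continuous (param c) := by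
  fin_cases c
  · refine Continuous.subtype_mk (Continuous.prodMk (by fun_prop) ?_) _
    exact continuous_projMk.comp (Continuous.subtype_mk
      (by fun_prop : Continuous fun w : ℂ × ℂ => ((1 : ℂ), w.2)) _)
  · refine Continuous.subtype_mk (Continuous.prodMk (by fun_prop) ?_) _
    exact continuous_projMk.comp (Continuous.subtype_mk
      (by fun_prop : Continuous fun w : ℂ × ℂ => (w.1, (1 : ℂ))) _)

theorem coord_param (c : Fin 2) (w : ℂ × ℂ) : coord c (param c w) = w := by
  fin_cases c
  · obtain ⟨a, ha⟩ := Projectivization.exists_smul_eq_mk_rep ℂ ((1 : ℂ), w.2)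
      (by simp [Prod.ext_iff])
    simp [coord, param, BlowUp.mk, ← ha, Units.smul_def]
  · obtain ⟨a, ha⟩ := Projectivization.exists_smul_eq_mk_rep ℂ (w.1, (1 : ℂ))
      (by simp [Prod.ext_iff])
    simp [coord, param, BlowUp.mk, ← ha, Units.smul_def]

theorem param_mem (c : Fin 2) (w : ℂ × ℂ) : param c w ∈ chartDomain c := by
  fin_cases c
  · obtain ⟨a, ha⟩ := Projectivization.exists_smul_eq_mk_rep ℂ ((1 : ℂ), w.2)
      (by simp [Prod.ext_iff])
    change (Projectivization.mk ℂ ((1 : ℂ), w.2) _).rep.1 ≠ 0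
    simp [← ha, Units.smul_def]
  · obtain ⟨a, ha⟩ := Projectivization.exists_smul_eq_mk_rep ℂ (w.1, (1 : ℂ))
      (by simp [Prod.ext_iff])
    change (Projectivization.mk ℂ (w.1, (1 : ℂ)) _).rep.2 ≠ 0
    simp [← ha, Units.smul_def]

theorem param_coord (c : Fin 2) (x : BlowUp) (hx : x ∈ chartDomain c) :
    param c (coord c x) = x := by
  obtain ⟨⟨⟨z1, z2⟩, t⟩, h⟩ := x
  have h0 := t.rep_nonzero
  fin_cases c
  · replace hx : t.rep.1 ≠ 0 := hx
    replace h : t.rep.1 * z2 - t.rep.2 * z1 = 0 := h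
    refine Subtype.ext (Prod.ext (Prod.ext rfl ?_) ?_)
    · change z1 * (t.rep.2 / t.rep.1) = z2
      field_simp
      linear_combination -h
    · refine Eq.trans ((Projectivization.mk_eq_mk_iff' ℂ ((1 : ℂ), t.rep.2 / t.rep.1) t.rep _ h0).mpr ?_) t.mk_rep
      refine ⟨t.rep.1⁻¹, Prod.ext ?_ ?_⟩
      · simp [hx]
      · simp [div_eq_inv_mul]
  · replace hx : t.rep.2 ≠ 0 := hx
    replace h : t.rep.1 * z2 - t.rep.2 * z1 = 0 := h
    refine Subtype.ext (Prod.ext (Prod.ext ?_ rfl) ?_)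
    · change t.rep.1 / t.rep.2 * z2 = z1
      field_simp
      linear_combination h
    · refine Eq.trans ((Projectivization.mk_eq_mk_iff' ℂ (t.rep.1 / t.rep.2, (1 : ℂ)) t.rep _ h0).mpr ?_) t.mk_rep
      refine ⟨t.rep.2⁻¹, Prod.ext ?_ ?_⟩
      · simp [div_eq_inv_mul]
      · simp [hx]

theorem exists_mem_chartDomain (x : BlowUp) : ∃ c, x ∈ chartDomain c := by
  by_contra! h
  have h1 : x.1.2.rep.1 = 0 := not_not.mp (h 0)
  have h2 : x.1.2.rep.2 = 0 := not_not.mp (h 1)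
  exact x.1.2.rep_nonzero (Prod.ext h1 h2)

theorem isOpen_rep_ne (f : ℂ × ℂ → ℂ) (hf : Continuous f)
    (hhom : ∀ (a : ℂˣ) v, f (a • v) = a * f v) : IsOpen {l : ℙ ℂ (ℂ × ℂ) | f l.rep ≠ 0} := by
  refine isOpen_coinduced.mpr ?_
  have : (fun v : {v : ℂ × ℂ // v ≠ 0} => Projectivization.mk' ℂ v) ⁻¹'
      {l : ℙ ℂ (ℂ × ℂ) | f l.rep ≠ 0} = {v | f v.1 ≠ 0} := by
    ext v
    obtain ⟨a, ha⟩ := Projectivization.exists_smul_eq_mk_rep ℂ v.1 v.2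
    simp [Projectivization.mk'_eq_mk, ← ha, hhom]
  exact this ▸ isOpen_ne_fun (hf.comp continuous_subtype_val) continuous_const

theorem isOpen_chartDomain (c : Fin 2) : IsOpen (chartDomain c) := by
  have hc : Continuous fun x : BlowUp => x.1.2 := continuous_snd.comp continuous_subtype_val
  fin_cases c
  · exact (isOpen_rep_ne Prod.fst continuous_fst (fun a v => rfl)).preimage hc
  · exact (isOpen_rep_ne Prod.snd continuous_snd (fun a v => rfl)).preimage hc

theorem continuousOn_coord (c : Fin 2) : ContinuousOn (coord c) (chartDomain c) := by
  have key : ∀ f g : ℂ × ℂ → ℂ, Continuous f → Continuous g →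
      (∀ (a : ℂˣ) v, f (a • v) = a * f v) → (∀ (a : ℂˣ) v, g (a • v) = a * g v) →
      IsOpen {l : ℙ ℂ (ℂ × ℂ) | f l.rep ≠ 0} →
      ContinuousOn (fun l : ℙ ℂ (ℂ × ℂ) => g l.rep / f l.rep) {l | f l.rep ≠ 0} := by
    intro f g hf hg hhf hhg ho
    have hq : Topology.IsQuotientMap
      (fun v : {v : ℂ × ℂ // v ≠ 0} => Projectivization.mk' ℂ v) := isQuotientMap_quotient_mk'
    refine (hq.continuousOn_isOpen_iff ho).mpr ?_
    have : (fun l : ℙ ℂ (ℂ × ℂ) => g l.rep / f l.rep) ∘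
        (fun v : {v : ℂ × ℂ // v ≠ 0} => Projectivization.mk' ℂ v) =
        fun v => g v.1 / f v.1 := by
      funext v
      obtain ⟨a, ha⟩ := Projectivization.exists_smul_eq_mk_rep ℂ v.1 v.2
      simp [Projectivization.mk'_eq_mk, ← ha, hhf, hhg, mul_div_mul_left]
    rw [this]
    refine (hg.comp continuous_subtype_val).continuousOn.div
      (hf.comp continuous_subtype_val).continuousOn ?_
    intro v hv hv0
    obtain ⟨a, ha⟩ := Projectivization.exists_smul_eq_mk_rep ℂ v.1 v.2
    apply hv
    change f (Projectivization.mk ℂ v.1 v.2).rep = 0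
    rw [← ha, hhf]
    change a * f v.1 = 0
    rw [show f v.1 = 0 from hv0, mul_zero]
  have hc : Continuous fun x : BlowUp => x.1.2 := continuous_snd.comp continuous_subtype_val
  have hz : Continuous fun x : BlowUp => x.1.1 := continuous_fst.comp continuous_subtype_val
  fin_cases c
  · exact (continuous_fst.comp hz).continuousOn.prodMk
      ((key Prod.fst Prod.snd continuous_fst continuous_snd (fun a v => rfl) (fun a v => rfl)
        (isOpen_rep_ne Prod.fst continuous_fst (fun a v => rfl))).comp hc.continuousOn (fun x hx => hx))
  · exact ((key Prod.snd Prod.fst continuous_snd continuous_fst (fun a v => rfl) (fun a v => rfl)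
        (isOpen_rep_ne Prod.snd continuous_snd (fun a v => rfl))).comp hc.continuousOn
        (fun x hx => hx)).prodMk (continuous_snd.comp hz).continuousOn

/-- The two coordinate charts of the blow-up; each identifies its domain with all of `ℂ²`. -/
def chart (c : Fin 2) : OpenPartialHomeomorph BlowUp (ℂ × ℂ) where
  toFun := coord c
  invFun := param c
  source := chartDomain c
  target := Set.univ
  map_source' _ _ := Set.mem_univ _
  map_target' w _ := param_mem c w
  left_inv' x hx := param_coord c x hx
  right_inv' w _ := coord_param c w
  open_source := isOpen_chartDomain c
  open_target := isOpen_univ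
  continuousOn_toFun := continuousOn_coord c
  continuousOn_invFun := (continuous_param c).continuousOn

/-! ### Holomorphic and smooth functions on open subsets of the blow-up -/

/-- `f` is holomorphic on the open set `V`: it is holomorphic in both charts. -/
def HolomorphicOn (f : BlowUp → ℂ) (V : Set BlowUp) : Prop :=
  ∀ c, DifferentiableOn ℂ (fun w => f (param c w)) (param c ⁻¹' V)

/-- The real function `f` is `C^∞` on the open set `V`: it is so in both charts. -/
def SmoothOn (f : BlowUp → ℝ) (V : Set BlowUp) : Prop :=
  ∀ c, ContDiffOn ℝ ∞ (fun w => f (param c w)) (param c ⁻¹' V)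

/-! ### The operator `∂∂̄` on `ℂ²` -/

/-- The standard basis of `ℂ²`. -/
def stdVec : Fin 2 → ℂ × ℂ
  | 0 => (1, 0)
  | 1 => (0, 1)

/-- The Wirtinger derivative `∂f/∂w_j = (∂f/∂x_j - i ∂f/∂y_j) / 2`. -/
def dz (j : Fin 2) (f : ℂ × ℂ → ℂ) (w : ℂ × ℂ) : ℂ :=
  (fderiv ℝ f w (stdVec j) - Complex.I * fderiv ℝ f w (Complex.I • stdVec j)) / 2

/-- The Wirtinger derivative `∂f/∂w̄_j = (∂f/∂x_j + i ∂f/∂y_j) / 2`. -/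
def dzbar (j : Fin 2) (f : ℂ × ℂ → ℂ) (w : ℂ × ℂ) : ℂ :=
  (fderiv ℝ f w (stdVec j) + Complex.I * fderiv ℝ f w (Complex.I • stdVec j)) / 2

/-- The coefficient matrix `(∂²u/∂w_j∂w̄_k)_{jk}`. A real `(1,1)`-form
`(i/2π) ∑ A_{jk} dw_j ∧ dw̄_k` is represented below by its coefficient matrix `A`, so that this
matrix represents the form `(i/2π) ∂∂̄u`. -/
def ddbar (u : ℂ × ℂ → ℝ) (w : ℂ × ℂ) : Matrix (Fin 2) (Fin 2) ℂ :=
  Matrix.of fun j k => dz j (dzbar k fun v => (u v : ℂ)) w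

/-! ### The Simanca metric -/

/-- The Kähler potential `|z|² + log |z|²` of the Simanca metric on `ℂ² \ {0}`. -/
def radialPotential (z : ℂ × ℂ) : ℝ :=
  (‖z.1‖ ^ 2 + ‖z.2‖ ^ 2) + Real.log (‖z.1‖ ^ 2 + ‖z.2‖ ^ 2)

/-- The Kähler potentials of the Simanca form in the two charts. -/
def localPotential : Fin 2 → ℂ × ℂ → ℝ
  | 0, w => ‖w.1‖ ^ 2 * (1 + ‖w.2‖ ^ 2) + Real.log (1 + ‖w.2‖ ^ 2)
  | 1, w => ‖w.2‖ ^ 2 * (1 + ‖w.1‖ ^ 2) + Real.log (1 + ‖w.1‖ ^ 2)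

/-- The coordinate of the chart `c` whose zero set is the exceptional divisor. -/
def divisorCoord : Fin 2 → ℂ × ℂ → ℂ
  | 0, w => w.1
  | 1, w => w.2

/-- Off the exceptional divisor the local potential differs from the pull-back of
`|z|² + log |z|²` by the pluriharmonic function `log |w_c|²`: the forms `(i/2π) ∂∂̄` of the local
potentials extend the pull-back of `(i/2π) ∂∂̄ (|z|² + log |z|²)` to the whole blow-up. -/
theorem radialPotential_proj_param (c : Fin 2) (w : ℂ × ℂ) (hw : divisorCoord c w ≠ 0) :
    radialPotential (param c w).proj =
      localPotential c w + Real.log (‖divisorCoord c w‖ ^ 2) := by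
  fin_cases c
  · replace hw : w.1 ≠ 0 := hw
    change (‖w.1‖ ^ 2 + ‖w.1 * w.2‖ ^ 2) + Real.log (‖w.1‖ ^ 2 + ‖w.1 * w.2‖ ^ 2) =
      ‖w.1‖ ^ 2 * (1 + ‖w.2‖ ^ 2) + Real.log (1 + ‖w.2‖ ^ 2) + Real.log (‖w.1‖ ^ 2)
    have h : ‖w.1‖ ^ 2 + ‖w.1 * w.2‖ ^ 2 = (1 + ‖w.2‖ ^ 2) * ‖w.1‖ ^ 2 := by
      rw [norm_mul]; ring
    rw [h, Real.log_mul (by positivity) (by positivity)]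
    ring
  · replace hw : w.2 ≠ 0 := hw
    change (‖w.1 * w.2‖ ^ 2 + ‖w.2‖ ^ 2) + Real.log (‖w.1 * w.2‖ ^ 2 + ‖w.2‖ ^ 2) =
      ‖w.2‖ ^ 2 * (1 + ‖w.1‖ ^ 2) + Real.log (1 + ‖w.1‖ ^ 2) + Real.log (‖w.2‖ ^ 2)
    have h : ‖w.1 * w.2‖ ^ 2 + ‖w.2‖ ^ 2 = (1 + ‖w.1‖ ^ 2) * ‖w.2‖ ^ 2 := by
      rw [norm_mul]; ring
    rw [h, Real.log_mul (by positivity) (by positivity)]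
    ring

/-- The Simanca form `ω_S` in the chart `c` (its coefficient matrix, that is, the matrix of the
Simanca metric). -/
def simancaForm (c : Fin 2) : ℂ × ℂ → Matrix (Fin 2) (Fin 2) ℂ :=
  ddbar (localPotential c)

/-- The density of the volume form `ω_S² / 2!` in the chart `c`. If `A` is the coefficient matrix
of `ω_S`, then `ω_S² / 2! = (i/2π)² det A dw₁ ∧ dw̄₁ ∧ dw₂ ∧ dw̄₂`, and
`(i/2π) dw ∧ dw̄ = (1/π) dx ∧ dy`. -/
def volumeDensity (c : Fin 2) (w : ℂ × ℂ) : ENNReal :=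
  ENNReal.ofReal ((simancaForm c w).det.re / Real.pi ^ 2)

/-- The measure on the blow-up given by the volume form `ω_S² / 2!`: its density is integrated
over the first chart domain in the first chart, and over the complement of the first chart domain
in the second chart. -/
def volumeMeasure : MeasureTheory.Measure BlowUp :=
  (MeasureTheory.volume.withDensity (volumeDensity 0)).map (param 0) +
    ((MeasureTheory.volume.withDensity (volumeDensity 1)).restrict
      (param 1 ⁻¹' (chartDomain 0)ᶜ)).map (param 1)

/-! ### Holomorphic line bundles, their powers and their sections -/

/-- A holomorphic line bundle on the blow-up, given by local trivializations over an open cover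
`(U i)` and their holomorphic transition functions `g i j : U i ∩ U j → ℂ \ {0}`. A section is a
family of functions `s i` on `U i` with `s i = g i j * s j` on `U i ∩ U j`. -/
structure LineBundle where
  /-- The index set of the cover. -/
  ι : Type
  /-- The trivializing open sets. -/
  U : ι → Set BlowUp
  isOpen_U : ∀ i, IsOpen (U i)
  exists_mem : ∀ x, ∃ i, x ∈ U i
  /-- The transition functions. -/
  g : ι → ι → BlowUp → ℂ
  holomorphic : ∀ i j, HolomorphicOn (g i j) (U i ∩ U j)
  ne_zero : ∀ i j, ∀ x ∈ U i ∩ U j, g i j x ≠ 0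
  cocycle : ∀ i j k, ∀ x ∈ U i ∩ U j ∩ U k, g i j x * g j k x = g i k x

/-- The tensor power `L^m`. -/
def LineBundle.pow (L : LineBundle) (m : ℕ) : LineBundle where
  ι := L.ι
  U := L.U
  isOpen_U := L.isOpen_U
  exists_mem := L.exists_mem
  g i j x := L.g i j x ^ m
  holomorphic i j c := (L.holomorphic i j c).pow m
  ne_zero i j x hx := pow_ne_zero m (L.ne_zero i j x hx)
  cocycle i j k x hx := by rw [← mul_pow, L.cocycle i j k x hx]

/-- The space `H⁰(L)` of global holomorphic sections of `L`. The local expression `s i` of a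
section is extended by zero outside `U i`. -/
def LineBundle.sections (L : LineBundle) : Submodule ℂ (L.ι → BlowUp → ℂ) where
  carrier := {s | (∀ i, HolomorphicOn (s i) (L.U i)) ∧
    (∀ i j, ∀ x ∈ L.U i ∩ L.U j, s i x = L.g i j x * s j x) ∧
    ∀ i, ∀ x ∉ L.U i, s i x = 0}
  zero_mem' := ⟨fun i c => differentiableOn_const 0, by simp, by simp⟩
  add_mem' := by
    rintro s t ⟨hs1, hs2, hs3⟩ ⟨ht1, ht2, ht3⟩
    refine ⟨fun i c => (hs1 i c).add (ht1 i c), fun i j x hx => ?_, fun i x hx => ?_⟩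
    · simp only [Pi.add_apply, hs2 i j x hx, ht2 i j x hx]
      ring
    · simp only [Pi.add_apply, hs3 i x hx, ht3 i x hx, add_zero]
  smul_mem' := by
    rintro a s ⟨hs1, hs2, hs3⟩
    refine ⟨fun i c => (hs1 i c).const_smul a, fun i j x hx => ?_, fun i x hx => ?_⟩
    · simp only [Pi.smul_apply, smul_eq_mul, hs2 i j x hx]
      ring
    · simp only [Pi.smul_apply, smul_eq_mul, hs3 i x hx, mul_zero]

/-- An index `i` with `x ∈ U i`. -/
def LineBundle.indexAt (L : LineBundle) (x : BlowUp) : L.ι := (L.exists_mem x).choose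

theorem LineBundle.mem_indexAt (L : LineBundle) (x : BlowUp) : x ∈ L.U (L.indexAt x) :=
  (L.exists_mem x).choose_spec

/-- A smooth Hermitian metric on `L`: `h i > 0` is the squared norm of the frame of `L` over
`U i`. -/
structure HermitianMetric (L : LineBundle) where
  /-- The squared norms of the local frames. -/
  h : L.ι → BlowUp → ℝ
  pos : ∀ i, ∀ x ∈ L.U i, 0 < h i x
  smooth : ∀ i, SmoothOn (h i) (L.U i)
  compat : ∀ i j, ∀ x ∈ L.U i ∩ L.U j, h j x = ‖L.g i j x‖ ^ 2 * h i x

namespace HermitianMetric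

variable {L : LineBundle}

/-- The pointwise Hermitian product `h(s(x), t(x))` of two sections. -/
def pairing (H : HermitianMetric L) (s t : L.sections) (x : BlowUp) : ℂ :=
  H.h (L.indexAt x) x * s.1 (L.indexAt x) x * starRingEnd ℂ (t.1 (L.indexAt x) x)

/-- The pointwise Hermitian product can be computed in any trivialization. -/
theorem pairing_eq (H : HermitianMetric L) (s t : L.sections) (x : BlowUp) (i : L.ι)
    (hx : x ∈ L.U i) : H.pairing s t x = H.h i x * s.1 i x * starRingEnd ℂ (t.1 i x) := by
  have hm := L.mem_indexAt x
  rw [pairing, s.2.2.1 i _ x ⟨hx, hm⟩, t.2.2.1 i _ x ⟨hx, hm⟩, H.compat i _ x ⟨hx, hm⟩]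
  push_cast
  rw [← Complex.mul_conj', map_mul]
  ring

/-- The pointwise squared norm `h(s(x), s(x))` of a section. -/
def normSq (H : HermitianMetric L) (s : L.sections) (x : BlowUp) : ℝ :=
  (H.pairing s s x).re

/-- The squared norm `∫ h(s, s) ω_S² / 2! ∈ [0, ∞]` of a section. -/
def energy (H : HermitianMetric L) (s : L.sections) : ENNReal :=
  ∫⁻ x, ENNReal.ofReal (H.normSq s x) ∂volumeMeasure

/-- The scalar product `∫ h(s, t) ω_S² / 2!` of two sections of finite norm. -/
def scalarProduct (H : HermitianMetric L) (s t : L.sections) : ℂ :=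
  ∫ x, H.pairing s t x ∂volumeMeasure

/-- `Ric(h) = m ω_S`, where `Ric(h) = -(i/2π) ∂∂̄ log h(σ, σ)` for a local holomorphic frame
`σ`. -/
def HasRicci (H : HermitianMetric L) (m : ℕ) : Prop :=
  ∀ (i : L.ι) (c : Fin 2), ∀ w ∈ param c ⁻¹' L.U i,
    -ddbar (fun v => Real.log (H.h i (param c v))) w = (m : ℂ) • simancaForm c w

/-- The family `(s a)` is an orthonormal basis of the Hilbert space of all global holomorphic
sections `s` of `L` with `∫ h(s, s) ω_S² / 2! < ∞`: it is an orthonormal family in this space and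
its linear span is dense. -/
structure IsOrthonormalBasis (H : HermitianMetric L) {κ : Type} (s : κ → L.sections) :
    Prop where
  finite : ∀ a, H.energy (s a) < ⊤
  norm_one : ∀ a, H.scalarProduct (s a) (s a) = 1
  orthogonal : ∀ a b, a ≠ b → H.scalarProduct (s a) (s b) = 0
  dense : ∀ t : L.sections, H.energy t < ⊤ → ∀ δ : ENNReal, 0 < δ →
    ∃ t' ∈ Submodule.span ℂ (Set.range s), H.energy (t - t') < δ

/-- `e` is the epsilon function of `(L, h)`: `e(x) = ∑ h(s_a(x), s_a(x))` for an orthonormal basis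
`(s_a)` of the Hilbert space of square integrable global holomorphic sections. -/
def IsEpsilonFunction (H : HermitianMetric L) (e : BlowUp → ℝ) : Prop :=
  ∃ (κ : Type) (s : κ → L.sections), H.IsOrthonormalBasis s ∧
    ∀ x, HasSum (fun a => H.normSq (s a) x) (e x)

end HermitianMetric

/-- A geometric quantization of `(M, m ω_S)` for all integers `m ≥ 1`, `M` being the blow-up: a
holomorphic line bundle `L` and Hermitian metrics `h_m` on `L^m` with `Ric(h_m) = m ω_S`.
(The metric with index `0` plays no role.) -/
structure GeometricQuantization where
  /-- The prequantum line bundle. -/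
  L : LineBundle
  /-- The Hermitian metrics on its powers. -/
  h : ∀ m : ℕ, HermitianMetric (L.pow m)
  ricci : ∀ m : ℕ, 1 ≤ m → (h m).HasRicci m

/-- `eps m`, for `m ≥ 1`, is the epsilon function `ε_{m g_S}`, computed with the geometric
quantization `Q`. -/
def GeometricQuantization.IsEpsilon (Q : GeometricQuantization) (eps : ℕ → BlowUp → ℝ) : Prop :=
  ∀ m : ℕ, 1 ≤ m → (Q.h m).IsEpsilonFunction (eps m)

/-! ### The Tian-Yau-Zelditch expansion -/

/-- `eps m ~ ∑_{j ≥ 0} a_j m^{2-j}` as `m → ∞`, in the `C^∞` sense: the functions are smooth, and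
on every compact subset of a chart every derivative of
`eps m - ∑_{j ≤ N} a_j m^{2-j}` is `O(m^{2-(N+1)})`, for every `N`. -/
structure IsTYZExpansion (eps : ℕ → BlowUp → ℝ) (a : ℕ → BlowUp → ℝ) : Prop where
  smooth_eps : ∀ m : ℕ, 1 ≤ m → SmoothOn (eps m) Set.univ
  smooth_coeff : ∀ j, SmoothOn (a j) Set.univ
  asymptotic : ∀ (c : Fin 2) (K : Set (ℂ × ℂ)), IsCompact K → ∀ r N : ℕ, ∃ C : ℝ,
    ∀ m : ℕ, 1 ≤ m → ∀ w ∈ K,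
      ‖iteratedFDeriv ℝ r (fun v => eps m (param c v) -
          ∑ j ∈ Finset.range (N + 1), a j (param c v) * (m : ℝ) ^ (2 - (j : ℤ))) w‖
        ≤ C * (m : ℝ) ^ (2 - ((N : ℤ) + 1))

end Simanca
end

/-!
A line bundle with a Hermitian metric is determined up to isometry by its curvature, because the
blow-up `M` is simply connected; the computation can therefore be made in one explicit model,
where the square integrable sections have an orthonormal basis of monomials.

*Reduction to the model.* Both chart domains are copies of `ℂ²`. Let `φ` be the local potential of
`ω_S` in a chart and let `h` be a metric with `Ric(h) = m ω_S`. In a local trivialization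
`log h + m φ` is pluriharmonic, hence locally the real part of a holomorphic function
(`exists_holomorphic_re_eq`), which yields local holomorphic frames of squared norm `exp (-m φ)`.
Two such frames differ by a holomorphic function of modulus one, that is, by a constant, so they
form a locally constant torsor under the circle and exist over the whole chart
(`LocalTorsor.exists_global`). On the overlap of the charts the two global frames differ, after a
change by a constant, by the transition function `w₂ ^ m` of `O(-m E)`, where `E` is the
exceptional divisor (`exists_unitaryFrames`). Holomorphic sections thus become pairs of entire
functions `t₀`, `t₁` with `t₀(w) = w₂ ^ m t₁(1 / w₂, w₁ w₂)`. Expanding them in Taylor series, one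
finds that they are the power series in the monomials `w₁ ^ a w₂ ^ b` with `b ≤ a + m`, which are
the monomials `z₁ ^ (a + m - b) z₂ ^ b` of degree at least `m` in the coordinates of `ℂ²`
(`IsModelSection.exists_expansion`).

*The kernel.* The second chart adds only a null set, and `det ω_S = |w₁|² + 1 / (1 + |w₂|²)` in the
first one. Integration in polar coordinates shows that the monomials are orthogonal, with squared
norms `a! b! (a + m - b)! / (m ^ (a + 2) (a + m)!)`, and that scalar products with monomials give
the Taylor coefficients, so that the normalized monomials are an orthonormal basis
(`integral_mul_conj_monomial`, `toLp_mem_closure_span`). For fixed `a` the sum over `b` of their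
squared absolute values is a binomial sum, and the sum over `a` is an exponential series: the total
is `m² exp (m φ)` (`hasSum_norm_sq_basisSection`), and the factor `exp (-m φ)` of the metric leaves
`m²`. Since evaluation at a point is represented by a vector of squared norm `m² exp (m φ)`,
Parseval's identity gives the same sum for every orthonormal basis
(`UnitaryFrames.hasSum_normSq`).

*Existence and expansion.* The bundle `O(-E)` with the metrics `exp (-m φ)` is a geometric
quantization (`prequantization`). The constant function `m²` is its own expansion, and the
coefficients of an expansion in powers of `m` are unique (`IsTYZExpansion.coeff_eq`).
-/

noncomputable section

namespace Simanca

/-! ### Globalizing local solutions with constant transition functions -/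

section Gluing

open Metric

/-- A class of `Y`-valued maps on a normed space, described by the condition `holds σ x` on the
germ of `σ` at `x`, in which any two solutions on a convex open set differ by a constant of the
group `G`: the solutions form a locally constant sheaf, a torsor under `G`. -/
structure LocalTorsor (E Y G : Type*) [NormedAddCommGroup E] [NormedSpace ℝ E] [Group G]
    [MulAction G Y] where
  /-- `σ` is a solution at `x`. -/
  holds : (E → Y) → E → Prop
  congr : ∀ {σ τ : E → Y} {x : E}, σ =ᶠ[nhds x] τ → holds σ x → holds τ x
  smul : ∀ {σ : E → Y} {x : E} (c : G), holds σ x → holds (fun y => c • σ y) x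
  exists_local : ∀ x, ∃ σ, ∀ᶠ y in nhds x, holds σ y
  unique : ∀ {V : Set E} {σ τ : E → Y}, IsOpen V → Convex ℝ V → V.Nonempty →
    (∀ x ∈ V, holds σ x) → (∀ x ∈ V, holds τ x) → ∃ c : G, ∀ x ∈ V, τ x = c • σ x
  free : ∀ {σ : E → Y} {x : E} {c : G}, holds σ x → c • σ x = σ x → c = 1

namespace LocalTorsor

variable {E Y G : Type*} [NormedAddCommGroup E] [NormedSpace ℝ E] [Group G] [MulAction G Y]

variable (T : LocalTorsor E Y G)

theorem eqOn_of_eq {V : Set E} {σ τ : E → Y} (hV : IsOpen V) (hc : Convex ℝ V)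
    (hσ : ∀ x ∈ V, T.holds σ x) (hτ : ∀ x ∈ V, T.holds τ x) {p : E} (hp : p ∈ V)
    (h : τ p = σ p) : ∀ x ∈ V, τ x = σ x := by
  obtain ⟨c, hcc⟩ := T.unique hV hc ⟨p, hp⟩ hσ hτ
  have h1 : c = 1 := T.free (hσ p hp) (by rw [← hcc p hp, h])
  intro x hx
  rw [hcc x hx, h1, one_smul]

/-- A solution on a larger set can be multiplied by a constant so as to extend a given one. -/
theorem exists_adjusted {V W : Set E} {σ τ : E → Y} (hV : IsOpen V) (hc : Convex ℝ V)
    (hne : V.Nonempty) (hσ : ∀ x ∈ V, T.holds σ x) (hVW : V ⊆ W) (hτ : ∀ x ∈ W, T.holds τ x) :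
    ∃ τ' : E → Y, (∀ x ∈ W, T.holds τ' x) ∧ ∀ x ∈ V, τ' x = σ x := by
  obtain ⟨c, hcc⟩ := T.unique hV hc hne hσ (fun x hx => hτ x (hVW hx))
  refine ⟨fun y => c⁻¹ • τ y, fun x hx => T.smul _ (hτ x hx), fun x hx => ?_⟩
  simp only [hcc x hx, inv_smul_smul]

/-- If solutions exist on all balls of radius `δ` centred in the ball of radius `r`, then a
solution on the latter extends to the ball of radius `r + δ`. The local solutions, normalized on
the smaller ball, match: if two of the `δ`-balls meet, the midpoint of their centres lies in both
of them and in the smaller ball. -/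
theorem exists_extension {r δ : ℝ} (hr : 0 < r) (hδ : 0 < δ) {σ : E → Y}
    (hσ : ∀ x ∈ ball (0 : E) r, T.holds σ x)
    (hloc : ∀ x ∈ ball (0 : E) r, ∃ τ, ∀ y ∈ ball x δ, T.holds τ y) :
    ∃ σ' : E → Y, ∀ x ∈ ball (0 : E) (r + δ), T.holds σ' x := by
  have h1 : ∀ x ∈ ball (0 : E) r, ∃ τ : E → Y, (∀ y ∈ ball x δ, T.holds τ y) ∧
      ∀ y ∈ ball x δ ∩ ball 0 r, τ y = σ y := by
    intro x hx
    obtain ⟨τ, hτ⟩ := hloc x hx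
    obtain ⟨c, hc⟩ := T.unique (isOpen_ball.inter isOpen_ball)
      ((convex_ball x δ).inter (convex_ball 0 r)) ⟨x, mem_ball_self hδ, hx⟩
      (fun y hy => hσ y hy.2) (fun y hy => hτ y hy.1)
    refine ⟨fun y => c⁻¹ • τ y, fun y hy => T.smul _ (hτ y hy), fun y hy => ?_⟩
    simp only [hc y hy, inv_smul_smul]
  have : Nonempty (E → Y) := ⟨σ⟩
  choose! τ hτ hτσ using h1
  have hmatch : ∀ x ∈ ball (0 : E) r, ∀ x' ∈ ball (0 : E) r, ∀ y ∈ ball x δ ∩ ball x' δ,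
      τ x y = τ x' y := by
    intro x hx x' hx' y hy
    have hd : dist x x' < 2 * δ := by
      have := dist_triangle_right x x' y
      have h2 := mem_ball'.mp hy.1
      have h3 := mem_ball'.mp hy.2
      linarith
    have hmx : midpoint ℝ x x' ∈ ball x δ := by
      rw [mem_ball, dist_midpoint_left]; simp; linarith
    have hmx' : midpoint ℝ x x' ∈ ball x' δ := by
      rw [mem_ball, dist_midpoint_right]; simp; linarith
    have hm0 : midpoint ℝ x x' ∈ ball (0 : E) r :=
      (convex_ball (0 : E) r).midpoint_mem hx hx'
    refine T.eqOn_of_eq (isOpen_ball.inter isOpen_ball)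
      ((convex_ball x δ).inter (convex_ball x' δ)) (fun y hy => hτ x' hx' y hy.2)
      (fun y hy => hτ x hx y hy.1) ⟨hmx, hmx'⟩ ?_ y hy
    rw [hτσ x hx _ ⟨hmx, hm0⟩, hτσ x' hx' _ ⟨hmx', hm0⟩]
  have hcov : ∀ y ∈ ball (0 : E) (r + δ), ∃ x ∈ ball (0 : E) r, y ∈ ball x δ := by
    intro y hy
    rw [mem_ball_zero_iff] at hy
    have hp : 0 < r + δ := by linarith
    refine ⟨(r / (r + δ)) • y, ?_, ?_⟩
    · rw [mem_ball_zero_iff, norm_smul, Real.norm_of_nonneg (by positivity), div_mul_eq_mul_div,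
        div_lt_iff₀ hp]
      exact mul_lt_mul_of_pos_left hy hr
    · have : y - (r / (r + δ)) • y = (δ / (r + δ)) • y := by
        have h : δ / (r + δ) = 1 - r / (r + δ) := by field_simp; ring
        rw [h, sub_smul, one_smul]
      rw [mem_ball, dist_eq_norm, this, norm_smul, Real.norm_of_nonneg (by positivity),
        div_mul_eq_mul_div, div_lt_iff₀ hp]
      exact mul_lt_mul_of_pos_left hy hδ
  choose! ctr hctr hyctr using hcov
  refine ⟨fun y => τ (ctr y) y, fun y hy => ?_⟩
  refine T.congr ?_ (hτ (ctr y) (hctr y hy) y (hyctr y hy))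
  filter_upwards [isOpen_ball.mem_nhds hy, isOpen_ball.mem_nhds (hyctr y hy)] with y' hy' hy''
  exact hmatch _ (hctr y hy) _ (hctr y' hy') y' ⟨hy'', hyctr y' hy'⟩

/-- Solutions exist on every ball: starting with a small ball, the radius is increased in steps of a
Lebesgue number of a cover by the domains of local solutions. -/
theorem exists_on_ball [ProperSpace E] (R : ℝ) :
    ∃ σ : E → Y, ∀ x ∈ ball (0 : E) R, T.holds σ x := by
  choose σ hσ using T.exists_local
  choose N hN hNo hNx using fun x => _root_.eventually_nhds_iff.mp (hσ x)
  obtain ⟨δ, hδ, hleb⟩ := lebesgue_number_lemma_of_metric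
    (isCompact_closedBall (0 : E) (max R 0)) hNo
    (fun x _ => Set.mem_iUnion.mpr ⟨x, hNx x⟩)
  have hloc : ∀ x ∈ closedBall (0 : E) (max R 0), ∃ τ : E → Y, ∀ y ∈ ball x δ, T.holds τ y := by
    intro x hx
    obtain ⟨i, hi⟩ := hleb x hx
    exact ⟨σ i, fun y hy => hN i y (hi hy)⟩
  have step : ∀ n : ℕ, ∃ τ : E → Y, ∀ x ∈ ball (0 : E) (min (max R 0) (n * δ) + δ),
      T.holds τ x := by
    intro n
    induction n with
    | zero =>
      obtain ⟨τ, hτ⟩ := hloc 0 (mem_closedBall_self (le_max_right _ _))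
      refine ⟨τ, fun x hx => hτ x ?_⟩
      simpa using hx
    | succ n ih =>
      obtain ⟨τ, hτ⟩ := ih
      by_cases h : max R 0 ≤ (n * δ)
      · refine ⟨τ, fun x hx => hτ x (ball_subset_ball ?_ hx)⟩
        rw [min_eq_left h]
        linarith [min_le_left (max R 0) (((n + 1 : ℕ) : ℝ) * δ)]
      · push Not at h
        have hr : 0 < min (max R 0) (n * δ + δ) :=
          lt_min (lt_of_le_of_lt (by positivity) h) (by positivity)
        have hle : min (max R 0) (n * δ + δ) ≤ min (max R 0) (n * δ) + δ := by
          rw [min_eq_right h.le]; exact min_le_right _ _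
        obtain ⟨τ', hτ'⟩ := T.exists_extension hr hδ
          (fun x hx => hτ x (ball_subset_ball hle hx))
          (fun x hx => hloc x (ball_subset_closedBall (ball_subset_ball (min_le_left _ _) hx)))
        refine ⟨τ', fun x hx => hτ' x ?_⟩
        have : ((n + 1 : ℕ) : ℝ) * δ = n * δ + δ := by push_cast; ring
        rwa [this] at hx
  obtain ⟨n, hn⟩ := exists_nat_ge (max R 0 / δ)
  obtain ⟨τ, hτ⟩ := step n
  refine ⟨τ, fun x hx => hτ x (ball_subset_ball ?_ hx)⟩
  rw [min_eq_left ((div_le_iff₀ hδ).mp hn)]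
  linarith [le_max_left R 0]

/-- A locally constant torsor on a finite-dimensional normed space has a global section. -/
theorem exists_global [ProperSpace E] : ∃ σ : E → Y, ∀ x, T.holds σ x := by
  choose σ hσ using fun n : ℕ => T.exists_on_ball (n + 1 : ℝ)
  have h0 : ∀ n : ℕ, (0 : E) ∈ ball (0 : E) (n + 1 : ℝ) := fun n =>
    mem_ball_self (by positivity)
  have h1 : ∀ n : ℕ, ∃ τ : E → Y, (∀ x ∈ ball (0 : E) (n + 1 : ℝ), T.holds τ x) ∧
      ∀ x ∈ ball (0 : E) (1 : ℝ), τ x = σ 0 x := by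
    intro n
    exact T.exists_adjusted isOpen_ball (convex_ball _ _) ⟨0, mem_ball_self one_pos⟩
      (fun x hx => hσ 0 x (by simpa using hx))
      (ball_subset_ball (by linarith [(Nat.cast_nonneg n : (0 : ℝ) ≤ n)])) (hσ n)
  choose τ hτ hτ0 using h1
  have hmatch : ∀ n k : ℕ, ∀ x ∈ ball (0 : E) (n + 1 : ℝ) ∩ ball (0 : E) (k + 1 : ℝ),
      τ n x = τ k x := fun n k =>
    T.eqOn_of_eq (isOpen_ball.inter isOpen_ball) ((convex_ball _ _).inter (convex_ball _ _))
      (fun x hx => hτ k x hx.2) (fun x hx => hτ n x hx.1) ⟨h0 n, h0 k⟩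
      (by rw [hτ0 n 0 (mem_ball_self one_pos), hτ0 k 0 (mem_ball_self one_pos)])
  have hmem : ∀ x : E, x ∈ ball (0 : E) ((⌈‖x‖⌉₊ : ℝ) + 1) := fun x => by
    rw [mem_ball_zero_iff]
    linarith [Nat.le_ceil ‖x‖]
  refine ⟨fun x => τ ⌈‖x‖⌉₊ x, fun x => T.congr ?_ (hτ _ x (hmem x))⟩
  filter_upwards [isOpen_ball.mem_nhds (hmem x)] with y hy
  exact hmatch _ _ y ⟨hy, hmem y⟩

end LocalTorsor

end Gluing

/-! ### Pluriharmonic functions -/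

/-- The `∂∂̄`-matrix in terms of the real second derivative. -/
theorem ddbar_apply {u : ℂ × ℂ → ℝ} {w : ℂ × ℂ} (hu : ContDiffAt ℝ 2 u w) (j k : Fin 2) :
    ddbar u w j k =
      ((fderiv ℝ (fderiv ℝ u) w (stdVec j) (stdVec k) +
          fderiv ℝ (fderiv ℝ u) w (Complex.I • stdVec j) (Complex.I • stdVec k) : ℝ) +
        Complex.I * (fderiv ℝ (fderiv ℝ u) w (stdVec j) (Complex.I • stdVec k) -
          fderiv ℝ (fderiv ℝ u) w (Complex.I • stdVec j) (stdVec k) : ℝ)) / 4 := by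
  have h1 : ∀ᶠ v in nhds w, DifferentiableAt ℝ u v := by
    filter_upwards [hu.eventually (by simp)] with v hv using hv.differentiableAt (by simp)
  have h2 : DifferentiableAt ℝ (fderiv ℝ u) w :=
    (hu.fderiv_right (m := 1) (by norm_num)).differentiableAt (by simp)
  have h3 : (dzbar k fun v => (u v : ℂ)) =ᶠ[nhds w] fun v =>
      ((fderiv ℝ u v (stdVec k) : ℝ) +
        Complex.I * (fderiv ℝ u v (Complex.I • stdVec k) : ℝ)) / 2 := by
    filter_upwards [h1] with v hv
    have : HasFDerivAt (fun v => (u v : ℂ)) (Complex.ofRealCLM.comp (fderiv ℝ u v)) v :=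
      Complex.ofRealCLM.hasFDerivAt.comp v hv.hasFDerivAt
    simp [dzbar, this.fderiv]
  have h4 : ∀ x : ℂ × ℂ, HasFDerivAt (fun v => ((fderiv ℝ u v x : ℝ) : ℂ))
      (Complex.ofRealCLM.comp
        ((ContinuousLinearMap.apply ℝ ℝ x).comp (fderiv ℝ (fderiv ℝ u) w))) w := fun x =>
    Complex.ofRealCLM.hasFDerivAt.comp w
      ((ContinuousLinearMap.apply ℝ ℝ x).hasFDerivAt.comp w h2.hasFDerivAt)
  have h5 := (((h4 (stdVec k)).add ((h4 (Complex.I • stdVec k)).const_mul Complex.I)).mul_const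
    (2⁻¹ : ℂ))
  simp only [ddbar, Matrix.of_apply]
  rw [dz, h3.fderiv_eq]
  simp only [div_eq_mul_inv]
  erw [h5.fderiv]
  simp
  ring_nf
  simp
  ring

/-- If `∂∂̄u = 0`, then the real second derivative `B` of `u` satisfies `B (i v) (i x) = -B v x`. -/
theorem snd_fderiv_I_smul_I_smul {u : ℂ × ℂ → ℝ} {w : ℂ × ℂ} (hu : ContDiffAt ℝ 2 u w)
    (h : ddbar u w = 0) (v x : ℂ × ℂ) :
    fderiv ℝ (fderiv ℝ u) w (Complex.I • v) (Complex.I • x) =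
      -fderiv ℝ (fderiv ℝ u) w v x := by
  set B := fderiv ℝ (fderiv ℝ u) w with hB
  have hjk : ∀ j k, B (stdVec j) (stdVec k) + B (Complex.I • stdVec j) (Complex.I • stdVec k) = 0 ∧
      B (stdVec j) (Complex.I • stdVec k) - B (Complex.I • stdVec j) (stdVec k) = 0 := by
    intro j k
    have h1 := ddbar_apply hu j k
    rw [h, ← hB] at h1
    have h2 := congrArg Complex.re h1
    have h3 := congrArg Complex.im h1
    simp at h2 h3
    constructor <;> linarith
  have hdec : ∀ v : ℂ × ℂ, v = v.1.re • stdVec 0 + v.1.im • (Complex.I • stdVec 0) +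
      (v.2.re • stdVec 1 + v.2.im • (Complex.I • stdVec 1)) := by
    intro v
    refine Prod.ext (Complex.ext ?_ ?_) (Complex.ext ?_ ?_) <;> simp [stdVec]
  have hI : ∀ v : ℂ × ℂ, Complex.I • v = v.1.re • (Complex.I • stdVec 0) - v.1.im • stdVec 0 +
      (v.2.re • (Complex.I • stdVec 1) - v.2.im • stdVec 1) := by
    intro v
    refine Prod.ext (Complex.ext ?_ ?_) (Complex.ext ?_ ?_) <;> simp [stdVec]
  rw [hI v, hI x]
  conv_rhs => rw [hdec v, hdec x]
  have h00 := hjk 0 0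
  have h01 := hjk 0 1
  have h10 := hjk 1 0
  have h11 := hjk 1 1
  simp only [map_add, map_sub, map_smul, add_apply,
    sub_apply, smul_apply, smul_eq_mul]
  rw [eq_neg_of_add_eq_zero_left h00.1, eq_neg_of_add_eq_zero_left h01.1,
    eq_neg_of_add_eq_zero_left h10.1, eq_neg_of_add_eq_zero_left h11.1,
    sub_eq_zero.mp h00.2, sub_eq_zero.mp h01.2, sub_eq_zero.mp h10.2, sub_eq_zero.mp h11.2]
  ring

/-- The `ℂ`-linear map with real part `L`. -/
def complexify (L : ℂ × ℂ →L[ℝ] ℝ) : ℂ × ℂ →L[ℂ] ℂ :=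
  LinearMap.toContinuousLinearMap
    { toFun := fun v => L v - Complex.I * L (Complex.I • v)
      map_add' := fun v x => by simp; ring
      map_smul' := fun c v => by
        have h1 : c • v = c.re • v + c.im • (Complex.I • v) := by
          conv_lhs => rw [← Complex.re_add_im c, add_smul, mul_smul]
          rfl
        have h2 : Complex.I • (c • v) = c.re • (Complex.I • v) - c.im • v := by
          rw [h1, smul_add, smul_comm Complex.I c.im, smul_smul, Complex.I_mul_I, neg_one_smul,
            smul_neg, ← sub_eq_add_neg, smul_comm]
        rw [h2, h1]
        simp only [map_add, map_sub, map_smul, smul_eq_mul, RingHom.id_apply]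
        apply Complex.ext <;> simp
        ring }

theorem complexify_apply (L : ℂ × ℂ →L[ℝ] ℝ) (v : ℂ × ℂ) :
    complexify L v = L v - Complex.I * L (Complex.I • v) := rfl

/-- A pluriharmonic function on a convex open set is the real part of a holomorphic function:
a primitive of `2∂u`, which is closed because `∂∂̄u = 0`. -/
theorem exists_holomorphic_re_eq {u : ℂ × ℂ → ℝ} {s : Set (ℂ × ℂ)} (hs : Convex ℝ s)
    (hso : IsOpen s) (hu : ContDiffOn ℝ 2 u s) (h : ∀ w ∈ s, ddbar u w = 0) :
    ∃ F : ℂ × ℂ → ℂ, ∀ w ∈ s, DifferentiableAt ℂ F w ∧ (F w).re = u w := by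
  rcases s.eq_empty_or_nonempty with rfl | ⟨p, hp⟩
  · simp
  have hua : ∀ w ∈ s, ContDiffAt ℝ 2 u w := fun w hw => hu.contDiffAt (hso.mem_nhds hw)
  let Ψ : (ℂ × ℂ →L[ℝ] ℝ) →L[ℝ] (ℂ × ℂ →L[ℝ] ℂ) := LinearMap.toContinuousLinearMap
    { toFun := fun L => (complexify L).restrictScalars ℝ
      map_add' := fun L M => by ext v <;> (simp [complexify_apply]; ring)
      map_smul' := fun c L => by ext v <;> (simp [complexify_apply]; ring) }
  have hΨ : ∀ L v, Ψ L v = L v - Complex.I * L (Complex.I • v) := fun L v => rfl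
  have hω : ∀ w ∈ s, HasFDerivAt (fun w => Ψ (fderiv ℝ u w))
      (Ψ.comp (fderiv ℝ (fderiv ℝ u) w)) w := fun w hw =>
    Ψ.hasFDerivAt.comp w (((hua w hw).fderiv_right (m := 1) (by norm_num)).differentiableAt
      (by simp)).hasFDerivAt
  obtain ⟨F, hF⟩ := hs.exists_forall_hasFDerivAt_of_fderiv_symmetric hso
    (fun w hw => (hω w hw).differentiableAt.differentiableWithinAt) (by
      intro w hw v x
      have hsymm : IsSymmSndFDerivAt ℝ u w := (hua w hw).isSymmSndFDerivAt (by simp)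
      have hB := snd_fderiv_I_smul_I_smul (hua w hw) (h w hw)
      rw [(hω w hw).fderiv]
      simp only [ContinuousLinearMap.comp_apply, hΨ]
      have h1 := hB (Complex.I • v) x
      rw [smul_smul, Complex.I_mul_I, neg_one_smul, map_neg, neg_apply,
        neg_inj] at h1
      rw [hsymm.eq v x, h1, hsymm.eq (Complex.I • v) x])
  have hre : ∀ w ∈ s, HasFDerivAt (fun w => (F w).re - u w) (0 : ℂ × ℂ →L[ℝ] ℝ) w := by
    intro w hw
    have h1 := Complex.reCLM.hasFDerivAt.comp w (hF w hw)
    have h2 := h1.sub ((hua w hw).differentiableAt (by simp)).hasFDerivAt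
    convert! h2 using 1
    ext v <;> simp [hΨ]
  have hconst : ∀ w ∈ s, (F w).re - u w = (F p).re - u p := fun w hw =>
    hs.is_const_of_fderivWithin_eq_zero (𝕜 := ℝ) (f := fun w => (F w).re - u w)
      (fun w hw => (hre w hw).differentiableAt.differentiableWithinAt)
      (fun w hw => by
        rw [fderivWithin_of_isOpen hso hw, (hre w hw).fderiv]) hw hp
  -- The primitive determines `u` up to a constant, which is subtracted.
  refine ⟨fun w => F w - ((F p).re - u p : ℝ), fun w hw => ⟨?_, ?_⟩⟩
  · have h1 : HasFDerivAt F (complexify (fderiv ℝ u w)) w :=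
      hasFDerivAt_of_restrictScalars ℝ (hF w hw) rfl
    exact h1.differentiableAt.sub_const _
  · have := hconst w hw
    simp only [Complex.sub_re, Complex.ofReal_re]
    linarith

end Simanca

namespace Simanca

/-! ### Wirtinger derivatives of the Kähler potentials -/

open scoped ComplexConjugate

/-- The real linear map `v ↦ ∑ a_j v_j + ∑ b_j v̄_j`. -/
def wirtingerMap (a b : Fin 2 → ℂ) : ℂ × ℂ →L[ℝ] ℂ :=
  LinearMap.toContinuousLinearMap
    { toFun := fun v => a 0 * v.1 + a 1 * v.2 + (b 0 * conj v.1 + b 1 * conj v.2)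
      map_add' := fun v x => by simp; ring
      map_smul' := fun c v => by simp; ring }

theorem wirtingerMap_apply (a b : Fin 2 → ℂ) (v : ℂ × ℂ) :
    wirtingerMap a b v = a 0 * v.1 + a 1 * v.2 + (b 0 * conj v.1 + b 1 * conj v.2) := rfl

/-- `f` is real differentiable at `w` with `∂f/∂w_j = a j` and `∂f/∂w̄_j = b j`. -/
def HasWirtingerAt (f : ℂ × ℂ → ℂ) (a b : Fin 2 → ℂ) (w : ℂ × ℂ) : Prop :=
  HasFDerivAt f (wirtingerMap a b) w

namespace HasWirtingerAt

variable {f g : ℂ × ℂ → ℂ} {a b a' b' : Fin 2 → ℂ} {w : ℂ × ℂ}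

theorem dz_eq (h : HasWirtingerAt f a b w) (j : Fin 2) : dz j f w = a j := by
  have h' : HasFDerivAt f (wirtingerMap a b) w := h
  rw [dz, h'.fderiv]
  have := Complex.I_mul_I
  fin_cases j
  · simp [stdVec, wirtingerMap_apply]
    linear_combination (-(a 0) / 2 + b 0 / 2) * this
  · simp [stdVec, wirtingerMap_apply]
    linear_combination (-(a 1) / 2 + b 1 / 2) * this

theorem dzbar_eq (h : HasWirtingerAt f a b w) (j : Fin 2) : dzbar j f w = b j := by
  have h' : HasFDerivAt f (wirtingerMap a b) w := h
  rw [dzbar, h'.fderiv]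
  have := Complex.I_mul_I
  fin_cases j
  · simp [stdVec, wirtingerMap_apply]
    linear_combination ((a 0) / 2 - b 0 / 2) * this
  · simp [stdVec, wirtingerMap_apply]
    linear_combination ((a 1) / 2 - b 1 / 2) * this

theorem const (c : ℂ) (w : ℂ × ℂ) : HasWirtingerAt (fun _ => c) 0 0 w := by
  refine (hasFDerivAt_const c w).congr_fderiv ?_
  ext v <;> simp [wirtingerMap_apply]

theorem fst (w : ℂ × ℂ) : HasWirtingerAt (fun v => v.1) ![1, 0] 0 w := by
  refine (ContinuousLinearMap.fst ℝ ℂ ℂ).hasFDerivAt.congr_fderiv ?_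
  ext v <;> simp [wirtingerMap_apply]

theorem snd (w : ℂ × ℂ) : HasWirtingerAt (fun v => v.2) ![0, 1] 0 w := by
  refine (ContinuousLinearMap.snd ℝ ℂ ℂ).hasFDerivAt.congr_fderiv ?_
  ext v <;> simp [wirtingerMap_apply]

theorem conj_fst (w : ℂ × ℂ) : HasWirtingerAt (fun v => conj v.1) 0 ![1, 0] w := by
  refine (Complex.conjCLE.toContinuousLinearMap.comp
    (ContinuousLinearMap.fst ℝ ℂ ℂ)).hasFDerivAt.congr_fderiv ?_
  ext v <;> simp [wirtingerMap_apply]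

theorem conj_snd (w : ℂ × ℂ) : HasWirtingerAt (fun v => conj v.2) 0 ![0, 1] w := by
  refine (Complex.conjCLE.toContinuousLinearMap.comp
    (ContinuousLinearMap.snd ℝ ℂ ℂ)).hasFDerivAt.congr_fderiv ?_
  ext v <;> simp [wirtingerMap_apply]

theorem add (hf : HasWirtingerAt f a b w) (hg : HasWirtingerAt g a' b' w) :
    HasWirtingerAt (fun v => f v + g v) (a + a') (b + b') w := by
  refine (HasFDerivAt.add hf hg).congr_fderiv ?_
  ext v <;> simp [wirtingerMap_apply] <;> ring

theorem mul (hf : HasWirtingerAt f a b w) (hg : HasWirtingerAt g a' b' w) :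
    HasWirtingerAt (fun v => f v * g v) (f w • a' + g w • a) (f w • b' + g w • b) w := by
  refine (HasFDerivAt.mul hf hg).congr_fderiv ?_
  ext v <;> simp [wirtingerMap_apply] <;> ring

theorem comp_holomorphic {k : ℂ → ℂ} {k' : ℂ} (hk : HasDerivAt k k' (f w))
    (hf : HasWirtingerAt f a b w) :
    HasWirtingerAt (fun v => k (f v)) (k' • a) (k' • b) w := by
  refine ((hk.hasFDerivAt.restrictScalars ℝ).comp w hf).congr_fderiv ?_
  ext v <;> simp [wirtingerMap_apply] <;> ring

end HasWirtingerAt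

theorem one_add_mul_conj (z : ℂ) : 1 + z * conj z = ((1 + ‖z‖ ^ 2 : ℝ) : ℂ) := by
  rw [Complex.mul_conj']; push_cast; ring

theorem one_add_mul_conj_ne_zero (z : ℂ) : 1 + z * conj z ≠ 0 := by
  rw [one_add_mul_conj]
  exact_mod_cast (by positivity : (1 + ‖z‖ ^ 2 : ℝ) ≠ 0)

theorem one_add_mul_conj_mem_slitPlane (z : ℂ) : 1 + z * conj z ∈ Complex.slitPlane := by
  rw [one_add_mul_conj, Complex.ofReal_mem_slitPlane]
  positivity

theorem dzbar_localPotential_zero (w : ℂ × ℂ) :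
    dzbar 0 (fun v => (localPotential 0 v : ℂ)) w = w.1 * (1 + w.2 * conj w.2) ∧
    dzbar 1 (fun v => (localPotential 0 v : ℂ)) w =
      w.1 * conj w.1 * w.2 + (1 + w.2 * conj w.2)⁻¹ * w.2 := by
  have h0 : (fun v => (localPotential 0 v : ℂ)) = fun v : ℂ × ℂ =>
      v.1 * conj v.1 * (1 + v.2 * conj v.2) + Complex.log (1 + v.2 * conj v.2) := by
    funext v
    rw [one_add_mul_conj, ← Complex.ofReal_log (by positivity), Complex.mul_conj']
    simp [localPotential]
  have h1 := ((HasWirtingerAt.fst w).mul (.conj_fst w)).mul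
    ((HasWirtingerAt.const 1 w).add ((HasWirtingerAt.snd w).mul (.conj_snd w)))
  have h2 := (HasWirtingerAt.comp_holomorphic
    (Complex.hasDerivAt_log (one_add_mul_conj_mem_slitPlane w.2))
    ((HasWirtingerAt.const 1 w).add ((HasWirtingerAt.snd w).mul (.conj_snd w))))
  rw [h0]
  have h3 := h1.add h2
  exact ⟨(h3.dzbar_eq 0).trans (by simp; ring), (h3.dzbar_eq 1).trans (by simp)⟩

theorem simancaForm_zero_apply (w : ℂ × ℂ) :
    simancaForm 0 w 0 0 = 1 + w.2 * conj w.2 ∧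
    simancaForm 0 w 0 1 = conj w.1 * w.2 ∧
    simancaForm 0 w 1 0 = w.1 * conj w.2 ∧
    simancaForm 0 w 1 1 = w.1 * conj w.1 + ((1 + w.2 * conj w.2)⁻¹) ^ 2 := by
  have h0 : (dzbar 0 fun v => (localPotential 0 v : ℂ)) = fun w : ℂ × ℂ =>
    w.1 * (1 + w.2 * conj w.2) := funext fun v => (dzbar_localPotential_zero v).1
  have h1 : (dzbar 1 fun v => (localPotential 0 v : ℂ)) = fun w : ℂ × ℂ =>
    w.1 * conj w.1 * w.2 + (1 + w.2 * conj w.2)⁻¹ * w.2 :=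
      funext fun v => (dzbar_localPotential_zero v).2
  have h2 := (HasWirtingerAt.fst w).mul
    ((HasWirtingerAt.const 1 w).add ((HasWirtingerAt.snd w).mul (.conj_snd w)))
  have h3 := (((HasWirtingerAt.fst w).mul (.conj_fst w)).mul (.snd w)).add
    ((HasWirtingerAt.comp_holomorphic (hasDerivAt_inv (one_add_mul_conj_ne_zero w.2))
    ((HasWirtingerAt.const 1 w).add ((HasWirtingerAt.snd w).mul (.conj_snd w)))).mul (.snd w))
  simp only [simancaForm, ddbar, Matrix.of_apply, h0, h1]
  refine ⟨(h2.dz_eq 0).trans (by simp), (h3.dz_eq 0).trans (by simp; ring),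
    (h2.dz_eq 1).trans (by simp), (h3.dz_eq 1).trans ?_⟩
  have := one_add_mul_conj_ne_zero w.2
  simp
  field_simp
  ring

theorem det_simancaForm_zero (w : ℂ × ℂ) :
    (simancaForm 0 w).det = ((‖w.1‖ ^ 2 + (1 + ‖w.2‖ ^ 2)⁻¹ : ℝ) : ℂ) := by
  obtain ⟨h00, h01, h10, h11⟩ := simancaForm_zero_apply w
  rw [Matrix.det_fin_two, h00, h01, h10, h11]
  have h := one_add_mul_conj_ne_zero w.2
  push_cast
  rw [← Complex.mul_conj', ← Complex.mul_conj']
  field_simp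
  ring

/-- The coordinate of the chart `c` along the exceptional divisor. -/
def fibreCoord : Fin 2 → ℂ × ℂ → ℂ
  | 0, w => w.2
  | 1, w => w.1

/-- `log |w|²` is pluriharmonic away from the zeros of the coordinate `w`. -/
theorem ddbar_log_norm_sq_fibreCoord (c : Fin 2) {w : ℂ × ℂ} (hw : fibreCoord c w ≠ 0) :
    ddbar (fun v => Real.log (‖fibreCoord c v‖ ^ 2)) w = 0 := by
  have hpos : ∀ z : ℂ, z ≠ 0 → z * conj z ∈ Complex.slitPlane ∧ z * conj z ≠ 0 ∧
      ((Real.log (‖z‖ ^ 2) : ℝ) : ℂ) = Complex.log (z * conj z) := by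
    intro z hz
    have : 0 < ‖z‖ ^ 2 := by positivity
    refine ⟨?_, by simpa using hz, ?_⟩
    · rw [Complex.mul_conj', ← Complex.ofReal_pow, Complex.ofReal_mem_slitPlane]
      exact this
    · rw [Complex.mul_conj', ← Complex.ofReal_pow, ← Complex.ofReal_log this.le]
  have hcont : Continuous (fibreCoord c) := by
    fin_cases c
    · exact continuous_snd
    · exact continuous_fst
  have hne : ∀ᶠ v in nhds w, fibreCoord c v ≠ 0 := hcont.continuousAt.eventually_ne hw
  let e : Fin 2 → ℂ := if c = 0 then ![0, 1] else ![1, 0]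
  have hf : ∀ v, HasWirtingerAt (fibreCoord c) e 0 v ∧
      HasWirtingerAt (fun v => conj (fibreCoord c v)) 0 e v := by
    intro v
    fin_cases c
    · exact ⟨.snd v, .conj_snd v⟩
    · exact ⟨.fst v, .conj_fst v⟩
  have h1 : ∀ k, (dzbar k fun v => ((Real.log (‖fibreCoord c v‖ ^ 2) : ℝ) : ℂ)) =ᶠ[nhds w]
      fun v => (conj (fibreCoord c v))⁻¹ * e k := by
    intro k
    filter_upwards [hne.eventually_nhds] with v hv
    have h2 : (fun v => ((Real.log (‖fibreCoord c v‖ ^ 2) : ℝ) : ℂ)) =ᶠ[nhds v]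
        fun v => Complex.log (fibreCoord c v * conj (fibreCoord c v)) := by
      filter_upwards [hv] with x hx using (hpos _ hx).2.2
    have hv0 := hv.self_of_nhds
    have h3 := HasWirtingerAt.comp_holomorphic (Complex.hasDerivAt_log (hpos _ hv0).1)
      ((hf v).1.mul (hf v).2)
    have h4 : HasWirtingerAt (fun v => ((Real.log (‖fibreCoord c v‖ ^ 2) : ℝ) : ℂ)) _ _ v :=
      HasFDerivAt.congr_of_eventuallyEq h3 h2
    rw [h4.dzbar_eq k]
    have : conj (fibreCoord c v) ≠ 0 := by simpa using hv0
    simp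
    field_simp
  ext j k
  simp only [ddbar, Matrix.of_apply, Matrix.zero_apply]
  have h5 := (HasWirtingerAt.comp_holomorphic
    (hasDerivAt_inv (by simpa using hw : conj (fibreCoord c w) ≠ 0)) (hf w).2).mul
    (.const (e k) w)
  have h6 : HasWirtingerAt (dzbar k fun v => ((Real.log (‖fibreCoord c v‖ ^ 2) : ℝ) : ℂ)) _ _ w :=
    HasFDerivAt.congr_of_eventuallyEq h5 (h1 k)
  rw [h6.dz_eq j]
  simp

theorem contDiff_localPotential (c : Fin 2) : ContDiff ℝ ∞ (localPotential c) := by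
  have h1 : ∀ v : ℂ × ℂ, (1 + ‖v.1‖ ^ 2) ≠ 0 := fun v => by positivity
  have h2 : ∀ v : ℂ × ℂ, (1 + ‖v.2‖ ^ 2) ≠ 0 := fun v => by positivity
  have h3 : ContDiff ℝ ∞ fun v : ℂ × ℂ => ‖v.1‖ ^ 2 := contDiff_fst.norm_sq ℝ
  have h4 : ContDiff ℝ ∞ fun v : ℂ × ℂ => ‖v.2‖ ^ 2 := contDiff_snd.norm_sq ℝ
  fin_cases c
  · exact (h3.mul (contDiff_const.add h4)).add ((contDiff_const.add h4).log h2)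
  · exact (h4.mul (contDiff_const.add h3)).add ((contDiff_const.add h3).log h1)

theorem ddbar_add_apply {u v : ℂ × ℂ → ℝ} {w : ℂ × ℂ} (hu : ContDiffAt ℝ 2 u w)
    (hv : ContDiffAt ℝ 2 v w) : ddbar (fun x => u x + v x) w = ddbar u w + ddbar v w := by
  have h1 : ∀ {u : ℂ × ℂ → ℝ}, ContDiffAt ℝ 2 u w → DifferentiableAt ℝ (fderiv ℝ u) w :=
    fun hu => (hu.fderiv_right (m := 1) (by norm_num)).differentiableAt (by simp)
  have h2 : fderiv ℝ (fun x => u x + v x) =ᶠ[nhds w] fun x => fderiv ℝ u x + fderiv ℝ v x := by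
    filter_upwards [hu.eventually (by simp), hv.eventually (by simp)] with x hx hx'
    exact fderiv_fun_add (hx.differentiableAt (by simp)) (hx'.differentiableAt (by simp))
  ext j k
  rw [Matrix.add_apply, ddbar_apply (hu.add hv), ddbar_apply hu, ddbar_apply hv, h2.fderiv_eq,
    fderiv_fun_add (h1 hu) (h1 hv)]
  simp
  ring

theorem ddbar_const_mul {u : ℂ × ℂ → ℝ} {w : ℂ × ℂ} (r : ℝ) (hu : ContDiffAt ℝ 2 u w) :
    ddbar (fun x => r * u x) w = (r : ℂ) • ddbar u w := by
  have h1 : DifferentiableAt ℝ (fderiv ℝ u) w :=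
    (hu.fderiv_right (m := 1) (by norm_num)).differentiableAt (by simp)
  have h2 : fderiv ℝ (fun x => r * u x) =ᶠ[nhds w] fun x => r • fderiv ℝ u x := by
    filter_upwards [hu.eventually (by simp)] with x hx
    exact fderiv_const_mul (hx.differentiableAt (by simp)) r
  ext j k
  rw [Matrix.smul_apply, ddbar_apply (contDiffAt_const.mul hu), ddbar_apply hu, h2.fderiv_eq,
    fderiv_fun_const_smul h1]
  simp
  ring

theorem ddbar_congr {u v : ℂ × ℂ → ℝ} {w : ℂ × ℂ} (h : u =ᶠ[nhds w] v) :
    ddbar u w = ddbar v w := by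
  ext j k
  have h1 : (dzbar k fun x => (u x : ℂ)) =ᶠ[nhds w] dzbar k fun x => (v x : ℂ) := by
    filter_upwards [h.eventually_nhds] with x hx
    have : (fun x => (u x : ℂ)) =ᶠ[nhds x] fun x => (v x : ℂ) := by
      filter_upwards [hx] with y hy
      rw [hy]
    simp only [dzbar, this.fderiv_eq]
  simp only [ddbar, Matrix.of_apply, dz, h1.fderiv_eq]

end Simanca

namespace Simanca

/-! ### Frames of prescribed norm over the charts -/

open scoped ComplexConjugate

/-- `σ w i` is the local expression in the trivialization `i` of a section of `L` over the chart
`c` (extended by zero). The section is holomorphic at `w` and `h(σ, σ) = exp (-m φ)` there, `φ`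
being the local potential. -/
structure IsFrameAt {L : LineBundle} (H : HermitianMetric L) (m : ℕ) (c : Fin 2)
    (σ : ℂ × ℂ → L.ι → ℂ) (w : ℂ × ℂ) : Prop where
  diff : ∀ i, param c w ∈ L.U i → DifferentiableAt ℂ (fun v => σ v i) w
  norm_eq : ∀ i, param c w ∈ L.U i →
    H.h i (param c w) * ‖σ w i‖ ^ 2 = Real.exp (-(m * localPotential c w))
  trans : ∀ i j, param c w ∈ L.U i ∩ L.U j → σ w i = L.g i j (param c w) * σ w j
  zero : ∀ i, param c w ∉ L.U i → σ w i = 0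

theorem isOpen_preimage_param {V : Set BlowUp} (hV : IsOpen V) (c : Fin 2) :
    IsOpen (param c ⁻¹' V) := hV.preimage (continuous_param c)

theorem two_le_infty : (2 : WithTop ℕ∞) ≤ ∞ := by
  exact WithTop.coe_le_coe.2 le_top

theorem circle_smul_apply {ι : Type*} (a : Circle) (f : ι → ℂ) (i : ι) :
    (a • f) i = (a : ℂ) * f i := rfl

section Frames

variable {L : LineBundle} {H : HermitianMetric L} {m : ℕ} {c : Fin 2}

namespace IsFrameAt

variable {σ τ : ℂ × ℂ → L.ι → ℂ} {w : ℂ × ℂ}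

theorem congr (h : σ =ᶠ[nhds w] τ) (hσ : IsFrameAt H m c σ w) : IsFrameAt H m c τ w where
  diff i hi := (hσ.diff i hi).congr_of_eventuallyEq (by
    filter_upwards [h] with v hv
    rw [hv])
  norm_eq i hi := by rw [← h.eq_of_nhds]; exact hσ.norm_eq i hi
  trans i j hij := by rw [← h.eq_of_nhds]; exact hσ.trans i j hij
  zero i hi := by rw [← h.eq_of_nhds]; exact hσ.zero i hi

theorem smul (a : Circle) (hσ : IsFrameAt H m c σ w) :
    IsFrameAt H m c (fun v => a • σ v) w where
  diff i hi := by
    simp only [circle_smul_apply]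
    exact (hσ.diff i hi).const_mul (a : ℂ)
  norm_eq i hi := by
    simp only [circle_smul_apply, norm_mul, Circle.norm_coe, one_mul]
    exact hσ.norm_eq i hi
  trans i j hij := by
    simp only [circle_smul_apply, hσ.trans i j hij]
    ring
  zero i hi := by simp [circle_smul_apply, hσ.zero i hi]

theorem ne_zero (hσ : IsFrameAt H m c σ w) {i : L.ι} (hi : param c w ∈ L.U i) : σ w i ≠ 0 := by
  intro h
  have := hσ.norm_eq i hi
  rw [h, norm_zero, zero_pow two_ne_zero, mul_zero] at this
  exact (Real.exp_pos _).ne this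

theorem free {a : Circle} (hσ : IsFrameAt H m c σ w) (h : a • σ w = σ w) : a = 1 := by
  have h1 := congrFun h (L.indexAt (param c w))
  rw [circle_smul_apply] at h1
  exact Circle.ext (mul_right_cancel₀ (hσ.ne_zero (L.mem_indexAt _)) (by rw [h1]; simp))

/-- Two frames of the same norm over a connected open set differ by a unimodular constant: their
quotient is a holomorphic function of modulus one. -/
theorem unique {V : Set (ℂ × ℂ)} (hV : IsOpen V) (hc : Convex ℝ V) (hne : V.Nonempty)
    (hσ : ∀ w ∈ V, IsFrameAt H m c σ w) (hτ : ∀ w ∈ V, IsFrameAt H m c τ w) :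
    ∃ a : Circle, ∀ w ∈ V, τ w = a • σ w := by
  obtain ⟨p, hp⟩ := hne
  let ρ : ℂ × ℂ → ℂ := fun w => τ w (L.indexAt (param c w)) / σ w (L.indexAt (param c w))
  have hρ : ∀ w ∈ V, ∀ i, param c w ∈ L.U i → τ w i = ρ w * σ w i := by
    intro w hw i hi
    have hm := L.mem_indexAt (param c w)
    have h0 := (hσ w hw).ne_zero hm
    rw [(hσ w hw).trans i _ ⟨hi, hm⟩, (hτ w hw).trans i _ ⟨hi, hm⟩]
    simp only [ρ]
    field_simp
  have hnorm : ∀ w ∈ V, ‖ρ w‖ = 1 := by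
    intro w hw
    have hm := L.mem_indexAt (param c w)
    have h1 := (hσ w hw).norm_eq _ hm
    have h2 := (hτ w hw).norm_eq _ hm
    have h0 : ‖σ w (L.indexAt (param c w))‖ ≠ 0 := norm_ne_zero_iff.mpr ((hσ w hw).ne_zero hm)
    rw [norm_div, div_eq_one_iff_eq h0]
    have h3 := mul_left_cancel₀ (H.pos _ _ hm).ne' (h2.trans h1.symm)
    exact (pow_left_inj₀ (norm_nonneg _) (norm_nonneg _) two_ne_zero).mp h3
  have hd : DifferentiableOn ℂ ρ V := by
    intro w hw
    have hm := L.mem_indexAt (param c w)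
    have h1 := DifferentiableAt.fun_inv ((hσ w hw).diff _ hm) (by exact (hσ w hw).ne_zero hm)
    refine ((((hτ w hw).diff _ hm).fun_mul h1).congr_of_eventuallyEq ?_).differentiableWithinAt
    filter_upwards [hV.mem_nhds hw, (isOpen_preimage_param (L.isOpen_U _) c).mem_nhds hm]
      with v hv hv'
    rw [hρ v hv _ hv', ← div_eq_mul_inv, mul_div_cancel_right₀ _ ((hσ v hv).ne_zero hv')]
  have hmax : IsMaxOn (norm ∘ ρ) V p := fun w hw => by
    simp [hnorm w hw, hnorm p hp]
  have hconst := Complex.eqOn_of_isPreconnected_of_isMaxOn_norm hc.isPreconnected hV hd hp hmax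
  obtain ⟨a, ha⟩ : ∃ a : Circle, (a : ℂ) = ρ p :=
    ⟨⟨ρ p, mem_sphere_zero_iff_norm.mpr (hnorm p hp)⟩, rfl⟩
  refine ⟨a, fun w hw => ?_⟩
  funext i
  rw [circle_smul_apply]
  by_cases hi : param c w ∈ L.U i
  · rw [hρ w hw i hi, hconst hw, ha]
    rfl
  · rw [(hσ w hw).zero i hi, (hτ w hw).zero i hi, mul_zero]

end IsFrameAt

/-- Locally, `log h_i + m φ` is the real part of a holomorphic function `F`, and `exp (-F / 2)` is
a frame of the required norm. -/
theorem exists_isFrameAt_near (hR : H.HasRicci m) (c : Fin 2) (x : ℂ × ℂ) :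
    ∃ σ : ℂ × ℂ → L.ι → ℂ, ∀ᶠ w in nhds x, IsFrameAt H m c σ w := by
  classical
  set i := L.indexAt (param c x)
  have hix : param c x ∈ L.U i := L.mem_indexAt _
  have hW : IsOpen (param c ⁻¹' L.U i) := isOpen_preimage_param (L.isOpen_U i) c
  obtain ⟨r, hr, hrW⟩ := Metric.isOpen_iff.mp hW x hix
  have hlog : ContDiffOn ℝ ∞ (fun v => Real.log (H.h i (param c v))) (param c ⁻¹' L.U i) :=
    (H.smooth i c).log fun v hv => (H.pos i _ hv).ne'
  have hpot : ContDiff ℝ ∞ (fun v => (m : ℝ) * localPotential c v) :=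
    contDiff_const.mul (contDiff_localPotential c)
  obtain ⟨F, hF⟩ := exists_holomorphic_re_eq (convex_ball x r) Metric.isOpen_ball
    (u := fun v => Real.log (H.h i (param c v)) + m * localPotential c v)
    (((hlog.mono hrW).add hpot.contDiffOn).of_le two_le_infty) (by
      intro w hw
      have h1 : ContDiffAt ℝ 2 (fun v => Real.log (H.h i (param c v))) w :=
        (hlog.contDiffAt (hW.mem_nhds (hrW hw))).of_le two_le_infty
      have h2 : ContDiffAt ℝ 2 (localPotential c) w :=
        (contDiff_localPotential c).contDiffAt.of_le two_le_infty
      rw [ddbar_add_apply h1 (contDiffAt_const.mul h2), ddbar_const_mul _ h2]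
      have h3 := hR i c w (hrW hw)
      rw [neg_eq_iff_eq_neg] at h3
      rw [h3, simancaForm]
      simp)
  refine ⟨fun v j => if param c v ∈ L.U j ∩ L.U i then
    L.g j i (param c v) * Complex.exp (-(F v / 2)) else 0, ?_⟩
  filter_upwards [Metric.ball_mem_nhds x hr] with w hw
  have hwi : param c w ∈ L.U i := hrW hw
  refine ⟨fun j hj => ?_, fun j hj => ?_, fun j k hjk => ?_, fun j hj => ?_⟩
  · have ho : IsOpen (param c ⁻¹' (L.U j ∩ L.U i)) :=
      isOpen_preimage_param ((L.isOpen_U j).inter (L.isOpen_U i)) c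
    have h1 : DifferentiableAt ℂ (fun v => L.g j i (param c v)) w :=
      (L.holomorphic j i c).differentiableAt (ho.mem_nhds ⟨hj, hwi⟩)
    have h2 : DifferentiableAt ℂ (fun v => Complex.exp (-(F v / 2))) w := by
      have := (hF w hw).1
      fun_prop
    refine (h1.mul h2).congr_of_eventuallyEq ?_
    filter_upwards [ho.mem_nhds ⟨hj, hwi⟩] with v hv
    exact if_pos hv
  · have h1 : param c w ∈ L.U j ∩ L.U i := ⟨hj, hwi⟩
    have h2 := H.compat j i _ h1
    simp only [if_pos h1]
    rw [norm_mul, mul_pow, ← mul_assoc, mul_comm (H.h j _), ← h2, Complex.norm_exp,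
      ← Real.exp_nat_mul]
    have h3 : ((2 : ℕ) : ℝ) * (-(F w / 2)).re = -(F w).re := by
      simp; ring
    rw [h3, (hF w hw).2, neg_add, Real.exp_add, Real.exp_neg (Real.log _),
      Real.exp_log (H.pos i _ hwi), mul_inv_cancel_left₀ (H.pos i _ hwi).ne']
  · simp only [if_pos (show param c w ∈ L.U j ∩ L.U i from ⟨hjk.1, hwi⟩),
      if_pos (show param c w ∈ L.U k ∩ L.U i from ⟨hjk.2, hwi⟩)]
    rw [← mul_assoc, L.cocycle j k i _ ⟨hjk, hwi⟩]
  · exact if_neg fun h => hj h.1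

/-- The frames of squared norm `exp (-m φ)` over a chart, as a locally constant torsor under the
unit circle. -/
def frameTorsor (hR : H.HasRicci m) (c : Fin 2) : LocalTorsor (ℂ × ℂ) (L.ι → ℂ) Circle where
  holds := IsFrameAt H m c
  congr := IsFrameAt.congr
  smul := IsFrameAt.smul
  exists_local := exists_isFrameAt_near hR c
  unique := IsFrameAt.unique
  free := IsFrameAt.free

/-- The second coordinates in terms of the first ones. -/
def chartChange (w : ℂ × ℂ) : ℂ × ℂ := (w.2⁻¹, w.1 * w.2)

theorem param_chartChange {w : ℂ × ℂ} (hw : w.2 ≠ 0) : param 1 (chartChange w) = param 0 w := by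
  refine Subtype.ext (Prod.ext (Prod.ext ?_ ?_) ?_)
  · change w.2⁻¹ * (w.1 * w.2) = w.1
    field_simp
  · rfl
  · refine (Projectivization.mk_eq_mk_iff' ℂ _ _ _ _).mpr ⟨w.2⁻¹, ?_⟩
    ext <;> simp [hw, chartChange]

theorem localPotential_chartChange {w : ℂ × ℂ} (hw : w.2 ≠ 0) :
    localPotential 1 (chartChange w) = localPotential 0 w - Real.log (‖w.2‖ ^ 2) := by
  have h : 1 + ‖w.2⁻¹‖ ^ 2 = (1 + ‖w.2‖ ^ 2) / ‖w.2‖ ^ 2 := by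
    have : ‖w.2‖ ≠ 0 := norm_ne_zero_iff.mpr hw
    rw [norm_inv]
    field_simp
    ring
  change ‖w.1 * w.2‖ ^ 2 * (1 + ‖w.2⁻¹‖ ^ 2) + Real.log (1 + ‖w.2⁻¹‖ ^ 2) =
    ‖w.1‖ ^ 2 * (1 + ‖w.2‖ ^ 2) + Real.log (1 + ‖w.2‖ ^ 2) - Real.log (‖w.2‖ ^ 2)
  have h0 : ‖w.2‖ ≠ 0 := norm_ne_zero_iff.mpr hw
  rw [h, Real.log_div (by positivity) (by positivity), norm_mul]
  field_simp
  ring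

theorem differentiableAt_chartChange {w : ℂ × ℂ} (hw : w.2 ≠ 0) :
    DifferentiableAt ℂ chartChange w :=
  (differentiableAt_snd.inv hw).prodMk (differentiableAt_fst.mul differentiableAt_snd)

theorem isPreconnected_snd_ne_zero : IsPreconnected {w : ℂ × ℂ | w.2 ≠ 0} := by
  have h : {w : ℂ × ℂ | w.2 ≠ 0} = Set.univ ×ˢ {0}ᶜ := by ext; simp
  rw [h]
  exact isPreconnected_univ.prod (isConnected_compl_singleton_of_one_lt_rank
    (by rw [Complex.rank_real_complex]; norm_num) (0 : ℂ)).isPreconnected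

/-- Frames of squared norm `exp (-m φ)` over both charts, with the transition function `w₂ ^ m`.
They identify the bundle with `O(-m E)`, where `E` is the exceptional divisor. -/
structure UnitaryFrames {L : LineBundle} (H : HermitianMetric L) (m : ℕ) where
  /-- The local expressions of the two frames. -/
  σ : Fin 2 → ℂ × ℂ → L.ι → ℂ
  isFrame : ∀ c w, IsFrameAt H m c (σ c) w
  transition : ∀ w : ℂ × ℂ, w.2 ≠ 0 → ∀ i, σ 1 (chartChange w) i = w.2 ^ m * σ 0 w i

/-- The Ricci equation determines the Hermitian line bundle up to isometry: on the overlap of the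
charts the frames differ by `w₂ ^ m` times a holomorphic function of modulus one, that is, by
`w₂ ^ m` times a constant, which is absorbed into one of the frames. -/
theorem exists_unitaryFrames (hR : H.HasRicci m) : Nonempty (UnitaryFrames H m) := by
  obtain ⟨σ₀, h₀⟩ := (frameTorsor hR 0).exists_global
  obtain ⟨σ₁, h₁⟩ := (frameTorsor hR 1).exists_global
  replace h₀ : ∀ w, IsFrameAt H m 0 σ₀ w := h₀
  replace h₁ : ∀ w, IsFrameAt H m 1 σ₁ w := h₁
  let ρ : ℂ × ℂ → ℂ := fun w => σ₁ (chartChange w) (L.indexAt (param 0 w)) /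
    (w.2 ^ m * σ₀ w (L.indexAt (param 0 w)))
  have hV : IsOpen {w : ℂ × ℂ | w.2 ≠ 0} := isOpen_ne_fun continuous_snd continuous_const
  have hρ : ∀ w : ℂ × ℂ, w.2 ≠ 0 → ∀ i, param 0 w ∈ L.U i →
      σ₁ (chartChange w) i = ρ w * (w.2 ^ m * σ₀ w i) := by
    intro w hw i hi
    have hm := L.mem_indexAt (param 0 w)
    have h0 := (h₀ w).ne_zero hm
    rw [(h₀ w).trans i _ ⟨hi, hm⟩, (h₁ (chartChange w)).trans i _
      (by rw [param_chartChange hw]; exact ⟨hi, hm⟩), param_chartChange hw]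
    simp only [ρ]
    field_simp
  have hnorm : ∀ w : ℂ × ℂ, w.2 ≠ 0 → ‖ρ w‖ = 1 := by
    intro w hw
    have hm := L.mem_indexAt (param 0 w)
    have e1 := (h₀ w).norm_eq _ hm
    have e2 := (h₁ (chartChange w)).norm_eq _ (by rw [param_chartChange hw]; exact hm)
    have h0 : σ₀ w (L.indexAt (param 0 w)) ≠ 0 := (h₀ w).ne_zero hm
    have hw' : 0 < ‖w.2‖ := norm_pos_iff.mpr hw
    rw [norm_div, div_eq_one_iff_eq (by simp [hw, h0])]
    rw [param_chartChange hw, localPotential_chartChange hw] at e2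
    have e3 : Real.exp (-(m * (localPotential 0 w - Real.log (‖w.2‖ ^ 2)))) =
        Real.exp (-(m * localPotential 0 w)) * (‖w.2‖ ^ m) ^ 2 := by
      rw [mul_sub, neg_sub, sub_eq_neg_add, Real.exp_add, Real.exp_nat_mul,
        Real.exp_log (by positivity)]
      ring
    rw [e3, ← e1, mul_assoc, ← mul_pow] at e2
    have e4 := mul_left_cancel₀ (H.pos _ _ hm).ne' e2
    rw [norm_mul, norm_pow, mul_comm]
    exact (pow_left_inj₀ (norm_nonneg _) (by positivity) two_ne_zero).mp e4
  have hd : DifferentiableOn ℂ ρ {w : ℂ × ℂ | w.2 ≠ 0} := by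
    intro w hw
    have hm := L.mem_indexAt (param 0 w)
    have h0 := (h₀ w).ne_zero hm
    have d1 : DifferentiableAt ℂ (fun v => σ₁ (chartChange v) (L.indexAt (param 0 w))) w :=
      DifferentiableAt.comp w (g := fun v => σ₁ v (L.indexAt (param 0 w)))
        ((h₁ (chartChange w)).diff _ (by rw [param_chartChange hw]; exact hm))
        (differentiableAt_chartChange hw)
    have d2 : DifferentiableAt ℂ (fun v : ℂ × ℂ => v.2 ^ m * σ₀ v (L.indexAt (param 0 w))) w :=
      (differentiableAt_snd.pow m).mul ((h₀ w).diff _ hm)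
    have d3 := DifferentiableAt.fun_inv d2 (by exact mul_ne_zero (pow_ne_zero m hw) h0)
    refine ((d1.fun_mul d3).congr_of_eventuallyEq ?_).differentiableWithinAt
    filter_upwards [hV.mem_nhds hw, (isOpen_preimage_param (L.isOpen_U _) 0).mem_nhds hm]
      with v hv hv'
    have h0' := (h₀ v).ne_zero hv'
    rw [hρ v hv _ hv', ← div_eq_mul_inv,
      mul_div_cancel_right₀ _ (mul_ne_zero (pow_ne_zero m hv) h0')]
  have hp : ((0, 1) : ℂ × ℂ) ∈ {w : ℂ × ℂ | w.2 ≠ 0} := by simp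
  have hmax : IsMaxOn (norm ∘ ρ) {w : ℂ × ℂ | w.2 ≠ 0} (0, 1) := fun w hw => by
    simp [hnorm w hw, hnorm _ hp]
  have hconst :=
    Complex.eqOn_of_isPreconnected_of_isMaxOn_norm isPreconnected_snd_ne_zero hV hd hp hmax
  let a : Circle := ⟨ρ (0, 1), by exact mem_sphere_zero_iff_norm.mpr (hnorm _ hp)⟩
  refine ⟨⟨fun c => if c = 0 then σ₀ else fun v => a⁻¹ • σ₁ v, fun c w => ?_, fun w hw i => ?_⟩⟩
  · fin_cases c
    · exact h₀ w
    · exact (h₁ w).smul a⁻¹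
  · change (a⁻¹ • σ₁ (chartChange w)) i = w.2 ^ m * σ₀ w i
    rw [circle_smul_apply, Circle.coe_inv, inv_mul_eq_iff_eq_mul₀ a.coe_ne_zero]
    by_cases hi : param 0 w ∈ L.U i
    · rw [hρ w hw i hi, hconst hw]
      rfl
    · rw [(h₀ w).zero i hi, (h₁ (chartChange w)).zero i (by rwa [param_chartChange hw])]
      simp

end Frames

/-! ### Sections as pairs of entire functions -/

/-- The pairs of entire functions which represent the holomorphic sections of `O(-m E)` in the
two charts. -/
structure IsModelSection (m : ℕ) (t : Fin 2 → ℂ × ℂ → ℂ) : Prop where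
  diff : ∀ c, Differentiable ℂ (t c)
  trans : ∀ w : ℂ × ℂ, w.2 ≠ 0 → t 0 w = w.2 ^ m * t 1 (chartChange w)

namespace UnitaryFrames

variable {L : LineBundle} {H : HermitianMetric L} {m : ℕ} (F : UnitaryFrames H m)

/-- The coefficients of a section with respect to the two frames. -/
def coeff : L.sections →ₗ[ℂ] (Fin 2 → ℂ × ℂ → ℂ) where
  toFun s c w := s.1 (L.indexAt (param c w)) (param c w) / F.σ c w (L.indexAt (param c w))
  map_add' s t := by
    funext c w
    simp [add_div]
  map_smul' a s := by
    funext c w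
    simp [mul_div_assoc]

theorem eq_coeff_mul (s : L.sections) {c : Fin 2} {w : ℂ × ℂ} {i : L.ι}
    (hi : param c w ∈ L.U i) : s.1 i (param c w) = F.coeff s c w * F.σ c w i := by
  have hm := L.mem_indexAt (param c w)
  have h0 := (F.isFrame c w).ne_zero hm
  rw [(F.isFrame c w).trans i _ ⟨hi, hm⟩, s.2.2.1 i _ _ ⟨hi, hm⟩]
  simp only [coeff, LinearMap.coe_mk, AddHom.coe_mk]
  field_simp

theorem isModelSection_coeff (s : L.sections) : IsModelSection m (F.coeff s) where
  diff c w := by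
    have hm := L.mem_indexAt (param c w)
    have ho := isOpen_preimage_param (L.isOpen_U (L.indexAt (param c w))) c
    have h1 : DifferentiableAt ℂ (fun v => s.1 (L.indexAt (param c w)) (param c v)) w :=
      (s.2.1 (L.indexAt (param c w)) c).differentiableAt (ho.mem_nhds hm)
    have h2 := DifferentiableAt.fun_inv ((F.isFrame c w).diff _ hm)
      (by exact (F.isFrame c w).ne_zero hm)
    refine (h1.fun_mul h2).congr_of_eventuallyEq ?_
    filter_upwards [ho.mem_nhds hm] with v hv
    rw [F.eq_coeff_mul s hv, ← div_eq_mul_inv, mul_div_cancel_right₀ _ ((F.isFrame c v).ne_zero hv)]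
  trans w hw := by
    have hm := L.mem_indexAt (param 0 w)
    have h1 := F.eq_coeff_mul s hm
    have h2 : s.1 (L.indexAt (param 0 w)) (param 1 (chartChange w)) = _ :=
      F.eq_coeff_mul s (by rw [param_chartChange hw]; exact hm)
    rw [param_chartChange hw, h1, F.transition w hw, ← mul_assoc] at h2
    rw [mul_right_cancel₀ ((F.isFrame 0 w).ne_zero hm) h2, mul_comm]

/-- Every pair of entire functions with the right transition behaviour comes from a section. -/
theorem exists_coeff_eq {t : Fin 2 → ℂ × ℂ → ℂ} (ht : IsModelSection m t) :
    ∃ s : L.sections, F.coeff s = t := by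
  classical
  let f : L.ι → BlowUp → ℂ := fun i x => if x ∈ chartDomain 0 then
    t 0 (coord 0 x) * F.σ 0 (coord 0 x) i else t 1 (coord 1 x) * F.σ 1 (coord 1 x) i
  have hf : ∀ i c w, f i (param c w) = t c w * F.σ c w i := by
    intro i c w
    have h0 : ∀ w : ℂ × ℂ, f i (param 0 w) = t 0 w * F.σ 0 w i := fun w => by
      simp only [f, if_pos (param_mem 0 w), coord_param]
    fin_cases c
    · exact h0 w
    · change f i (param 1 w) = t 1 w * F.σ 1 w i
      by_cases hw : param 1 w ∈ chartDomain 0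
      · obtain ⟨v, hv⟩ : ∃ v, param 0 v = param 1 w := ⟨_, param_coord 0 _ hw⟩
        have hv2 : v.2 ≠ 0 := by
          intro h2
          have hm := param_mem 1 w
          rw [← hv, show param 0 v = param 0 (v.1, 0) by rw [← h2]] at hm
          obtain ⟨a, ha⟩ := Projectivization.exists_smul_eq_mk_rep ℂ ((1 : ℂ), (0 : ℂ))
            (by simp [Prod.ext_iff])
          change (Projectivization.mk ℂ ((1 : ℂ), (0 : ℂ)) _).rep.2 ≠ 0 at hm
          rw [← ha] at hm
          simp [Units.smul_def] at hm
        have hw' : w = chartChange v := by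
          rw [← coord_param 1 w, ← hv, ← param_chartChange hv2, coord_param]
        rw [← hv, h0, hw', F.transition v hv2, ht.trans v hv2]
        ring
      · simp only [f, if_neg hw, coord_param]
  refine ⟨⟨f, ⟨fun i c => ?_, fun i j x hx => ?_, fun i x hx => ?_⟩⟩, ?_⟩
  · simp only [hf]
    exact fun w hw => ((ht.diff c w).mul ((F.isFrame c w).diff i hw)).differentiableWithinAt
  · obtain ⟨c, hc⟩ := exists_mem_chartDomain x
    rw [← param_coord c x hc] at hx ⊢
    rw [hf, hf, (F.isFrame c _).trans i j hx]
    ring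
  · obtain ⟨c, hc⟩ := exists_mem_chartDomain x
    rw [← param_coord c x hc] at hx ⊢
    rw [hf, (F.isFrame c _).zero i hx, mul_zero]
  · funext c w
    have hm := L.mem_indexAt (param c w)
    simp only [coeff, LinearMap.coe_mk, AddHom.coe_mk, hf]
    rw [mul_div_cancel_right₀ _ ((F.isFrame c w).ne_zero hm)]

theorem pairing_param (s t : L.sections) (c : Fin 2) (w : ℂ × ℂ) :
    H.pairing s t (param c w) = F.coeff s c w * conj (F.coeff t c w) *
      (Real.exp (-(m * localPotential c w)) : ℝ) := by
  have hm := L.mem_indexAt (param c w)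
  rw [H.pairing_eq s t _ _ hm, F.eq_coeff_mul s hm, F.eq_coeff_mul t hm,
    ← (F.isFrame c w).norm_eq _ hm]
  push_cast
  rw [map_mul, ← Complex.mul_conj']
  ring

theorem normSq_param (s : L.sections) (c : Fin 2) (w : ℂ × ℂ) :
    H.normSq s (param c w) = ‖F.coeff s c w‖ ^ 2 * Real.exp (-(m * localPotential c w)) := by
  rw [HermitianMetric.normSq, F.pairing_param, Complex.mul_conj', ← Complex.ofReal_pow,
    ← Complex.ofReal_mul, Complex.ofReal_re]

end UnitaryFrames

end Simanca

namespace Simanca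

/-! ### Taylor expansion of sections -/

open scoped ComplexConjugate
open MeasureTheory

/-- The `n`-th Taylor coefficient at the origin. -/
def taylorCoeff (n : ℕ) (f : ℂ → ℂ) : ℂ := (n.factorial : ℂ)⁻¹ * iteratedDeriv n f 0

theorem hasSum_taylorCoeff {f : ℂ → ℂ} (hf : Differentiable ℂ f) (z : ℂ) :
    HasSum (fun n => taylorCoeff n f * z ^ n) (f z) := by
  convert! Complex.hasSum_taylorSeries_of_entire hf 0 z using 2 with n
  simp [taylorCoeff]
  ring

theorem taylorCoeff_eq_circleIntegral {f : ℂ → ℂ} (hf : Differentiable ℂ f) (n : ℕ) :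
    taylorCoeff n f =
      (2 * Real.pi * Complex.I)⁻¹ * ∮ z in C(0, 1), (1 / z ^ (n + 1)) * f z := by
  have h := DiffContOnCl.circleIntegral_one_div_sub_center_pow_smul (c := 0) one_pos n
    hf.diffContOnCl
  simp only [sub_zero, smul_eq_mul] at h
  rw [h, taylorCoeff]
  have : (2 * Real.pi * Complex.I : ℂ) ≠ 0 := Complex.two_pi_I_ne_zero
  field_simp

/-- The Taylor coefficients in the first variable of an entire function of two variables are
entire functions of the second variable. -/
theorem differentiable_taylorCoeff {t : ℂ × ℂ → ℂ} (ht : Differentiable ℂ t) (n : ℕ) :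
    Differentiable ℂ fun w => taylorCoeff n fun v => t (v, w) := by
  have h1 : (fun w => taylorCoeff n fun v => t (v, w)) = fun w =>
      (2 * Real.pi * Complex.I)⁻¹ * ∮ z in C(0, 1), (1 / z ^ (n + 1)) * t (z, w) := by
    funext w
    exact taylorCoeff_eq_circleIntegral
      (ht.comp (differentiable_id.prodMk (differentiable_const w))) n
  rw [h1]
  refine Differentiable.const_mul (fun w₀ => ?_) _
  let k : ℝ → ℂ := fun θ => deriv (circleMap 0 1) θ * (1 / circleMap 0 1 θ ^ (n + 1))
  have hk : Continuous k := by
    have h2 : Continuous fun θ => 1 / circleMap 0 1 θ ^ (n + 1) :=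
      continuous_const.div ((continuous_circleMap 0 1).pow _)
        fun θ => pow_ne_zero _ (circleMap_ne_center one_ne_zero)
    simp only [k, deriv_circleMap]
    exact ((continuous_circleMap 0 1).mul continuous_const).mul h2
  have hint : ∀ w, (∮ z in C(0, 1), (1 / z ^ (n + 1)) * t (z, w)) =
      ∫ θ in (0 : ℝ)..2 * Real.pi, k θ * t (circleMap 0 1 θ, w) := by
    intro w
    simp only [circleIntegral, k, smul_eq_mul, mul_assoc]
  simp only [hint]
  have hcont : ∀ w, Continuous fun θ : ℝ => k θ * t (circleMap 0 1 θ, w) := fun w =>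
    hk.mul (ht.continuous.comp ((continuous_circleMap 0 1).prodMk continuous_const))
  obtain ⟨M, hM⟩ := ((isCompact_closedBall (0 : ℂ) 1).prod
    (isCompact_closedBall w₀ 2)).exists_bound_of_continuousOn ht.continuous.continuousOn
  have hpart : ∀ z w, HasDerivAt (fun w => t (z, w)) (fderiv ℂ t (z, w) (0, 1)) w := by
    intro z w
    have h3 : HasDerivAt (fun w : ℂ => (z, w)) ((0 : ℂ), (1 : ℂ)) w :=
      (hasDerivAt_const w z).prodMk (hasDerivAt_id w)
    exact (ht (z, w)).hasFDerivAt.comp_hasDerivAt w h3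
  have hbound : ∀ z ∈ Metric.closedBall (0 : ℂ) 1, ∀ w ∈ Metric.ball w₀ 1,
      ‖fderiv ℂ t (z, w) (0, 1)‖ ≤ M := by
    intro z hz w hw
    rw [← (hpart z w).deriv]
    have h4 := Complex.norm_deriv_le_of_forall_mem_sphere_norm_le (c := w) (R := 1) (C := M)
      (f := fun w => t (z, w)) one_pos
      ((ht.comp ((differentiable_const z).prodMk differentiable_id)).diffContOnCl) (by
        intro v hv
        refine hM (z, v) ⟨hz, ?_⟩
        rw [Metric.mem_closedBall]
        have h5 := dist_triangle v w w₀
        have h6 := Metric.mem_sphere.mp hv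
        have h7 := Metric.mem_ball.mp hw
        linarith)
    simpa using h4
  have hmap : ∀ θ : ℝ, circleMap 0 1 θ ∈ Metric.closedBall (0 : ℂ) 1 := fun θ =>
    circleMap_mem_closedBall 0 zero_le_one θ
  refine (intervalIntegral.hasDerivAt_integral_of_dominated_loc_of_deriv_le
    (F' := fun w θ => k θ * fderiv ℂ t (circleMap 0 1 θ, w) (0, 1))
    (bound := fun θ => ‖k θ‖ * M)
    (Metric.ball_mem_nhds w₀ one_pos)
    (Filter.Eventually.of_forall fun w => (hcont w).aestronglyMeasurable)
    ((hcont w₀).intervalIntegrable _ _) ?_ ?_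
    ((hk.norm.mul continuous_const).intervalIntegrable _ _) ?_).2.differentiableAt
  · refine (hk.measurable.mul ?_).aestronglyMeasurable
    exact (measurable_fderiv_apply_const ℂ t ((0 : ℂ), (1 : ℂ))).comp
      ((continuous_circleMap 0 1).prodMk continuous_const).measurable
  · refine Filter.Eventually.of_forall fun θ _ w hw => ?_
    rw [norm_mul]
    exact mul_le_mul_of_nonneg_left (hbound _ (hmap θ) w hw) (norm_nonneg _)
  · exact Filter.Eventually.of_forall fun θ _ w _ => (hpart _ w).const_mul _

/-- An entire function of growth at most `|w| ^ N` is a polynomial of degree at most `N`. -/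
theorem exists_polynomial_of_growth {f g : ℂ → ℂ} {N : ℕ} (hf : Differentiable ℂ f)
    (hg : Continuous g) (h : ∀ w, w ≠ 0 → f w = w ^ N * g w⁻¹) :
    ∃ c : ℕ → ℂ, (∀ b ∉ Finset.range (N + 1), c b = 0) ∧
      (∀ w, f w = ∑ b ∈ Finset.range (N + 1), c b * w ^ b) ∧
      ∀ u, g u = ∑ b ∈ Finset.range (N + 1), c b * u ^ (N - b) := by
  have hzero : ∀ b ∉ Finset.range (N + 1), taylorCoeff b f = 0 := by
    intro b hb
    rw [Finset.mem_range, not_lt] at hb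
    obtain ⟨M, hM⟩ := (isCompact_closedBall (0 : ℂ) 1).exists_bound_of_continuousOn hg.continuousOn
    have hest : ∀ R : ℝ, 1 ≤ R → ‖iteratedDeriv b f 0‖ ≤ b.factorial * M / R := by
      intro R hR
      have hR0 : 0 < R := by linarith
      have hM0 : 0 ≤ M := (norm_nonneg _).trans (hM 0 (by simp))
      have h1 := Complex.norm_iteratedDeriv_le_of_forall_mem_sphere_norm_le (c := 0) (R := R)
        (C := R ^ N * M) b hR0 hf.diffContOnCl (by
          intro z hz
          have hz' : ‖z‖ = R := by simpa using hz
          have hz0 : z ≠ 0 := by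
            rintro rfl
            simp at hz'
            linarith
          rw [h z hz0, norm_mul, norm_pow, hz']
          refine mul_le_mul_of_nonneg_left (hM _ ?_) (by positivity)
          rw [mem_closedBall_zero_iff, norm_inv, hz']
          exact inv_le_one_of_one_le₀ hR)
      refine h1.trans ?_
      rw [div_le_div_iff₀ (by positivity) hR0]
      have h2 : R ^ N * R ≤ R ^ b := by
        rw [← pow_succ]
        exact pow_le_pow_right₀ hR hb
      have h3 : 0 ≤ b.factorial * M := by positivity
      nlinarith
    have hlim : Filter.Tendsto (fun R : ℝ => b.factorial * M / R) Filter.atTop (nhds 0) :=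
      Filter.Tendsto.div_atTop tendsto_const_nhds Filter.tendsto_id
    have h4 : ‖iteratedDeriv b f 0‖ ≤ 0 := ge_of_tendsto hlim
      (by filter_upwards [Filter.eventually_ge_atTop 1] with R hR using hest R hR)
    rw [taylorCoeff, norm_le_zero_iff.mp h4, mul_zero]
  have hfsum : ∀ w, f w = ∑ b ∈ Finset.range (N + 1), taylorCoeff b f * w ^ b := by
    intro w
    refine (hasSum_taylorCoeff hf w).unique (hasSum_sum_of_ne_finset_zero fun b hb => ?_)
    rw [hzero b hb, zero_mul]
  refine ⟨fun b => taylorCoeff b f, hzero, hfsum, ?_⟩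
  have hne : ∀ u ∈ ({0}ᶜ : Set ℂ),
      g u = ∑ b ∈ Finset.range (N + 1), taylorCoeff b f * u ^ (N - b) := by
    intro u hu
    have hu0 : u ≠ 0 := hu
    have h1 := h u⁻¹ (inv_ne_zero hu0)
    rw [inv_inv, hfsum] at h1
    have h2 : g u = u ^ N * ∑ b ∈ Finset.range (N + 1), taylorCoeff b f * u⁻¹ ^ b := by
      rw [h1, inv_pow, mul_inv_cancel_left₀ (pow_ne_zero N hu0)]
    rw [h2, Finset.mul_sum]
    refine Finset.sum_congr rfl fun b hb => ?_
    have hb' : b ≤ N := Nat.lt_succ_iff.mp (Finset.mem_range.mp hb)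
    rw [pow_sub₀ u hu0 hb', inv_pow]
    ring
  have hc : Continuous fun u : ℂ =>
      ∑ b ∈ Finset.range (N + 1), taylorCoeff b f * u ^ (N - b) := by fun_prop
  exact fun u => congrFun (hg.ext_on (dense_compl_singleton 0) hc hne) u

/-- The monomial sections: in the coordinates of `ℂ²` these are `z₁ ^ (a + m - b) * z₂ ^ b`. -/
def monomial (m a b : ℕ) : Fin 2 → ℂ × ℂ → ℂ
  | 0, w => w.2 ^ b * w.1 ^ a
  | 1, w => w.1 ^ (a + m - b) * w.2 ^ a

theorem isModelSection_monomial {m a b : ℕ} (hb : b ≤ a + m) :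
    IsModelSection m (monomial m a b) where
  diff c := by
    fin_cases c
    · exact (differentiable_snd.pow b).mul (differentiable_fst.pow a)
    · exact (differentiable_fst.pow _).mul (differentiable_snd.pow a)
  trans w hw := by
    simp only [monomial, chartChange]
    have h : w.2 ^ m * w.2 ^ a = w.2 ^ b * w.2 ^ (a + m - b) := by
      rw [← pow_add, ← pow_add]; congr 1; omega
    have h2 : w.2 ^ (a + m - b) ≠ 0 := pow_ne_zero _ hw
    rw [inv_pow, mul_pow]
    field_simp
    linear_combination (-w.1 ^ a) * h

theorem taylorCoeff_comp_mul {f : ℂ → ℂ} (hf : Differentiable ℂ f) (a : ℕ) (r s : ℂ) :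
    taylorCoeff a (fun v => r * f (s * v)) = r * s ^ a * taylorCoeff a f := by
  have h := congrFun (iteratedDeriv_comp_const_mul (n := a) (f := f) hf.contDiff s) 0
  rw [taylorCoeff, iteratedDeriv_const_mul_field, h, taylorCoeff]
  simp
  ring

/-- The expansion of a section into monomials, with the same coefficients in both charts. -/
theorem IsModelSection.exists_expansion {m : ℕ} {t : Fin 2 → ℂ × ℂ → ℂ} (ht : IsModelSection m t) :
    ∃ c : ℕ → ℕ → ℂ, (∀ a, ∀ b ∉ Finset.range (a + m + 1), c a b = 0) ∧
      ∀ i w, HasSum (fun a => ∑ b ∈ Finset.range (a + m + 1), c a b * monomial m a b i w)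
        (t i w) := by
  have hd0 : ∀ w2, Differentiable ℂ fun v => t 0 (v, w2) := fun w2 =>
    (ht.diff 0).comp (differentiable_id.prodMk (differentiable_const w2))
  have hd1 : ∀ u1, Differentiable ℂ fun v => t 1 (u1, v) := fun u1 =>
    (ht.diff 1).comp ((differentiable_const u1).prodMk differentiable_id)
  let f : ℕ → ℂ → ℂ := fun a w2 => taylorCoeff a fun v => t 0 (v, w2)
  let g : ℕ → ℂ → ℂ := fun a u1 => taylorCoeff a fun v => t 1 (u1, v)
  have hf : ∀ a, Differentiable ℂ (f a) := fun a => differentiable_taylorCoeff (ht.diff 0) a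
  have hg : ∀ a, Differentiable ℂ (g a) := fun a =>
    differentiable_taylorCoeff (t := fun w => t 1 (w.2, w.1))
      ((ht.diff 1).comp (differentiable_snd.prodMk differentiable_fst)) a
  have hfg : ∀ a w, w ≠ 0 → f a w = w ^ (a + m) * g a w⁻¹ := by
    intro a w hw
    have h1 : (fun v => t 0 (v, w)) = fun v => w ^ m * (fun v => t 1 (w⁻¹, v)) (w * v) := by
      funext v
      rw [ht.trans (v, w) hw, chartChange]
      simp only [mul_comm v w]
    simp only [f, g]
    rw [h1, taylorCoeff_comp_mul (hd1 _)]
    ring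
  choose c hc0 hcf hcg using fun a =>
    exists_polynomial_of_growth (hf a) (hg a).continuous (hfg a)
  refine ⟨c, hc0, fun i w => ?_⟩
  fin_cases i
  · have h1 : HasSum (fun a => f a w.2 * w.1 ^ a) (t 0 w) := hasSum_taylorCoeff (hd0 w.2) w.1
    refine h1.congr_fun fun a => ?_
    rw [hcf, Finset.sum_mul]
    exact Finset.sum_congr rfl fun b _ => by simp [monomial, mul_assoc]
  · have h1 : HasSum (fun a => g a w.1 * w.2 ^ a) (t 1 w) := hasSum_taylorCoeff (hd1 w.1) w.2
    refine h1.congr_fun fun a => ?_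
    rw [hcg, Finset.sum_mul]
    exact Finset.sum_congr rfl fun b _ => by simp [monomial, mul_assoc]

end Simanca

namespace Simanca

/-! ### Integration in polar coordinates -/

open scoped ComplexConjugate
open MeasureTheory Set

theorem integral_exp_int_mul_I (k : ℤ) :
    ∫ θ in (-Real.pi)..Real.pi, Complex.exp (k * θ * Complex.I) =
      if k = 0 then 2 * (Real.pi : ℂ) else 0 := by
  split_ifs with hk
  · simp [hk]; ring
  · have hc : (k * Complex.I : ℂ) ≠ 0 := mul_ne_zero (by exact_mod_cast hk) Complex.I_ne_zero
    have h1 : ∀ θ : ℝ, (k * θ * Complex.I : ℂ) = k * Complex.I * θ := fun θ => by ring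
    simp only [h1]
    rw [integral_exp_mul_complex hc]
    have h2 : (k * Complex.I * (Real.pi : ℝ) : ℂ) =
        k * Complex.I * ((-Real.pi : ℝ) : ℂ) + k * (2 * Real.pi * Complex.I) := by
      push_cast; ring
    rw [h2, Complex.exp_add, Complex.exp_int_mul_two_pi_mul_I, mul_one, sub_self, zero_div]

/-- The mean of `f(z) z̄ ^ a` over a circle picks out the `a`-th Taylor coefficient. -/
theorem integral_circle_mul_conj_pow {f : ℂ → ℂ} {d : ℕ → ℂ}
    (hf : ∀ z, HasSum (fun n => d n * z ^ n) (f z)) (a : ℕ) (r : ℝ) :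
    ∫ θ in (-Real.pi)..Real.pi, f (r * Complex.exp (θ * Complex.I)) *
      conj (r * Complex.exp (θ * Complex.I)) ^ a = 2 * Real.pi * d a * (r : ℂ) ^ (2 * a) := by
  have hterm : ∀ (n : ℕ) (θ : ℝ), d n * (r * Complex.exp (θ * Complex.I)) ^ n *
      conj (r * Complex.exp (θ * Complex.I)) ^ a =
      d n * (r : ℂ) ^ (n + a) * Complex.exp (((n - a : ℤ) : ℂ) * θ * Complex.I) := by
    intro n θ
    have h1 : conj (r * Complex.exp (θ * Complex.I)) = r * Complex.exp (-(θ * Complex.I)) := by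
      rw [map_mul, Complex.conj_ofReal, ← Complex.exp_conj]
      simp
    rw [h1, mul_pow, mul_pow, ← Complex.exp_nat_mul, ← Complex.exp_nat_mul]
    have h2 : (((n - a : ℤ) : ℂ) * θ * Complex.I) =
        n * (θ * Complex.I) + a * (-(θ * Complex.I)) := by push_cast; ring
    rw [h2, Complex.exp_add]
    ring
  have hsum : Summable fun n => ‖d n * (r : ℂ) ^ n‖ := (hf r).summable.norm
  have h := intervalIntegral.hasSum_integral_of_dominated_convergence (μ := volume)
    (a := -Real.pi) (b := Real.pi)
    (F := fun n θ => d n * (r * Complex.exp (θ * Complex.I)) ^ n *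
      conj (r * Complex.exp (θ * Complex.I)) ^ a)
    (f := fun θ : ℝ => f (r * Complex.exp (θ * Complex.I)) *
      conj (r * Complex.exp (θ * Complex.I)) ^ a)
    (fun n _ => ‖d n * (r : ℂ) ^ n‖ * |r| ^ a)
    (fun n => (by fun_prop : Continuous fun θ : ℝ => d n * (r * Complex.exp (θ * Complex.I)) ^ n *
      conj (r * Complex.exp (θ * Complex.I)) ^ a).aestronglyMeasurable)
    (fun n => Filter.Eventually.of_forall fun θ _ => by
      simp only [norm_mul, norm_pow, RCLike.norm_conj, Complex.norm_exp_ofReal_mul_I, mul_one,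
        Complex.norm_real, Real.norm_eq_abs]
      exact le_rfl)
    (Filter.Eventually.of_forall fun θ _ => hsum.mul_right _)
    (by simp)
    (Filter.Eventually.of_forall fun θ _ => (hf _).mul_right _)
  refine h.unique ?_
  have h3 : ∀ n, (∫ θ in (-Real.pi)..Real.pi, d n * (r * Complex.exp (θ * Complex.I)) ^ n *
      conj (r * Complex.exp (θ * Complex.I)) ^ a) =
      if n = a then 2 * Real.pi * d a * (r : ℂ) ^ (2 * a) else 0 := by
    intro n
    simp only [hterm]
    rw [intervalIntegral.integral_const_mul, integral_exp_int_mul_I]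
    by_cases hn : n = a
    · subst hn
      simp
      ring
    · rw [if_neg (by omega), if_neg hn, mul_zero]
  simp only [h3]
  exact hasSum_ite_eq a _

theorem integral_radial (G : ℝ → ℝ) :
    ∫ z : ℂ, G ‖z‖ = 2 * Real.pi * ∫ r in Ioi (0 : ℝ), r * G r := by
  rw [← Complex.integral_comp_polarCoord_symm, polarCoord_target]
  have h1 : ∫ p in Ioi (0 : ℝ) ×ˢ Ioo (-Real.pi) Real.pi,
      p.1 • G ‖Complex.polarCoord.symm p‖ =
      ∫ p in Ioi (0 : ℝ) ×ˢ Ioo (-Real.pi) Real.pi, (p.1 * G p.1) * (fun _ => (1 : ℝ)) p.2 := by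
    refine setIntegral_congr_fun (measurableSet_Ioi.prod measurableSet_Ioo) fun p hp => ?_
    simp only [Complex.norm_polarCoord_symm, smul_eq_mul, mul_one]
    rw [abs_of_pos hp.1]
  rw [h1, Measure.volume_eq_prod, setIntegral_prod_mul (fun r => r * G r) (fun _ => (1 : ℝ))]
  simp only [integral_const, measureReal_restrict_apply MeasurableSet.univ, univ_inter,
    Real.volume_real_Ioo_of_le (by linarith [Real.pi_pos] : -Real.pi ≤ Real.pi)]
  simp
  ring

theorem integrableOn_polarCoord {F : ℂ → ℂ} (hF : Integrable F) :
    IntegrableOn (fun p : ℝ × ℝ => p.1 • F (Complex.polarCoord.symm p))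
      (Ioi (0 : ℝ) ×ˢ Ioo (-Real.pi) Real.pi) := by
  have h1 : Integrable (fun p : ℝ × ℝ => F (Complex.measurableEquivRealProd.symm p)) :=
    (Complex.volume_preserving_equiv_real_prod.symm).integrable_comp_emb
      Complex.measurableEquivRealProd.symm.measurableEmbedding |>.mpr hF
  have h2 := (integrableOn_image_iff_integrableOn_abs_det_fderiv_smul volume
    polarCoord.open_target.measurableSet
    (fun p _ => (hasFDerivAt_polarCoord_symm p).hasFDerivWithinAt)
    (polarCoord.symm.injOn) (fun p : ℝ × ℝ => F (Complex.measurableEquivRealProd.symm p))).mp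
    h1.integrableOn
  rw [polarCoord_target] at h2
  refine h2.congr_fun (fun p hp => ?_) (measurableSet_Ioi.prod measurableSet_Ioo)
  simp only [det_fderivPolarCoordSymm]
  rw [abs_of_pos hp.1]
  rfl

/-- Integrating an entire function against `z̄ ^ a` and a radial weight picks out the `a`-th
Taylor coefficient. -/
theorem integral_mul_conj_pow_mul_radial {f : ℂ → ℂ} {d : ℕ → ℂ}
    (hf : ∀ z, HasSum (fun n => d n * z ^ n) (f z)) (a : ℕ) (ρ : ℝ → ℝ)
    (hint : Integrable fun z => f z * conj z ^ a * (ρ ‖z‖ : ℂ)) :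
    ∫ z, f z * conj z ^ a * (ρ ‖z‖ : ℂ) = d a * (∫ z : ℂ, ‖z‖ ^ (2 * a) * ρ ‖z‖ : ℝ) := by
  rw [integral_radial fun r => r ^ (2 * a) * ρ r, ← Complex.integral_comp_polarCoord_symm,
    polarCoord_target, Measure.volume_eq_prod, setIntegral_prod _ (integrableOn_polarCoord hint)]
  have h1 : ∀ r ∈ Ioi (0 : ℝ), ∫ θ in Ioo (-Real.pi) Real.pi,
      r • (f (Complex.polarCoord.symm (r, θ)) * conj (Complex.polarCoord.symm (r, θ)) ^ a *
        (ρ ‖Complex.polarCoord.symm (r, θ)‖ : ℂ)) =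
      (d a * (2 * Real.pi)) * ((r * (r ^ (2 * a) * ρ r) : ℝ) : ℂ) := by
    intro r hr
    have h2 : ∀ θ : ℝ, r • (f (Complex.polarCoord.symm (r, θ)) *
        conj (Complex.polarCoord.symm (r, θ)) ^ a *
        (ρ ‖Complex.polarCoord.symm (r, θ)‖ : ℂ)) =
        (f (r * Complex.exp (θ * Complex.I)) * conj (r * Complex.exp (θ * Complex.I)) ^ a) *
          ((r * ρ r : ℝ) : ℂ) := by
      intro θ
      have h3 : Complex.polarCoord.symm (r, θ) = r * Complex.exp (θ * Complex.I) := by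
        rw [Complex.polarCoord_symm_apply, Complex.exp_mul_I]
        simp
      rw [Complex.norm_polarCoord_symm, abs_of_pos hr, h3, Complex.real_smul]
      push_cast
      ring
    simp only [h2]
    rw [integral_mul_const, ← integral_Ioc_eq_integral_Ioo,
      ← intervalIntegral.integral_of_le (by linarith [Real.pi_pos]),
      integral_circle_mul_conj_pow hf]
    push_cast
    ring
  rw [setIntegral_congr_fun measurableSet_Ioi h1, integral_const_mul, integral_complex_ofReal]
  push_cast
  ring

/-! ### Norms of the monomial sections -/

theorem integral_pow_mul_exp (k : ℕ) {β : ℝ} (hβ : 0 < β) :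
    ∫ z : ℂ, ‖z‖ ^ (2 * k) * Real.exp (-β * ‖z‖ ^ 2) = Real.pi * k.factorial / β ^ (k + 1) := by
  have h := Complex.integral_rpow_mul_exp_neg_mul_rpow (p := 2) (q := 2 * k) (b := β)
    (by norm_num) (by have : (0 : ℝ) ≤ k := by positivity
                      linarith) hβ
  have h1 : ((2 * (k : ℝ) + 2) / 2) = k + 1 := by ring
  have h2 : (-(2 * (k : ℝ) + 2) / 2) = -((k + 1 : ℕ) : ℝ) := by push_cast; ring
  rw [h1, h2, Real.Gamma_nat_eq_factorial, Real.rpow_neg hβ.le, Real.rpow_natCast] at h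
  have h3 : ∀ z : ℂ, ‖z‖ ^ (2 * (k : ℝ)) * Real.exp (-β * ‖z‖ ^ (2 : ℝ)) =
      ‖z‖ ^ (2 * k) * Real.exp (-β * ‖z‖ ^ 2) := by
    intro z
    have : (2 * (k : ℝ)) = ((2 * k : ℕ) : ℝ) := by push_cast; ring
    rw [this, Real.rpow_natCast, Real.rpow_two]
  simp only [h3] at h
  rw [h]
  field_simp

theorem integrable_pow_mul_exp (k : ℕ) {β : ℝ} (hβ : 0 < β) :
    Integrable fun z : ℂ => ‖z‖ ^ (2 * k) * Real.exp (-β * ‖z‖ ^ 2) := by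
  -- The integral of a non-integrable function is zero.
  refine Integrable.of_integral_ne_zero ?_
  rw [integral_pow_mul_exp k hβ]
  positivity

theorem hasDerivAt_pow_div_one_add_sq (k N : ℕ) (r : ℝ) :
    HasDerivAt (fun r : ℝ => r ^ k / (1 + r ^ 2) ^ (N + 1))
      (k * r ^ (k - 1) / (1 + r ^ 2) ^ (N + 1) -
        2 * (N + 1) * r ^ (k + 1) / (1 + r ^ 2) ^ (N + 2)) r := by
  have h0 : (1 + r ^ 2) ≠ 0 := by positivity
  have h1 : HasDerivAt (fun r : ℝ => (1 + r ^ 2) ^ (N + 1))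
      (((N + 1 : ℕ) : ℝ) * (1 + r ^ 2) ^ N * (2 * r)) r := by
    have := ((hasDerivAt_pow 2 r).const_add 1).fun_pow (N + 1)
    simpa using this
  refine ((hasDerivAt_pow k r).fun_div h1 (pow_ne_zero _ h0)).congr_deriv ?_
  push_cast
  field_simp
  ring

theorem integrableOn_pow_div_one_add_sq {b N : ℕ} (hb : b ≤ N) :
    IntegrableOn (fun r : ℝ => r ^ (2 * b + 1) / (1 + r ^ 2) ^ (N + 2)) (Ioi 0) := by
  have h1 : IntegrableOn (fun r : ℝ => 2 * r / (1 + r ^ 2) ^ 2) (Ioi 0) := by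
    refine integrableOn_Ioi_deriv_of_nonneg' (g := fun r => -(1 + r ^ 2)⁻¹) (l := 0) ?_ ?_ ?_
    · intro r _
      have h0 : (1 + r ^ 2) ≠ 0 := by positivity
      refine (((hasDerivAt_pow 2 r).const_add 1).fun_inv h0).fun_neg.congr_deriv ?_
      simp
      ring
    · intro r hr
      have : 0 < r := hr
      positivity
    · rw [← neg_zero]
      refine (Filter.Tendsto.inv_tendsto_atTop ?_).neg
      exact Filter.tendsto_atTop_add_const_left _ _ (Filter.tendsto_pow_atTop two_ne_zero)
  refine Integrable.mono' h1 ?_ ?_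
  · refine Continuous.aestronglyMeasurable ?_
    exact (by fun_prop : Continuous fun r : ℝ => r ^ (2 * b + 1)).div (by fun_prop)
      fun r => by positivity
  · refine (ae_restrict_iff' measurableSet_Ioi).mpr (Filter.Eventually.of_forall fun r hr => ?_)
    have hr0 : 0 < r := hr
    rw [Real.norm_of_nonneg (by positivity), div_le_div_iff₀ (by positivity) (by positivity)]
    have h2 : (r ^ 2) ^ b ≤ (1 + r ^ 2) ^ N :=
      (pow_le_pow_left₀ (by positivity) (by linarith) b).trans
        (pow_le_pow_right₀ (by nlinarith) hb)
    calc r ^ (2 * b + 1) * (1 + r ^ 2) ^ 2 = (r ^ 2) ^ b * (r * (1 + r ^ 2) ^ 2) := by ring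
      _ ≤ (1 + r ^ 2) ^ N * (r * (1 + r ^ 2) ^ 2) :=
        mul_le_mul_of_nonneg_right h2 (by positivity)
      _ ≤ 2 * r * (1 + r ^ 2) ^ (N + 2) := by
        have : 0 ≤ (1 + r ^ 2) ^ N * (r * (1 + r ^ 2) ^ 2) := by positivity
        calc _ ≤ 2 * ((1 + r ^ 2) ^ N * (r * (1 + r ^ 2) ^ 2)) := by linarith
          _ = _ := by ring

theorem tendsto_pow_div_one_add_sq {k N : ℕ} (hk : k < 2 * (N + 1)) :
    Filter.Tendsto (fun r : ℝ => r ^ k / (1 + r ^ 2) ^ (N + 1)) Filter.atTop (nhds 0) := by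
  have h1 : Filter.Tendsto (fun r : ℝ => r⁻¹) Filter.atTop (nhds 0) := tendsto_inv_atTop_zero
  refine squeeze_zero' ?_ ?_ h1
  · filter_upwards [Filter.eventually_ge_atTop 0] with r hr
    positivity
  · filter_upwards [Filter.eventually_ge_atTop 1] with r hr
    have hr0 : 0 < r := by linarith
    rw [div_le_iff₀ (by positivity), inv_mul_eq_div, le_div_iff₀ hr0, ← pow_succ]
    calc r ^ (k + 1) ≤ r ^ (2 * (N + 1)) := pow_le_pow_right₀ hr hk
      _ = (r ^ 2) ^ (N + 1) := by rw [pow_mul]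
      _ ≤ (1 + r ^ 2) ^ (N + 1) := pow_le_pow_left₀ (by positivity) (by linarith) _

/-- A beta integral, computed by recursion on `b`: integrate the derivative of
`r ^ (2 b) / (1 + r²) ^ (N + 1)`. -/
theorem integral_Ioi_pow_div_one_add_sq (N : ℕ) : ∀ b ≤ N,
    ∫ r in Ioi (0 : ℝ), r ^ (2 * b + 1) / (1 + r ^ 2) ^ (N + 2) =
      (b.factorial : ℝ) * (N - b).factorial / (2 * (N + 1).factorial) := by
  intro b
  induction b with
  | zero =>
    intro _
    have h1 : ∀ r ∈ Ici (0 : ℝ), HasDerivAt (fun r : ℝ => r ^ 0 / (1 + r ^ 2) ^ (N + 1))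
        (-(2 * (N + 1)) * (r ^ (2 * 0 + 1) / (1 + r ^ 2) ^ (N + 2))) r := fun r _ =>
      (hasDerivAt_pow_div_one_add_sq 0 N r).congr_deriv (by simp; ring)
    have h2 := integral_Ioi_of_hasDerivAt_of_tendsto' h1
      ((integrableOn_pow_div_one_add_sq (Nat.zero_le N)).const_mul _)
      (tendsto_pow_div_one_add_sq (by omega))
    rw [integral_const_mul] at h2
    have h3 : (2 * ((N : ℝ) + 1)) ≠ 0 := by positivity
    rw [Nat.factorial_succ]
    push_cast
    have h4 : ((N.factorial : ℝ)) ≠ 0 := by positivity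
    simp at h2 ⊢
    field_simp
    linarith
  | succ b ih =>
    intro hb
    have ih' := ih (by omega)
    have h1 : ∀ r ∈ Ici (0 : ℝ), HasDerivAt (fun r : ℝ => r ^ (2 * b + 2) / (1 + r ^ 2) ^ (N + 1))
        (2 * (b + 1) * (r ^ (2 * b + 1) / (1 + r ^ 2) ^ (N + 2)) -
        2 * (N - b) * (r ^ (2 * (b + 1) + 1) / (1 + r ^ 2) ^ (N + 2))) r := fun r _ => by
      refine (hasDerivAt_pow_div_one_add_sq (2 * b + 2) N r).congr_deriv ?_
      have : (1 + r ^ 2) ≠ 0 := by positivity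
      simp only [show 2 * b + 2 - 1 = 2 * b + 1 by omega]
      push_cast
      field_simp
      ring
    have i1 := (integrableOn_pow_div_one_add_sq (b := b) (N := N) (by omega)).const_mul
      (2 * ((b : ℝ) + 1))
    have i2 := (integrableOn_pow_div_one_add_sq hb).const_mul (2 * ((N : ℝ) - b))
    have h2 := integral_Ioi_of_hasDerivAt_of_tendsto' h1 (i1.sub i2)
      (tendsto_pow_div_one_add_sq (by omega))
    rw [integral_sub i1 i2, integral_const_mul, integral_const_mul, ih'] at h2
    have h3 : ((N : ℝ) - b) ≠ 0 := by
      have : (b : ℝ) + 1 ≤ N := by exact_mod_cast hb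
      intro h; linarith
    have h4 : ((N - b).factorial : ℝ) = (N - b) * (N - (b + 1)).factorial := by
      rw [show N - b = (N - (b + 1)) + 1 by omega, Nat.factorial_succ]
      have : ((N - (b + 1) : ℕ) : ℝ) = N - (b + 1) := by
        rw [Nat.cast_sub hb]; push_cast; ring
      push_cast
      rw [this]
      ring
    have h5 : (((N + 1).factorial : ℝ)) ≠ 0 := by positivity
    rw [h4] at h2
    rw [Nat.factorial_succ b]
    push_cast
    simp at h2
    field_simp at h2 ⊢
    rw [mul_zero] at h2
    have h6 := sub_eq_zero.mp ((mul_eq_zero.mp h2).resolve_left h3)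
    linarith

theorem integral_pow_div_one_add_sq {b N : ℕ} (hb : b ≤ N) :
    ∫ z : ℂ, ‖z‖ ^ (2 * b) / (1 + ‖z‖ ^ 2) ^ (N + 2) =
      Real.pi * (b.factorial * (N - b).factorial) / (N + 1).factorial := by
  rw [integral_radial fun r => r ^ (2 * b) / (1 + r ^ 2) ^ (N + 2)]
  have h : ∀ r : ℝ, r * (r ^ (2 * b) / (1 + r ^ 2) ^ (N + 2)) =
      r ^ (2 * b + 1) / (1 + r ^ 2) ^ (N + 2) := fun r => by ring
  simp only [h]
  rw [integral_Ioi_pow_div_one_add_sq N b hb]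
  field_simp

/-- The density, as a function of `r = |w₁|` and `q = |w₂|`, of `exp (-m φ) ω_S² / 2!` in the
first chart. -/
def weight (m : ℕ) (r q : ℝ) : ℝ :=
  (r ^ 2 + (1 + q ^ 2)⁻¹) / Real.pi ^ 2 *
    (Real.exp (-(m * (1 + q ^ 2)) * r ^ 2) * ((1 + q ^ 2) ^ m)⁻¹)

theorem weight_nonneg (m : ℕ) (r q : ℝ) : 0 ≤ weight m r q := by
  unfold weight; positivity

theorem continuous_weight (m : ℕ) : Continuous fun w : ℂ × ℂ => weight m ‖w.1‖ ‖w.2‖ := by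
  have h1 : ∀ w : ℂ × ℂ, 1 + ‖w.2‖ ^ 2 ≠ 0 := fun w => by positivity
  have h2 : ∀ w : ℂ × ℂ, (1 + ‖w.2‖ ^ 2) ^ m ≠ 0 := fun w => by positivity
  unfold weight
  fun_prop (disch := assumption)

/-- The squared norms of the monomial sections. -/
def monomialNormSq (m a b : ℕ) : ℝ :=
  a.factorial * (b.factorial * (a + m - b).factorial) / (m ^ (a + 2) * (a + m).factorial)

variable {m : ℕ}

theorem pow_mul_weight_eq (a : ℕ) (q r : ℝ) : r ^ (2 * a) * weight m r q =
    (r ^ (2 * (a + 1)) * Real.exp (-(m * (1 + q ^ 2)) * r ^ 2) +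
      (1 + q ^ 2)⁻¹ * (r ^ (2 * a) * Real.exp (-(m * (1 + q ^ 2)) * r ^ 2))) *
      (((1 + q ^ 2) ^ m)⁻¹ / Real.pi ^ 2) := by
  unfold weight
  ring

theorem integrable_pow_mul_weight (hm : 1 ≤ m) (a : ℕ) (q : ℝ) :
    Integrable fun z : ℂ => ‖z‖ ^ (2 * a) * weight m ‖z‖ q := by
  have hm' : (0 : ℝ) < m := by exact_mod_cast hm
  have hβ : 0 < m * (1 + q ^ 2) := by positivity
  simp only [pow_mul_weight_eq]
  exact ((integrable_pow_mul_exp _ hβ).add ((integrable_pow_mul_exp _ hβ).const_mul _)).mul_const _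

theorem integral_pow_mul_weight (hm : 1 ≤ m) (a : ℕ) (q : ℝ) :
    ∫ z : ℂ, ‖z‖ ^ (2 * a) * weight m ‖z‖ q =
      a.factorial * (a + m + 1) / (Real.pi * m ^ (a + 2)) / (1 + q ^ 2) ^ (a + m + 2) := by
  have hm' : (0 : ℝ) < m := by exact_mod_cast hm
  have hβ : 0 < m * (1 + q ^ 2) := by positivity
  simp only [pow_mul_weight_eq]
  rw [integral_mul_const, integral_add (integrable_pow_mul_exp _ hβ)
    ((integrable_pow_mul_exp _ hβ).const_mul _), integral_const_mul, integral_pow_mul_exp _ hβ,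
    integral_pow_mul_exp _ hβ, Nat.factorial_succ]
  have h1 : (1 + q ^ 2) ≠ 0 := by positivity
  generalize 1 + q ^ 2 = s at h1
  have := Real.pi_ne_zero
  rw [mul_pow, mul_pow]
  push_cast
  field_simp
  ring

theorem integral_pow_mul_integral_weight (hm : 1 ≤ m) {a b : ℕ} (hb : b ≤ a + m) :
    ∫ w : ℂ, ‖w‖ ^ (2 * b) * ∫ z : ℂ, ‖z‖ ^ (2 * a) * weight m ‖z‖ ‖w‖ = monomialNormSq m a b := by
  have hm' : (0 : ℝ) < m := by exact_mod_cast hm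
  simp only [integral_pow_mul_weight hm]
  have h1 : ∀ w : ℂ, ‖w‖ ^ (2 * b) * (a.factorial * (a + m + 1) / (Real.pi * m ^ (a + 2)) /
      (1 + ‖w‖ ^ 2) ^ (a + m + 2)) = (a.factorial * (a + m + 1) / (Real.pi * m ^ (a + 2))) *
      (‖w‖ ^ (2 * b) / (1 + ‖w‖ ^ 2) ^ (a + m + 2)) := fun w => by ring
  simp only [h1]
  rw [integral_const_mul, integral_pow_div_one_add_sq hb, monomialNormSq, Nat.factorial_succ]
  have := Real.pi_ne_zero
  push_cast
  field_simp

theorem monomialNormSq_pos (hm : 1 ≤ m) (a b : ℕ) : 0 < monomialNormSq m a b := by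
  have hm' : (0 : ℝ) < m := by exact_mod_cast hm
  unfold monomialNormSq
  positivity

theorem lintegral_monomial (hm : 1 ≤ m) {a b : ℕ} (hb : b ≤ a + m) :
    ∫⁻ w : ℂ × ℂ, ENNReal.ofReal (‖monomial m a b 0 w‖ ^ 2 * weight m ‖w.1‖ ‖w.2‖) =
      ENNReal.ofReal (monomialNormSq m a b) := by
  have hcont : Continuous fun w : ℂ × ℂ =>
      ‖monomial m a b 0 w‖ ^ 2 * weight m ‖w.1‖ ‖w.2‖ := by
    have h1 : Continuous fun w : ℂ × ℂ => ‖w.2 ^ b * w.1 ^ a‖ ^ 2 := by fun_prop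
    exact h1.mul (continuous_weight m)
  have hform : ∀ v w : ℂ, ‖monomial m a b 0 (v, w)‖ ^ 2 * weight m ‖v‖ ‖w‖ =
      ‖w‖ ^ (2 * b) * (‖v‖ ^ (2 * a) * weight m ‖v‖ ‖w‖) := by
    intro v w
    simp only [monomial, norm_mul, norm_pow]
    ring
  rw [Measure.volume_eq_prod, lintegral_prod_symm' _ hcont.measurable.ennreal_ofReal]
  have hin : ∀ w : ℂ, ∫⁻ v : ℂ, ENNReal.ofReal (‖monomial m a b 0 (v, w)‖ ^ 2 *
      weight m ‖v‖ ‖w‖) = ENNReal.ofReal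
        (‖w‖ ^ (2 * b) * ∫ v : ℂ, ‖v‖ ^ (2 * a) * weight m ‖v‖ ‖w‖) := by
    intro w
    simp only [hform]
    rw [← ofReal_integral_eq_lintegral_ofReal ((integrable_pow_mul_weight hm a ‖w‖).const_mul _)
      (Filter.Eventually.of_forall fun v => by
        have := weight_nonneg m ‖v‖ ‖w‖
        positivity), integral_const_mul]
  simp only [hin]
  rw [← integral_pow_mul_integral_weight hm hb, ofReal_integral_eq_lintegral_ofReal]
  · refine Integrable.of_integral_ne_zero ?_
    rw [integral_pow_mul_integral_weight hm hb]
    exact (monomialNormSq_pos hm a b).ne'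
  · refine Filter.Eventually.of_forall fun w => ?_
    have : 0 ≤ ∫ v : ℂ, ‖v‖ ^ (2 * a) * weight m ‖v‖ ‖w‖ := integral_nonneg fun v => by
      have := weight_nonneg m ‖v‖ ‖w‖
      positivity
    positivity

/-- The scalar product with a monomial section picks out a coefficient of the expansion. -/
theorem integral_mul_conj_monomial (hm : 1 ≤ m) {t : ℂ × ℂ → ℂ} {c : ℕ → ℕ → ℂ}
    (hc0 : ∀ a, ∀ b ∉ Finset.range (a + m + 1), c a b = 0)
    (hc : ∀ w, HasSum (fun a => ∑ b ∈ Finset.range (a + m + 1), c a b * monomial m a b 0 w) (t w))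
    {a b : ℕ} (hb : b ≤ a + m)
    (hint : Integrable fun w : ℂ × ℂ =>
      t w * conj (monomial m a b 0 w) * (weight m ‖w.1‖ ‖w.2‖ : ℂ)) :
    ∫ w : ℂ × ℂ, t w * conj (monomial m a b 0 w) * (weight m ‖w.1‖ ‖w.2‖ : ℂ) =
      c a b * monomialNormSq m a b := by
  let P : ℕ → ℂ → ℂ := fun a w => ∑ b ∈ Finset.range (a + m + 1), c a b * w ^ b
  have hP : ∀ w z, HasSum (fun n => P n w * z ^ n) (t (z, w)) := by
    intro w z
    refine (hc (z, w)).congr_fun fun n => ?_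
    simp only [P, Finset.sum_mul]
    exact Finset.sum_congr rfl fun b _ => by simp [monomial, mul_assoc]
  have hPa : ∀ w, HasSum (fun n => c a n * w ^ n) (P a w) := fun w =>
    hasSum_sum_of_ne_finset_zero fun b hb => by rw [hc0 a b hb, zero_mul]
  rw [Measure.volume_eq_prod] at hint ⊢
  rw [integral_prod_symm _ hint]
  let ρ : ℝ → ℝ := fun q => ∫ z : ℂ, ‖z‖ ^ (2 * a) * weight m ‖z‖ q
  have hae : (fun w : ℂ => ∫ v : ℂ, t (v, w) * conj (monomial m a b 0 (v, w)) *
      (weight m ‖v‖ ‖w‖ : ℂ)) =ᵐ[volume] fun w => P a w * conj w ^ b * (ρ ‖w‖ : ℂ) := by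
    filter_upwards [hint.prod_left_ae] with w hw
    have h1 : ∀ v : ℂ, t (v, w) * conj (monomial m a b 0 (v, w)) * (weight m ‖v‖ ‖w‖ : ℂ) =
        conj w ^ b * (t (v, w) * conj v ^ a * (weight m ‖v‖ ‖w‖ : ℂ)) := by
      intro v
      simp only [monomial, map_mul, map_pow]
      ring
    simp only [h1] at hw ⊢
    rw [integral_const_mul]
    rcases eq_or_ne (conj w ^ b) 0 with h0 | h0
    · rw [h0]; ring
    · rw [integral_mul_conj_pow_mul_radial (hP w) a (fun r => weight m r ‖w‖)
        ((integrable_const_mul_iff (IsUnit.mk0 _ h0) _).mp hw)]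
      ring
  rw [integral_congr_ae hae, integral_mul_conj_pow_mul_radial hPa b ρ
    (hint.integral_prod_right.congr hae), integral_pow_mul_integral_weight hm hb]

end Simanca

namespace Simanca

/-! ### Orthonormal families and reproducing vectors -/

open scoped ComplexConjugate
open MeasureTheory Set

section Hilbert

open scoped InnerProductSpace

variable {H κ : Type*} [NormedAddCommGroup H] [InnerProductSpace ℂ H]
  {v : κ → H}

theorem mem_closure_span_of_hasSum {k : κ → ℂ} {K : H} (h : HasSum (fun n => k n • v n) K) :
    K ∈ (Submodule.span ℂ (range v)).topologicalClosure :=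
  mem_closure_of_tendsto h (Filter.Eventually.of_forall fun _ =>
    Submodule.sum_mem _ fun n _ => Submodule.smul_mem _ _ (Submodule.subset_span ⟨n, rfl⟩))

theorem exists_hasSum_smul [CompleteSpace H] (hv : Orthonormal ℂ v)
    {k : κ → ℂ} (hk : Summable fun n => ‖k n‖ ^ 2) : ∃ K, HasSum (fun n => k n • v n) K :=
  (hv.orthogonalFamily.summable_iff_norm_sq_summable k).mpr hk

theorem inner_of_hasSum (hv : Orthonormal ℂ v) {k : κ → ℂ} {K : H}
    (h : HasSum (fun n => k n • v n) K) (n : κ) : ⟪v n, K⟫_ℂ = k n := by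
  classical
  have h1 := h.mapL (innerSL ℂ (v n))
  refine h1.unique ?_
  have h2 : ∀ l, innerSL ℂ (v n) (k l • v l) = if l = n then k n else 0 := by
    intro l
    rw [innerSL_apply_apply, inner_smul_right, orthonormal_iff_ite.mp hv]
    by_cases hl : l = n
    · subst hl; simp
    · rw [if_neg hl, if_neg (Ne.symm hl), mul_zero]
  simp only [h2]
  exact hasSum_ite_eq n _

theorem hasSum_norm_sq_of_hasSum (hv : Orthonormal ℂ v) {k : κ → ℂ} {K : H}
    (h : HasSum (fun n => k n • v n) K) : HasSum (fun n => ‖k n‖ ^ 2) (‖K‖ ^ 2) := by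
  have h1 := h.mapL (innerSL ℂ K)
  have h2 : ∀ n, innerSL ℂ K (k n • v n) = ((‖k n‖ ^ 2 : ℝ) : ℂ) := by
    intro n
    rw [innerSL_apply_apply, inner_smul_right, ← inner_conj_symm, inner_of_hasSum hv h,
      Complex.mul_conj']
    push_cast
    rfl
  simp only [h2] at h1
  rw [innerSL_apply_apply, inner_self_eq_norm_sq_to_K] at h1
  simpa [← Complex.ofReal_pow] using h1.mapL Complex.reCLM

theorem hasSum_inner_smul [CompleteSpace H] (hv : Orthonormal ℂ v) {K : H}
    (hK : K ∈ (Submodule.span ℂ (range v)).topologicalClosure) :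
    HasSum (fun n => ⟪v n, K⟫_ℂ • v n) K := by
  obtain ⟨K', hK'⟩ := exists_hasSum_smul hv (k := fun n => ⟪v n, K⟫_ℂ)
    (hv.inner_products_summable K)
  have h1 : K - K' ∈ (Submodule.span ℂ (range v)).topologicalClosure :=
    Submodule.sub_mem _ hK (mem_closure_span_of_hasSum hK')
  have h2 : K - K' ∈ (Submodule.span ℂ (range v))ᗮ := by
    rw [Submodule.mem_orthogonal]
    intro u hu
    induction hu using Submodule.span_induction with
    | mem x hx =>
      obtain ⟨n, rfl⟩ := hx
      rw [inner_sub_right, inner_of_hasSum hv hK', sub_self]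
    | zero => exact inner_zero_left _
    | add x y _ _ hx hy => rw [inner_add_left, hx, hy, add_zero]
    | smul a x _ hx => rw [inner_smul_left, hx, mul_zero]
  rw [← Submodule.orthogonal_closure] at h2
  have h3 : K - K' = 0 := by
    have := Submodule.mem_inf.mpr ⟨h1, h2⟩
    rwa [Submodule.inf_orthogonal_eq_bot, Submodule.mem_bot] at this
  rwa [← sub_eq_zero.mp h3] at hK'

/-- Parseval's identity for a vector in the closed span of an orthonormal family. -/
theorem hasSum_norm_inner_sq [CompleteSpace H] (hv : Orthonormal ℂ v) {K : H}
    (hK : K ∈ (Submodule.span ℂ (range v)).topologicalClosure) :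
    HasSum (fun n => ‖⟪v n, K⟫_ℂ‖ ^ 2) (‖K‖ ^ 2) :=
  hasSum_norm_sq_of_hasSum hv (hasSum_inner_smul hv hK)

end Hilbert

/-! ### The Hilbert space of square integrable sections -/

/-- The measure `exp (-m φ) ω_S² / 2!` in the first chart. -/
def modelMeasure (m : ℕ) : Measure (ℂ × ℂ) :=
  volume.withDensity fun w => ENNReal.ofReal (weight m ‖w.1‖ ‖w.2‖)

theorem measurable_toNNReal_weight (m : ℕ) :
    Measurable fun w : ℂ × ℂ => (weight m ‖w.1‖ ‖w.2‖).toNNReal :=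
  (continuous_weight m).measurable.real_toNNReal

theorem integral_modelMeasure (m : ℕ) (g : ℂ × ℂ → ℂ) :
    ∫ w, g w ∂modelMeasure m = ∫ w : ℂ × ℂ, g w * (weight m ‖w.1‖ ‖w.2‖ : ℂ) := by
  refine (integral_withDensity_eq_integral_smul (measurable_toNNReal_weight m) g).trans ?_
  refine integral_congr_ae (Filter.Eventually.of_forall fun w => ?_)
  simp only [NNReal.smul_def, Real.coe_toNNReal _ (weight_nonneg m _ _), Complex.real_smul]
  ring

theorem integrable_modelMeasure {m : ℕ} {g : ℂ × ℂ → ℂ} (hg : Integrable g (modelMeasure m)) :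
    Integrable fun w : ℂ × ℂ => g w * (weight m ‖w.1‖ ‖w.2‖ : ℂ) := by
  have h := (integrable_withDensity_iff_integrable_smul (measurable_toNNReal_weight m)).mp hg
  refine h.congr (Filter.Eventually.of_forall fun w => ?_)
  simp only [NNReal.smul_def, Real.coe_toNNReal _ (weight_nonneg m _ _), Complex.real_smul]
  ring

theorem lintegral_modelMeasure (m : ℕ) {g : ℂ × ℂ → ENNReal} (hg : Measurable g) :
    ∫⁻ w, g w ∂modelMeasure m =
      ∫⁻ w : ℂ × ℂ, g w * ENNReal.ofReal (weight m ‖w.1‖ ‖w.2‖) := by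
  rw [modelMeasure, lintegral_withDensity_eq_lintegral_mul _
    (continuous_weight m).measurable.ennreal_ofReal hg]
  simp only [Pi.mul_apply, mul_comm]

theorem memLp_two_iff {m : ℕ} {g : ℂ × ℂ → ℂ} (hg : Continuous g) :
    MemLp g 2 (modelMeasure m) ↔ ∫⁻ w, ENNReal.ofReal (‖g w‖ ^ 2) ∂modelMeasure m < ⊤ := by
  have h : ∀ w, ENNReal.ofReal (‖g w‖ ^ 2) = ‖g w‖ₑ ^ (2 : ℝ) := fun w => by
    rw [ENNReal.ofReal_pow (norm_nonneg _), ofReal_norm]; norm_cast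
  simp only [h]
  rw [MemLp, and_iff_right hg.aestronglyMeasurable,
    eLpNorm_lt_top_iff_lintegral_rpow_enorm_lt_top two_ne_zero ENNReal.ofNat_ne_top]
  simp

/-- The index set of the monomials `z₁ ^ (a + m - b) * z₂ ^ b` of degree at least `m`. -/
abbrev MonomialIndex (m : ℕ) : Type := Σ a : ℕ, Fin (a + m + 1)

/-- The normalized monomial sections. -/
def basisSection (m : ℕ) (n : MonomialIndex m) (i : Fin 2) (w : ℂ × ℂ) : ℂ :=
  (((Real.sqrt (monomialNormSq m n.1 n.2))⁻¹ : ℝ) : ℂ) * monomial m n.1 n.2 i w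

variable {m : ℕ}

theorem MonomialIndex.le (n : MonomialIndex m) : (n.2 : ℕ) ≤ n.1 + m := Nat.lt_succ_iff.mp n.2.2

theorem IsModelSection.const_mul {t : Fin 2 → ℂ × ℂ → ℂ} (ht : IsModelSection m t) (k : ℂ) :
    IsModelSection m fun i w => k * t i w where
  diff c := (ht.diff c).const_mul k
  trans w hw := by rw [ht.trans w hw]; ring

theorem isModelSection_basisSection (n : MonomialIndex m) :
    IsModelSection m (basisSection m n) :=
  (isModelSection_monomial n.le).const_mul _

theorem memLp_monomial (hm : 1 ≤ m) (n : MonomialIndex m) :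
    MemLp (monomial m n.1 n.2 0) 2 (modelMeasure m) := by
  have hc := ((isModelSection_monomial n.le).diff 0).continuous
  rw [memLp_two_iff hc, lintegral_modelMeasure m (by fun_prop)]
  simp only [← ENNReal.ofReal_mul (sq_nonneg _)]
  rw [lintegral_monomial hm n.le]
  exact ENNReal.ofReal_lt_top

theorem memLp_basisSection (hm : 1 ≤ m) (n : MonomialIndex m) :
    MemLp (basisSection m n 0) 2 (modelMeasure m) :=
  (memLp_monomial hm n).const_mul _

/-- The orthonormal family of the normalized monomials in `L²`. -/
def basisLp (hm : 1 ≤ m) (n : MonomialIndex m) : Lp ℂ 2 (modelMeasure m) :=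
  (memLp_basisSection hm n).toLp

open scoped InnerProductSpace

theorem inner_toLp {f g : ℂ × ℂ → ℂ} (hf : MemLp f 2 (modelMeasure m))
    (hg : MemLp g 2 (modelMeasure m)) :
    ⟪hf.toLp, hg.toLp⟫_ℂ = ∫ w, g w * conj (f w) ∂modelMeasure m := by
  rw [L2.inner_def]
  refine integral_congr_ae ?_
  filter_upwards [hf.coeFn_toLp, hg.coeFn_toLp] with w h1 h2
  rw [h1, h2]
  simp

/-- The coefficients of the expansion of a section into monomials are, up to normalization, its
scalar products with the normalized monomials. -/
theorem inner_basisLp (hm : 1 ≤ m) {t : ℂ × ℂ → ℂ} {c : ℕ → ℕ → ℂ}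
    (hc0 : ∀ a, ∀ b ∉ Finset.range (a + m + 1), c a b = 0)
    (hc : ∀ w, HasSum (fun a => ∑ b ∈ Finset.range (a + m + 1), c a b * monomial m a b 0 w) (t w))
    (ht : MemLp t 2 (modelMeasure m)) (n : MonomialIndex m) :
    ⟪basisLp hm n, ht.toLp⟫_ℂ = c n.1 n.2 * Real.sqrt (monomialNormSq m n.1 n.2) := by
  have hpos := monomialNormSq_pos hm n.1 n.2
  have hint : Integrable (fun w => t w * conj (monomial m n.1 n.2 0 w)) (modelMeasure m) :=
    ht.integrable_mul (memLp_monomial hm n).star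
  have h1 := integral_mul_conj_monomial hm hc0 hc n.le (integrable_modelMeasure hint)
  rw [basisLp, inner_toLp]
  have h2 : ∀ w, t w * conj (basisSection m n 0 w) =
      (((Real.sqrt (monomialNormSq m n.1 n.2))⁻¹ : ℝ) : ℂ) *
        (t w * conj (monomial m n.1 n.2 0 w)) := by
    intro w
    rw [basisSection, map_mul, Complex.conj_ofReal]
    ring
  simp only [h2]
  rw [integral_const_mul, integral_modelMeasure, h1, mul_left_comm, ← Complex.ofReal_mul]
  congr 2
  rw [inv_mul_eq_div, Real.div_sqrt]

theorem basisLp_orthonormal (hm : 1 ≤ m) : Orthonormal ℂ (basisLp hm) := by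
  classical
  rw [orthonormal_iff_ite]
  intro n k
  have hpos := monomialNormSq_pos hm k.1 k.2
  let c : ℕ → ℕ → ℂ := fun a b => if a = k.1 ∧ b = k.2 then
    (((Real.sqrt (monomialNormSq m k.1 k.2))⁻¹ : ℝ) : ℂ) else 0
  have hc0 : ∀ a, ∀ b ∉ Finset.range (a + m + 1), c a b = 0 := by
    intro a b hb
    refine if_neg ?_
    rintro ⟨rfl, rfl⟩
    exact hb (Finset.mem_range.mpr k.2.2)
  have hc : ∀ w, HasSum (fun a => ∑ b ∈ Finset.range (a + m + 1), c a b * monomial m a b 0 w)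
      (basisSection m k 0 w) := by
    intro w
    have h1 : ∀ a, ∑ b ∈ Finset.range (a + m + 1), c a b * monomial m a b 0 w =
        if a = k.1 then basisSection m k 0 w else 0 := by
      intro a
      by_cases ha : a = k.1
      · subst ha
        rw [if_pos rfl, Finset.sum_eq_single (k.2 : ℕ)]
        · simp [c, basisSection]
        · intro b _ hb
          simp [c, hb]
        · intro h
          exact absurd (Finset.mem_range.mpr k.2.2) h
      · simp [c, ha]
    simp only [h1]
    exact hasSum_ite_eq k.1 _
  have h := inner_basisLp hm hc0 hc (memLp_basisSection hm k) n
  change ⟪basisLp hm n, basisLp hm k⟫_ℂ = _ at h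
  rw [h]
  by_cases hn : n = k
  · subst hn
    have hs : Real.sqrt (monomialNormSq m n.1 n.2) ≠ 0 := (Real.sqrt_pos.mpr hpos).ne'
    simp [c, hs]
  · rw [if_neg hn]
    have : ¬(n.1 = k.1 ∧ (n.2 : ℕ) = k.2) := by
      rintro ⟨h1, h2⟩
      apply hn
      obtain ⟨n1, n2⟩ := n
      obtain ⟨k1, k2⟩ := k
      subst h1
      exact congrArg (Sigma.mk n1) (Fin.ext h2)
    simp [c, this]

/-- The expansion of a square integrable section in the normalized monomials converges to it
pointwise, in both charts. -/
theorem hasSum_inner_basisLp (hm : 1 ≤ m) {t : Fin 2 → ℂ × ℂ → ℂ} (ht : IsModelSection m t)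
    (h2 : MemLp (t 0) 2 (modelMeasure m)) (i : Fin 2) (w : ℂ × ℂ) :
    HasSum (fun a => ∑ b : Fin (a + m + 1),
      ⟪basisLp hm ⟨a, b⟩, h2.toLp⟫_ℂ * basisSection m ⟨a, b⟩ i w) (t i w) := by
  obtain ⟨c, hc0, hc⟩ := ht.exists_expansion
  refine (hc i w).congr_fun fun a => ?_
  rw [Finset.sum_range]
  refine Finset.sum_congr rfl fun b _ => ?_
  rw [inner_basisLp hm hc0 (hc 0) h2, basisSection]
  have hs : ((Real.sqrt (monomialNormSq m a b) : ℝ) : ℂ) ≠ 0 := by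
    exact_mod_cast (Real.sqrt_pos.mpr (monomialNormSq_pos hm a b)).ne'
  push_cast
  field_simp

/-- The monomials span the space of square integrable sections: the expansion of a section
converges in `L²`, and the limit coincides with the pointwise limit. -/
theorem toLp_mem_closure_span (hm : 1 ≤ m) {t : Fin 2 → ℂ × ℂ → ℂ} (ht : IsModelSection m t)
    (h2 : MemLp (t 0) 2 (modelMeasure m)) :
    h2.toLp ∈ (Submodule.span ℂ (range (basisLp hm))).topologicalClosure := by
  have hv := basisLp_orthonormal hm
  obtain ⟨K, hK⟩ := exists_hasSum_smul hv (k := fun n => ⟪basisLp hm n, h2.toLp⟫_ℂ)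
    (hv.inner_products_summable h2.toLp)
  suffices h : K = h2.toLp by
    rw [← h]
    exact mem_closure_span_of_hasSum hK
  have h3 : HasSum (fun a => ∑ b : Fin (a + m + 1),
      ⟪basisLp hm ⟨a, b⟩, h2.toLp⟫_ℂ • basisLp hm ⟨a, b⟩) K :=
    hK.sigma fun a => hasSum_fintype _
  obtain ⟨ns, hns, hae⟩ :=
    (tendstoInMeasure_of_tendsto_Lp h3.tendsto_sum_nat).exists_seq_tendsto_ae
  have hterm : ∀ᵐ w ∂modelMeasure m, ∀ n : MonomialIndex m,
      basisLp hm n w = basisSection m n 0 w :=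
    ae_all_iff.mpr fun n => (memLp_basisSection hm n).coeFn_toLp
  have hsum : ∀ A : ℕ, ∀ᵐ w ∂modelMeasure m,
      (∑ a ∈ Finset.range A, ∑ b : Fin (a + m + 1),
        ⟪basisLp hm ⟨a, b⟩, h2.toLp⟫_ℂ • basisLp hm ⟨a, b⟩ : Lp ℂ 2 (modelMeasure m)) w =
      ∑ a ∈ Finset.range A, ∑ b : Fin (a + m + 1),
        ⟪basisLp hm ⟨a, b⟩, h2.toLp⟫_ℂ * basisSection m ⟨a, b⟩ 0 w := by
    intro A
    have e1 : ∀ᵐ w ∂modelMeasure m, ∀ n : MonomialIndex m,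
        (⟪basisLp hm n, h2.toLp⟫_ℂ • basisLp hm n : Lp ℂ 2 (modelMeasure m)) w =
          ⟪basisLp hm n, h2.toLp⟫_ℂ * basisLp hm n w :=
      ae_all_iff.mpr fun n => Lp.coeFn_smul _ _
    have e2 : ∀ᵐ w ∂modelMeasure m, ∀ a : ℕ,
        (∑ b : Fin (a + m + 1), ⟪basisLp hm ⟨a, b⟩, h2.toLp⟫_ℂ • basisLp hm ⟨a, b⟩ :
          Lp ℂ 2 (modelMeasure m)) w =
        ∑ b : Fin (a + m + 1), (⟪basisLp hm ⟨a, b⟩, h2.toLp⟫_ℂ • basisLp hm ⟨a, b⟩ :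
          Lp ℂ 2 (modelMeasure m)) w :=
      ae_all_iff.mpr fun a => (Lp.coeFn_finsetSum _ _).mono fun w hw => by
        rw [hw, Finset.sum_apply]
    filter_upwards [hterm, e1, e2, Lp.coeFn_finsetSum (Finset.range A) fun a =>
      (∑ b : Fin (a + m + 1), ⟪basisLp hm ⟨a, b⟩, h2.toLp⟫_ℂ • basisLp hm ⟨a, b⟩ :
          Lp ℂ 2 (modelMeasure m))] with w w1 w2 w3 w4
    rw [w4, Finset.sum_apply]
    simp only [w3, w2, w1]
  refine Lp.ext ?_
  filter_upwards [hae, ae_all_iff.mpr hsum, h2.coeFn_toLp] with w h4 h5 h6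
  rw [h6]
  refine tendsto_nhds_unique h4 ?_
  simp only [h5]
  exact (hasSum_inner_basisLp hm ht h2 0 w).tendsto_sum_nat.comp hns.tendsto_atTop

theorem localPotential_eq (i : Fin 2) (w : ℂ × ℂ) : localPotential i w =
    ‖divisorCoord i w‖ ^ 2 * (1 + ‖fibreCoord i w‖ ^ 2) + Real.log (1 + ‖fibreCoord i w‖ ^ 2) := by
  fin_cases i <;> rfl

/-- The sum of the squared norms of the monomials of one degree is given by the binomial
formula. -/
theorem sum_norm_sq_basisSection (hm : 1 ≤ m) (a : ℕ) (i : Fin 2) (w : ℂ × ℂ) :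
    ∑ b : Fin (a + m + 1), ‖basisSection m ⟨a, b⟩ i w‖ ^ 2 =
      m ^ (a + 2) / a.factorial * (‖divisorCoord i w‖ ^ 2) ^ a *
        (1 + ‖fibreCoord i w‖ ^ 2) ^ (a + m) := by
  have hm' : (0 : ℝ) < m := by exact_mod_cast hm
  have hnorm : ∀ b ∈ Finset.range (a + m + 1), ∀ z : ℂ,
      ‖(((Real.sqrt (monomialNormSq m a b))⁻¹ : ℝ) : ℂ) * z‖ ^ 2 =
      m ^ (a + 2) / a.factorial * ((a + m).choose b) * ‖z‖ ^ 2 := by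
    intro b hb z
    have hb' : b ≤ a + m := Nat.lt_succ_iff.mp (Finset.mem_range.mp hb)
    have h1 : ((a + m).choose b : ℝ) =
        (a + m).factorial / (b.factorial * (a + m - b).factorial) := by
      rw [Nat.cast_choose ℝ hb']
    rw [norm_mul, mul_pow, Complex.norm_real, Real.norm_eq_abs, sq_abs, inv_pow,
      Real.sq_sqrt (monomialNormSq_pos hm a b).le, h1, monomialNormSq]
    field_simp
  have h0 := Finset.sum_range (n := a + m + 1) fun b =>
    ‖(((Real.sqrt (monomialNormSq m a b))⁻¹ : ℝ) : ℂ) * monomial m a b i w‖ ^ 2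
  refine h0.symm.trans ?_
  rw [Finset.sum_congr rfl fun b hb => hnorm b hb _]
  fin_cases i
  · change ∑ b ∈ Finset.range (a + m + 1), m ^ (a + 2) / a.factorial * ((a + m).choose b) *
      ‖w.2 ^ b * w.1 ^ a‖ ^ 2 =
      m ^ (a + 2) / a.factorial * (‖w.1‖ ^ 2) ^ a * (1 + ‖w.2‖ ^ 2) ^ (a + m)
    rw [add_comm 1, add_pow, Finset.mul_sum]
    refine Finset.sum_congr rfl fun b _ => ?_
    rw [norm_mul, norm_pow, norm_pow]
    ring
  · change ∑ b ∈ Finset.range (a + m + 1), m ^ (a + 2) / a.factorial * ((a + m).choose b) *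
      ‖w.1 ^ (a + m - b) * w.2 ^ a‖ ^ 2 =
      m ^ (a + 2) / a.factorial * (‖w.2‖ ^ 2) ^ a * (1 + ‖w.1‖ ^ 2) ^ (a + m)
    rw [add_pow, Finset.mul_sum]
    refine Finset.sum_congr rfl fun b _ => ?_
    rw [norm_mul, norm_pow, norm_pow]
    ring

/-- The kernel on the diagonal: the binomial sums over each degree add up to an exponential
series. -/
theorem hasSum_norm_sq_basisSection (hm : 1 ≤ m) (i : Fin 2) (w : ℂ × ℂ) :
    HasSum (fun n : MonomialIndex m => ‖basisSection m n i w‖ ^ 2)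
      (m ^ 2 * Real.exp (m * localPotential i w)) := by
  have hs : 0 < 1 + ‖fibreCoord i w‖ ^ 2 := by positivity
  have h1 : HasSum (fun a => ∑ b : Fin (a + m + 1), ‖basisSection m ⟨a, b⟩ i w‖ ^ 2)
      (m ^ 2 * Real.exp (m * localPotential i w)) := by
    simp only [sum_norm_sq_basisSection hm]
    rw [localPotential_eq, mul_add, Real.exp_add, Real.exp_nat_mul (Real.log _), Real.exp_log hs]
    have h2 := NormedSpace.expSeries_div_hasSum_exp
      ((m : ℝ) * (‖divisorCoord i w‖ ^ 2 * (1 + ‖fibreCoord i w‖ ^ 2)))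
    rw [← Real.exp_eq_exp_ℝ] at h2
    refine ((h2.mul_right ((1 + ‖fibreCoord i w‖ ^ 2) ^ m)).mul_left ((m : ℝ) ^ 2)).congr_fun
      fun a => ?_
    rw [mul_pow, mul_pow]
    ring
  refine HasSum.sigma_of_hasSum h1 (fun a => hasSum_fintype _) ?_
  rw [summable_sigma_of_nonneg fun n => sq_nonneg _]
  refine ⟨fun a => (hasSum_fintype _).summable, ?_⟩
  simp only [tsum_fintype]
  exact h1.summable

/-- The reproducing kernel: evaluation of square integrable sections at the point with coordinates
`w` in the chart `i` is represented by a vector of squared norm `m² exp (m φ)`. -/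
theorem exists_reproducing (hm : 1 ≤ m) (i : Fin 2) (w : ℂ × ℂ) :
    ∃ K ∈ (Submodule.span ℂ (range (basisLp hm))).topologicalClosure,
      ‖K‖ ^ 2 = m ^ 2 * Real.exp (m * localPotential i w) ∧
      ∀ (t : Fin 2 → ℂ × ℂ → ℂ) (_ : IsModelSection m t) (h2 : MemLp (t 0) 2 (modelMeasure m)),
        ⟪K, h2.toLp⟫_ℂ = t i w := by
  have hv := basisLp_orthonormal hm
  have hsum := hasSum_norm_sq_basisSection hm i w
  obtain ⟨K, hK⟩ := exists_hasSum_smul hv (k := fun n => conj (basisSection m n i w))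
    (by simpa only [RCLike.norm_conj] using hsum.summable)
  refine ⟨K, mem_closure_span_of_hasSum hK, ?_, fun t ht h2 => ?_⟩
  · have h1 := hasSum_norm_sq_of_hasSum hv hK
    simp only [RCLike.norm_conj] at h1
    exact h1.unique hsum
  · have h1 := (hasSum_inner_smul hv (toLp_mem_closure_span hm ht h2)).mapL (innerSL ℂ K)
    rw [innerSL_apply_apply] at h1
    have h3 : ∀ n, innerSL ℂ K (⟪basisLp hm n, h2.toLp⟫_ℂ • basisLp hm n) =
        ⟪basisLp hm n, h2.toLp⟫_ℂ * basisSection m n i w := by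
      intro n
      rw [innerSL_apply_apply, inner_smul_right, ← inner_conj_symm K, inner_of_hasSum hv hK,
        Complex.conj_conj]
    simp only [h3] at h1
    exact (h1.sigma fun a => hasSum_fintype _).unique (hasSum_inner_basisLp hm ht h2 i w)

end Simanca

namespace Simanca

/-! ### Scalar products of sections in the first chart -/

open scoped ComplexConjugate InnerProductSpace
open MeasureTheory Set

theorem exists_eq_chartChange {u : ℂ × ℂ} (hu : u.1 ≠ 0) :
    ∃ v : ℂ × ℂ, v.2 = u.1⁻¹ ∧ chartChange v = u := by
  refine ⟨(u.1 * u.2, u.1⁻¹), rfl, ?_⟩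
  ext
  · simp [chartChange]
  · simp [chartChange]
    field_simp

theorem measurableEmbedding_param (c : Fin 2) : MeasurableEmbedding (param c) :=
  ((chart c).symm.isOpenEmbedding rfl).measurableEmbedding

theorem volumeDensity_zero (w : ℂ × ℂ) : volumeDensity 0 w =
    ENNReal.ofReal ((‖w.1‖ ^ 2 + (1 + ‖w.2‖ ^ 2)⁻¹) / Real.pi ^ 2) := by
  rw [volumeDensity, det_simancaForm_zero, Complex.ofReal_re]

/-- The complement of the first chart domain is a null set. -/
theorem volumeMeasure_eq :
    volumeMeasure = (volume.withDensity (volumeDensity 0)).map (param 0) := by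
  have h1 : (volume : Measure (ℂ × ℂ)) (param 1 ⁻¹' (chartDomain 0)ᶜ) = 0 := by
    refine measure_mono_null (t := {0} ×ˢ univ) (fun u hu => ?_) ?_
    · by_contra h
      have hu1 : u.1 ≠ 0 := fun h0 => h ⟨h0, mem_univ _⟩
      obtain ⟨v, hv, rfl⟩ := exists_eq_chartChange hu1
      refine hu ?_
      rw [param_chartChange (by rw [hv]; exact inv_ne_zero hu1)]
      exact param_mem 0 v
    · rw [Measure.volume_eq_prod, Measure.prod_prod]
      simp
  have h2 : (volume.withDensity (volumeDensity 1)) (param 1 ⁻¹' (chartDomain 0)ᶜ) = 0 :=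
    withDensity_absolutelyContinuous _ _ h1
  rw [volumeMeasure, Measure.restrict_eq_zero.mpr h2, Measure.map_zero, add_zero]

theorem weight_eq (m : ℕ) (w : ℂ × ℂ) : weight m ‖w.1‖ ‖w.2‖ =
    (‖w.1‖ ^ 2 + (1 + ‖w.2‖ ^ 2)⁻¹) / Real.pi ^ 2 * Real.exp (-(m * localPotential 0 w)) := by
  have hs : 0 < 1 + ‖w.2‖ ^ 2 := by positivity
  have h : -((m : ℝ) * localPotential 0 w) =
      -(m * (1 + ‖w.2‖ ^ 2)) * ‖w.1‖ ^ 2 + -(m * Real.log (1 + ‖w.2‖ ^ 2)) := by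
    simp only [localPotential]
    ring
  rw [weight, h, Real.exp_add, Real.exp_neg (_ * Real.log _), Real.exp_nat_mul, Real.exp_log hs]

namespace UnitaryFrames

variable {L : LineBundle} {H : HermitianMetric L} {m : ℕ} (F : UnitaryFrames H m)

theorem energy_eq (s : L.sections) :
    H.energy s = ∫⁻ w, ENNReal.ofReal (‖F.coeff s 0 w‖ ^ 2) ∂modelMeasure m := by
  have hc := ((F.isModelSection_coeff s).diff 0).continuous
  have hm : Measurable (volumeDensity 0) := by
    have hcont : Continuous fun w : ℂ × ℂ => (‖w.1‖ ^ 2 + (1 + ‖w.2‖ ^ 2)⁻¹) / Real.pi ^ 2 := by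
      have : ∀ w : ℂ × ℂ, 1 + ‖w.2‖ ^ 2 ≠ 0 := fun w => by positivity
      fun_prop (disch := assumption)
    simp only [funext volumeDensity_zero]
    exact hcont.measurable.ennreal_ofReal
  rw [lintegral_modelMeasure m (by fun_prop), HermitianMetric.energy, volumeMeasure_eq,
    (measurableEmbedding_param 0).lintegral_map]
  simp only [F.normSq_param]
  have hp := (contDiff_localPotential 0).continuous
  rw [lintegral_withDensity_eq_lintegral_mul _ hm (by fun_prop)]
  refine lintegral_congr fun w => ?_
  rw [Pi.mul_apply, volumeDensity_zero, weight_eq, ← ENNReal.ofReal_mul (by positivity),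
    ← ENNReal.ofReal_mul (by positivity)]
  ring_nf

theorem scalarProduct_eq (s t : L.sections) :
    H.scalarProduct s t = ∫ w, F.coeff s 0 w * conj (F.coeff t 0 w) ∂modelMeasure m := by
  have hm : Measurable fun w : ℂ × ℂ =>
      ((‖w.1‖ ^ 2 + (1 + ‖w.2‖ ^ 2)⁻¹) / Real.pi ^ 2).toNNReal := by
    have hcont : Continuous fun w : ℂ × ℂ => (‖w.1‖ ^ 2 + (1 + ‖w.2‖ ^ 2)⁻¹) / Real.pi ^ 2 := by
      have : ∀ w : ℂ × ℂ, 1 + ‖w.2‖ ^ 2 ≠ 0 := fun w => by positivity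
      fun_prop (disch := assumption)
    exact hcont.measurable.real_toNNReal
  rw [integral_modelMeasure, HermitianMetric.scalarProduct, volumeMeasure_eq,
    (measurableEmbedding_param 0).integral_map]
  simp only [F.pairing_param, funext volumeDensity_zero]
  refine (integral_withDensity_eq_integral_smul hm _).trans ?_
  refine integral_congr_ae (Filter.Eventually.of_forall fun w => ?_)
  simp only [NNReal.smul_def, Complex.real_smul, weight_eq]
  rw [Real.coe_toNNReal _ (by positivity)]
  push_cast
  ring

theorem energy_lt_top_iff (s : L.sections) :
    H.energy s < ⊤ ↔ MemLp (F.coeff s 0) 2 (modelMeasure m) := by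
  rw [memLp_two_iff ((F.isModelSection_coeff s).diff 0).continuous, F.energy_eq]

theorem energy_sub_eq {s t : L.sections} (hs : MemLp (F.coeff s 0) 2 (modelMeasure m))
    (ht : MemLp (F.coeff t 0) 2 (modelMeasure m)) :
    H.energy (s - t) = edist hs.toLp ht.toLp ^ 2 := by
  have h := eLpNorm_nnreal_pow_eq_lintegral (p := 2) (μ := modelMeasure m)
    (f := F.coeff s 0 - F.coeff t 0) two_ne_zero
  have h' : eLpNorm (F.coeff s 0 - F.coeff t 0) 2 (modelMeasure m) ^ 2 =
      ∫⁻ w, ‖(F.coeff s 0 - F.coeff t 0) w‖ₑ ^ (2 : ℝ) ∂modelMeasure m := by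
    simpa using h
  rw [Lp.edist_toLp_toLp, h', F.energy_eq, map_sub]
  refine lintegral_congr fun w => ?_
  rw [ENNReal.ofReal_pow (norm_nonneg _), ofReal_norm]
  norm_cast

/-- The frames identify the span of a family of square integrable sections with the span of the
corresponding family in `L²`. -/
theorem exists_toLp_mem_span {κ : Type} {s : κ → L.sections}
    (hs : ∀ a, MemLp (F.coeff (s a) 0) 2 (modelMeasure m)) {t : L.sections}
    (ht : t ∈ Submodule.span ℂ (range s)) :
    ∃ h : MemLp (F.coeff t 0) 2 (modelMeasure m),
      h.toLp ∈ Submodule.span ℂ (range fun a => (hs a).toLp) := by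
  induction ht using Submodule.span_induction with
  | mem x hx =>
    obtain ⟨a, rfl⟩ := hx
    exact ⟨hs a, Submodule.subset_span ⟨a, rfl⟩⟩
  | zero =>
    have e : F.coeff 0 0 = 0 := by rw [map_zero]; rfl
    refine ⟨e ▸ MemLp.zero, ?_⟩
    simp only [e]
    rw [MemLp.toLp_zero]
    exact Submodule.zero_mem _
  | add x y _ _ hx hy =>
    obtain ⟨hx1, hx2⟩ := hx
    obtain ⟨hy1, hy2⟩ := hy
    have e : F.coeff (x + y) 0 = F.coeff x 0 + F.coeff y 0 := by rw [map_add]; rfl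
    refine ⟨e ▸ hx1.add hy1, ?_⟩
    simp only [e]
    rw [MemLp.toLp_add hx1 hy1]
    exact Submodule.add_mem _ hx2 hy2
  | smul k x _ hx =>
    obtain ⟨hx1, hx2⟩ := hx
    have e : F.coeff (k • x) 0 = k • F.coeff x 0 := by rw [map_smul]; rfl
    refine ⟨e ▸ hx1.const_smul k, ?_⟩
    simp only [e]
    rw [MemLp.toLp_const_smul k hx1]
    exact Submodule.smul_mem _ _ hx2

theorem exists_mem_span_toLp_eq {κ : Type} {s : κ → L.sections}
    (hs : ∀ a, MemLp (F.coeff (s a) 0) 2 (modelMeasure m)) {y : Lp ℂ 2 (modelMeasure m)}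
    (hy : y ∈ Submodule.span ℂ (range fun a => (hs a).toLp)) :
    ∃ t ∈ Submodule.span ℂ (range s), ∃ h : MemLp (F.coeff t 0) 2 (modelMeasure m),
      h.toLp = y := by
  induction hy using Submodule.span_induction with
  | mem x hx =>
    obtain ⟨a, rfl⟩ := hx
    exact ⟨s a, Submodule.subset_span ⟨a, rfl⟩, hs a, rfl⟩
  | zero =>
    have e : F.coeff 0 0 = 0 := by rw [map_zero]; rfl
    refine ⟨0, Submodule.zero_mem _, e ▸ MemLp.zero, ?_⟩
    simp only [e]
    exact MemLp.toLp_zero _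
  | add x y _ _ hx hy =>
    obtain ⟨t, ht, h1, rfl⟩ := hx
    obtain ⟨t', ht', h1', rfl⟩ := hy
    have e : F.coeff (t + t') 0 = F.coeff t 0 + F.coeff t' 0 := by rw [map_add]; rfl
    refine ⟨t + t', Submodule.add_mem _ ht ht', e ▸ h1.add h1', ?_⟩
    simp only [e]
    exact MemLp.toLp_add h1 h1'
  | smul k x _ hx =>
    obtain ⟨t, ht, h1, rfl⟩ := hx
    have e : F.coeff (k • t) 0 = k • F.coeff t 0 := by rw [map_smul]; rfl
    refine ⟨k • t, Submodule.smul_mem _ _ ht, e ▸ h1.const_smul k, ?_⟩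
    simp only [e]
    exact MemLp.toLp_const_smul k h1

end UnitaryFrames

/-! ### The epsilon function -/

namespace UnitaryFrames

variable {L : LineBundle} {H : HermitianMetric L} {m : ℕ}

/-- The sum over any orthonormal basis is `m²`: by Parseval's identity it is `exp (-m φ)` times the
squared norm of the vector that represents the evaluation at the point. -/
theorem hasSum_normSq (F : UnitaryFrames H m) (hm : 1 ≤ m) {κ : Type} {s : κ → L.sections}
    (hs : H.IsOrthonormalBasis s) (x : BlowUp) :
    HasSum (fun a => H.normSq (s a) x) ((m : ℝ) ^ 2) := by
  classical
  have hL2 : ∀ a, MemLp (F.coeff (s a) 0) 2 (modelMeasure m) := fun a =>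
    (F.energy_lt_top_iff _).mp (hs.finite a)
  have hv : Orthonormal ℂ fun a => (hL2 a).toLp := by
    rw [orthonormal_iff_ite]
    intro a b
    rw [inner_toLp, ← F.scalarProduct_eq]
    split_ifs with h
    · rw [h]; exact hs.norm_one b
    · exact hs.orthogonal b a (Ne.symm h)
  obtain ⟨i, hi⟩ := exists_mem_chartDomain x
  rw [← param_coord i x hi]
  set w := coord i x
  obtain ⟨K, hK, hKn, hKt⟩ := exists_reproducing hm i w
  have hsub : (Submodule.span ℂ (range (basisLp hm))).topologicalClosure ≤
      (Submodule.span ℂ (range fun a => (hL2 a).toLp)).topologicalClosure := by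
    refine Submodule.topologicalClosure_minimal _ ?_ (Submodule.isClosed_topologicalClosure _)
    rw [Submodule.span_le]
    rintro _ ⟨n, rfl⟩
    obtain ⟨t, ht⟩ := F.exists_coeff_eq (isModelSection_basisSection n)
    have htL : MemLp (F.coeff t 0) 2 (modelMeasure m) := by
      rw [ht]; exact memLp_basisSection hm n
    have hte : basisLp hm n = htL.toLp := by simp only [basisLp, ht]
    change basisLp hm n ∈ closure _
    rw [EMetric.mem_closure_iff]
    intro ε hε
    obtain ⟨t', ht', hlt⟩ := hs.dense t ((F.energy_lt_top_iff t).mpr htL) (ε ^ 2)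
      (pos_iff_ne_zero.mpr (pow_ne_zero 2 hε.ne'))
    obtain ⟨h1, h2⟩ := F.exists_toLp_mem_span hL2 ht'
    refine ⟨h1.toLp, h2, ?_⟩
    rw [hte]
    rw [F.energy_sub_eq htL h1] at hlt
    by_contra hle
    exact absurd hlt (not_lt.mpr (pow_le_pow_left' (not_lt.mp hle) 2))
  have h1 := (hasSum_norm_inner_sq hv (hsub hK)).mul_right (Real.exp (-(m * localPotential i w)))
  rw [hKn, mul_assoc, ← Real.exp_add, add_neg_cancel, Real.exp_zero, mul_one] at h1
  refine h1.congr_fun fun a => ?_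
  rw [F.normSq_param, ← inner_conj_symm, RCLike.norm_conj,
    hKt _ (F.isModelSection_coeff (s a)) (hL2 a)]

theorem exists_isOrthonormalBasis (F : UnitaryFrames H m) (hm : 1 ≤ m) :
    ∃ s : MonomialIndex m → L.sections, H.IsOrthonormalBasis s := by
  classical
  choose s hs using fun n : MonomialIndex m => F.exists_coeff_eq (isModelSection_basisSection n)
  have hL2 : ∀ n, MemLp (F.coeff (s n) 0) 2 (modelMeasure m) := fun n => by
    rw [hs]; exact memLp_basisSection hm n
  have he : basisLp hm = fun n => (hL2 n).toLp := by
    funext n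
    simp only [basisLp, hs]
  have hv := orthonormal_iff_ite.mp (basisLp_orthonormal hm)
  have hsp : ∀ a b, H.scalarProduct (s a) (s b) = if b = a then 1 else 0 := by
    intro a b
    rw [F.scalarProduct_eq, ← inner_toLp (hL2 b) (hL2 a), ← hv b a, he]
  refine ⟨s, fun a => (F.energy_lt_top_iff _).mpr (hL2 a), fun a => by rw [hsp, if_pos rfl],
    fun a b hab => by rw [hsp, if_neg (Ne.symm hab)], fun t ht δ hδ => ?_⟩
  have htL := (F.energy_lt_top_iff t).mp ht
  have hmem := toLp_mem_closure_span hm (F.isModelSection_coeff t) htL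
  rw [he] at hmem
  obtain ⟨y, hy, hlt⟩ := EMetric.mem_closure_iff.mp hmem (δ ^ (2⁻¹ : ℝ))
    (ENNReal.rpow_pos_of_nonneg hδ (by norm_num))
  obtain ⟨t', ht', h1, rfl⟩ := F.exists_mem_span_toLp_eq hL2 hy
  refine ⟨t', ht', ?_⟩
  rw [F.energy_sub_eq htL h1]
  have h2 := (ENNReal.lt_rpow_inv_iff (by norm_num : (0 : ℝ) < 2)).mp hlt
  exact_mod_cast h2

end UnitaryFrames

namespace HermitianMetric

variable {L : LineBundle} {H : HermitianMetric L} {m : ℕ}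

theorem isEpsilonFunction_sq (hR : H.HasRicci m) (hm : 1 ≤ m) :
    H.IsEpsilonFunction fun _ => (m : ℝ) ^ 2 := by
  obtain ⟨F⟩ := exists_unitaryFrames hR
  obtain ⟨s, hs⟩ := F.exists_isOrthonormalBasis hm
  exact ⟨_, s, hs, F.hasSum_normSq hm hs⟩

theorem IsEpsilonFunction.eq_sq (hR : H.HasRicci m) (hm : 1 ≤ m) {e : BlowUp → ℝ}
    (he : H.IsEpsilonFunction e) (x : BlowUp) : e x = (m : ℝ) ^ 2 := by
  obtain ⟨F⟩ := exists_unitaryFrames hR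
  obtain ⟨κ, s, hs, hsum⟩ := he
  exact (hsum x).unique (F.hasSum_normSq hm hs x)

end HermitianMetric

end Simanca

namespace Simanca

/-! ### The geometric quantization `O(-E)` -/

open Set

/-- The homogeneous coordinates of the point of `ℂP¹` under `x`. -/
def homCoord : Fin 2 → BlowUp → ℂ
  | 0, x => x.1.2.rep.1
  | 1, x => x.1.2.rep.2

/-- The homogeneous coordinates in the chart `c`, normalized by `t_c = 1`. -/
def chartHomCoord (c i : Fin 2) (w : ℂ × ℂ) : ℂ := if i = c then 1 else fibreCoord c w

theorem mem_chartDomain_iff (i : Fin 2) (x : BlowUp) : x ∈ chartDomain i ↔ homCoord i x ≠ 0 := by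
  fin_cases i <;> rfl

theorem exists_homCoord_param (c : Fin 2) (w : ℂ × ℂ) :
    ∃ a : ℂ, a ≠ 0 ∧ ∀ i, homCoord i (param c w) = a * chartHomCoord c i w := by
  have key : ∀ (t : ℂ × ℂ) (ht : t ≠ 0), ∃ a : ℂ, a ≠ 0 ∧
      (Projectivization.mk ℂ t ht).rep.1 = a * t.1 ∧
      (Projectivization.mk ℂ t ht).rep.2 = a * t.2 := by
    intro t ht
    obtain ⟨a, ha⟩ := Projectivization.exists_smul_eq_mk_rep ℂ t ht
    exact ⟨a, a.ne_zero, by rw [← ha]; rfl, by rw [← ha]; rfl⟩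
  fin_cases c
  · obtain ⟨a, h0, h1, h2⟩ := key ((1 : ℂ), w.2) (by simp [Prod.ext_iff])
    refine ⟨a, h0, fun i => ?_⟩
    fin_cases i
    · exact h1
    · exact h2
  · obtain ⟨a, h0, h1, h2⟩ := key (w.1, (1 : ℂ)) (by simp [Prod.ext_iff])
    refine ⟨a, h0, fun i => ?_⟩
    fin_cases i
    · exact h1
    · exact h2

theorem param_mem_chartDomain_iff (c i : Fin 2) (w : ℂ × ℂ) :
    param c w ∈ chartDomain i ↔ chartHomCoord c i w ≠ 0 := by
  obtain ⟨a, ha, h⟩ := exists_homCoord_param c w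
  rw [mem_chartDomain_iff, h, mul_ne_zero_iff, and_iff_right ha]

theorem homCoord_div_param (c i j : Fin 2) (w : ℂ × ℂ) :
    homCoord j (param c w) / homCoord i (param c w) =
      chartHomCoord c j w / chartHomCoord c i w := by
  obtain ⟨a, ha, h⟩ := exists_homCoord_param c w
  rw [h, h, mul_div_mul_left _ _ ha]

theorem differentiable_chartHomCoord (c i : Fin 2) : Differentiable ℂ (chartHomCoord c i) := by
  fin_cases c <;> fin_cases i
  · exact differentiable_const 1
  · exact differentiable_snd
  · exact differentiable_fst
  · exact differentiable_const 1

theorem contDiff_chartHomCoord (c i : Fin 2) : ContDiff ℝ ∞ (chartHomCoord c i) := by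
  fin_cases c <;> fin_cases i
  · exact contDiff_const (c := (1 : ℂ))
  · exact contDiff_snd
  · exact contDiff_fst
  · exact contDiff_const (c := (1 : ℂ))

/-- On the overlap of the charts the local potentials differ by a pluriharmonic function. -/
theorem localPotential_coord_param {c i : Fin 2} {w : ℂ × ℂ} (h : chartHomCoord c i w ≠ 0) :
    localPotential i (coord i (param c w)) =
      localPotential c w - Real.log (‖chartHomCoord c i w‖ ^ 2) := by
  have diag : ∀ c, localPotential c (coord c (param c w)) =
      localPotential c w - Real.log (‖chartHomCoord c c w‖ ^ 2) := fun c => by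
    simp [coord_param, chartHomCoord]
  fin_cases c <;> fin_cases i
  · exact diag 0
  · replace h : w.2 ≠ 0 := h
    change localPotential 1 (coord 1 (param 0 w)) =
      localPotential 0 w - Real.log (‖w.2‖ ^ 2)
    rw [← param_chartChange h, coord_param, localPotential_chartChange h]
  · replace h : w.1 ≠ 0 := h
    change localPotential 0 (coord 0 (param 1 w)) =
      localPotential 1 w - Real.log (‖w.1‖ ^ 2)
    obtain ⟨v, hv, rfl⟩ := exists_eq_chartChange h
    have hv2 : v.2 ≠ 0 := by rw [hv]; exact inv_ne_zero h
    have h1 : (chartChange v).1 = v.2⁻¹ := rfl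
    rw [param_chartChange hv2, coord_param, localPotential_chartChange hv2, h1, norm_inv, inv_pow,
      Real.log_inv]
    ring
  · exact diag 1

/-- The line bundle `O(-E)`, the pull-back of the hyperplane bundle `O(1)` of `ℂP¹`, with the
transition functions `t_j / t_i`. -/
def prequantumBundle : LineBundle where
  ι := Fin 2
  U := chartDomain
  isOpen_U := isOpen_chartDomain
  exists_mem := exists_mem_chartDomain
  g i j x := homCoord j x / homCoord i x
  holomorphic i j c := by
    simp only [homCoord_div_param]
    intro w hw
    have h : DifferentiableAt ℂ (fun v => (chartHomCoord c i v)⁻¹) w :=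
      (differentiable_chartHomCoord c i w).fun_inv ((param_mem_chartDomain_iff c i w).mp hw.1)
    simp only [div_eq_mul_inv]
    exact ((differentiable_chartHomCoord c j w).fun_mul h).differentiableWithinAt
  ne_zero i j x hx :=
    div_ne_zero ((mem_chartDomain_iff j x).mp hx.2) ((mem_chartDomain_iff i x).mp hx.1)
  cocycle i j k x hx := by
    have hj := (mem_chartDomain_iff j x).mp hx.1.2
    have hi := (mem_chartDomain_iff i x).mp hx.1.1
    field_simp

/-- The metrics `exp (-m φ)` match under the transition functions of `O(-m E)`. -/
theorem exp_localPotential_coord (m : ℕ) (i j : Fin 2) (x : BlowUp)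
    (hx : x ∈ chartDomain i ∩ chartDomain j) :
    Real.exp (-(m * localPotential j (coord j x))) =
      ‖(homCoord j x / homCoord i x) ^ m‖ ^ 2 *
        Real.exp (-(m * localPotential i (coord i x))) := by
  obtain ⟨c, hc⟩ := exists_mem_chartDomain x
  rw [← param_coord c x hc] at hx ⊢
  set w := coord c x
  have hi := (param_mem_chartDomain_iff c i w).mp hx.1
  have hj := (param_mem_chartDomain_iff c j w).mp hx.2
  have hexp : ∀ k, chartHomCoord c k w ≠ 0 →
      Real.exp (-(m * localPotential k (coord k (param c w)))) =
      Real.exp (-(m * localPotential c w)) * (‖chartHomCoord c k w‖ ^ 2) ^ m := by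
    intro k hk
    have : 0 < ‖chartHomCoord c k w‖ ^ 2 := by positivity
    rw [localPotential_coord_param hk, mul_sub, neg_sub, sub_eq_neg_add, Real.exp_add,
      Real.exp_nat_mul (Real.log _), Real.exp_log this]
  rw [hexp i hi, hexp j hj, homCoord_div_param, norm_pow, norm_div]
  have : ‖chartHomCoord c i w‖ ≠ 0 := norm_ne_zero_iff.mpr hi
  rw [div_pow, div_pow, ← pow_mul, ← pow_mul, ← pow_mul, ← pow_mul, mul_comm 2 m]
  field_simp

/-- The Hermitian metrics `exp (-m φ)` on the powers of the prequantum bundle. -/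
def prequantumMetric (m : ℕ) : HermitianMetric (prequantumBundle.pow m) where
  h i x := Real.exp (-(m * localPotential i (coord i x)))
  pos _ _ _ := Real.exp_pos _
  smooth i c := by
    have h1 : ∀ w ∈ param c ⁻¹' chartDomain i,
        Real.exp (-(m * localPotential i (coord i (param c w)))) =
        Real.exp (-(m * (localPotential c w - Real.log (‖chartHomCoord c i w‖ ^ 2)))) :=
      fun w hw => by rw [localPotential_coord_param ((param_mem_chartDomain_iff c i w).mp hw)]
    refine ContDiffOn.congr ?_ h1
    have h3 : ContDiffOn ℝ ∞ (fun w => Real.log (‖chartHomCoord c i w‖ ^ 2))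
        (param c ⁻¹' chartDomain i) :=
      ((contDiff_chartHomCoord c i).norm_sq ℝ).contDiffOn.log fun w hw =>
        pow_ne_zero 2 (norm_ne_zero_iff.mpr ((param_mem_chartDomain_iff c i w).mp hw))
    exact (contDiffOn_const.mul ((contDiff_localPotential c).contDiffOn.sub h3)).neg.exp
  compat i j x hx := exp_localPotential_coord m i j x hx

theorem hasRicci_prequantumMetric (m : ℕ) : (prequantumMetric m).HasRicci m := by
  intro i c w hw
  have hw' : chartHomCoord c i w ≠ 0 := (param_mem_chartDomain_iff c i w).mp hw
  have hcont := (differentiable_chartHomCoord c i).continuous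
  have h1 : (fun v => Real.log ((prequantumMetric m).h i (param c v))) =ᶠ[nhds w]
      fun v => (-(m : ℝ)) * localPotential c v + m * Real.log (‖chartHomCoord c i v‖ ^ 2) := by
    filter_upwards [hcont.continuousAt.eventually_ne hw'] with v hv
    change Real.log (Real.exp (-(m * localPotential i (coord i (param c v))))) = _
    rw [Real.log_exp, localPotential_coord_param hv]
    ring
  have hpot : ContDiffAt ℝ 2 (localPotential c) w :=
    (contDiff_localPotential c).contDiffAt.of_le two_le_infty
  have hlog : ContDiffAt ℝ 2 (fun v => Real.log (‖chartHomCoord c i v‖ ^ 2)) w := by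
    have h2 : ContDiff ℝ 2 (chartHomCoord c i) := (contDiff_chartHomCoord c i).of_le two_le_infty
    exact (h2.norm_sq ℝ).contDiffAt.log (pow_ne_zero 2 (norm_ne_zero_iff.mpr hw'))
  have hzero : ddbar (fun v => Real.log (‖chartHomCoord c i v‖ ^ 2)) w = 0 := by
    by_cases hic : i = c
    · have h3 : (fun v => Real.log (‖chartHomCoord c i v‖ ^ 2)) = fun _ => (0 : ℝ) := by
        funext v
        simp [chartHomCoord, hic]
      rw [h3]
      ext j k
      have h4 : (dzbar k fun _ : ℂ × ℂ => ((0 : ℝ) : ℂ)) = fun _ => 0 := by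
        funext v
        simp [dzbar]
      simp only [ddbar, Matrix.of_apply, h4]
      simp [dz]
    · have h3 : chartHomCoord c i = fibreCoord c := funext fun v => if_neg hic
      rw [h3] at hw' ⊢
      exact ddbar_log_norm_sq_fibreCoord c hw'
  rw [ddbar_congr h1, ddbar_add_apply (contDiffAt_const.mul hpot) (contDiffAt_const.mul hlog),
    ddbar_const_mul _ hpot, ddbar_const_mul _ hlog, hzero, simancaForm]
  simp

/-- A geometric quantization of the blow-up with the Simanca metric. -/
def prequantization : GeometricQuantization where
  L := prequantumBundle
  h := prequantumMetric
  ricci m _ := hasRicci_prequantumMetric m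

/-! ### The Tian-Yau-Zelditch expansion -/

section Expansion

variable {eps : ℕ → BlowUp → ℝ}

theorem isTYZExpansion_of_eq_sq (h : ∀ m : ℕ, 1 ≤ m → ∀ x, eps m x = (m : ℝ) ^ 2) :
    IsTYZExpansion eps fun j _ => if j = 0 then 1 else 0 where
  smooth_eps m hm c := by
    simp only [h m hm]
    exact contDiffOn_const
  smooth_coeff j c := contDiffOn_const
  asymptotic c K _ r N := by
    refine ⟨0, fun m hm w _ => ?_⟩
    have h1 : (fun v => eps m (param c v) - ∑ j ∈ Finset.range (N + 1),
        (if j = 0 then (1 : ℝ) else 0) * (m : ℝ) ^ (2 - (j : ℤ))) = fun _ => 0 := by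
      funext v
      rw [Finset.sum_eq_single 0 (fun j _ hj => by simp [hj]) (fun h0 => absurd h0 (by simp)),
        h m hm]
      simp
    rw [h1]
    have h2 : iteratedFDeriv ℝ r (fun _ : ℂ × ℂ => (0 : ℝ)) = 0 := iteratedFDeriv_fun_zero
    rw [h2]
    simp

/-- The coefficients of an expansion are unique: the difference of two expansions whose terms
agree up to order `N - 1` is `O(m^{1-N})`, and its leading term is of order `m^{2-N}`. -/
theorem IsTYZExpansion.coeff_eq (h : ∀ m : ℕ, 1 ≤ m → ∀ x, eps m x = (m : ℝ) ^ 2)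
    {a : ℕ → BlowUp → ℝ} (ha : IsTYZExpansion eps a) (x : BlowUp) (N : ℕ) :
    a N x = if N = 0 then 1 else 0 := by
  induction N using Nat.strong_induction_on with
  | _ N ih =>
    obtain ⟨c, hc⟩ := exists_mem_chartDomain x
    obtain ⟨C, hC⟩ := ha.asymptotic c {coord c x} isCompact_singleton 0 N
    have hsum : ∀ m : ℕ, 1 ≤ m → (m : ℝ) ^ 2 - ∑ j ∈ Finset.range (N + 1),
        a j x * (m : ℝ) ^ (2 - (j : ℤ)) =
        ((if N = 0 then 1 else 0) - a N x) * (m : ℝ) ^ (2 - (N : ℤ)) := by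
      intro m hm
      rw [Finset.sum_range_succ]
      have h1 : ∑ j ∈ Finset.range N, a j x * (m : ℝ) ^ (2 - (j : ℤ)) =
          if N = 0 then 0 else (m : ℝ) ^ 2 := by
        rw [Finset.sum_congr rfl fun j hj => by rw [ih j (Finset.mem_range.mp hj)]]
        split_ifs with hN
        · simp [hN]
        · rw [Finset.sum_eq_single 0 (fun j _ hj => by simp [hj])
            (fun h0 => absurd (Finset.mem_range.mpr (Nat.pos_of_ne_zero hN)) h0)]
          simp
      rw [h1]
      split_ifs with hN
      · subst hN
        simp only [Nat.cast_zero, sub_zero]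
        have : (m : ℝ) ^ (2 : ℤ) = (m : ℝ) ^ 2 := by norm_cast
        rw [this]
        ring
      · ring
    have hbound : ∀ m : ℕ, 1 ≤ m → |(if N = 0 then 1 else 0) - a N x| * m ≤ C := by
      intro m hm
      have hm' : (0 : ℝ) < m := by exact_mod_cast hm
      have h1 := hC m hm (coord c x) rfl
      simp only [norm_iteratedFDeriv_zero, param_coord c x hc] at h1
      rw [h m hm, hsum m hm, norm_mul, Real.norm_eq_abs, Real.norm_of_nonneg (by positivity)] at h1
      have h2 : (m : ℝ) ^ (2 - (N : ℤ)) = m * (m : ℝ) ^ (2 - ((N : ℤ) + 1)) := by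
        rw [← zpow_one_add₀ hm'.ne']
        congr 1
        ring
      rw [h2, ← mul_assoc] at h1
      exact le_of_mul_le_mul_right h1 (by positivity)
    by_contra hne
    have hpos : 0 < |(if N = 0 then 1 else 0) - a N x| :=
      abs_pos.mpr (sub_ne_zero.mpr (Ne.symm hne))
    obtain ⟨m, hm⟩ := exists_nat_gt (C / |(if N = 0 then 1 else 0) - a N x|)
    have h1 := hbound (m + 1) (by omega)
    rw [div_lt_iff₀ hpos] at hm
    push_cast at h1
    nlinarith

end Expansion

end Simanca

end

theorem corollary2 :
    Nonempty Simanca.GeometricQuantization ∧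
    ∀ Q : Simanca.GeometricQuantization,
      (∃ eps : ℕ → Simanca.BlowUp → ℝ, Q.IsEpsilon eps) ∧
      ∀ eps : ℕ → Simanca.BlowUp → ℝ, Q.IsEpsilon eps →
        (∀ m : ℕ, 1 ≤ m → ∀ x, eps m x = (m : ℝ) ^ 2) ∧
        (∃ a : ℕ → Simanca.BlowUp → ℝ, Simanca.IsTYZExpansion eps a) ∧
        ∀ a : ℕ → Simanca.BlowUp → ℝ, Simanca.IsTYZExpansion eps a →
          (∀ x, a 0 x = 1) ∧ ∀ j : ℕ, 1 ≤ j → ∀ x, a j x = 0 := by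
  refine ⟨⟨Simanca.prequantization⟩, fun Q => ⟨⟨fun m _ => (m : ℝ) ^ 2, fun m hm =>
    Simanca.HermitianMetric.isEpsilonFunction_sq (Q.ricci m hm) hm⟩, fun eps heps => ?_⟩⟩
  have h : ∀ m : ℕ, 1 ≤ m → ∀ x, eps m x = (m : ℝ) ^ 2 := fun m hm x =>
    (heps m hm).eq_sq (Q.ricci m hm) hm x
  refine ⟨h, ⟨_, Simanca.isTYZExpansion_of_eq_sq h⟩, fun a ha => ⟨fun x => ?_, fun j hj x => ?_⟩⟩
  · simpa using ha.coeff_eq h x 0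
  · rw [ha.coeff_eq h x j, if_neg (by omega)]
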